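/- Let $m\ge 1$, let $\mathcal P_n$ be the space of complex polynomials of degree at most $n$ in $m$ variables and $m_n=\dim\mathcal P_n=\binom{m+n}{n}$. Let $Y\subset\mathbb C^m$ be closed, unbounded and not pluripolar. Let $Q:Y\to\mathbb R$ be continuous and super-logarithmic: for some $b>0$, $Q(z)-(1+b)\log|z|\to+\infty$ as $|z|\to\infty$, $z\in Y$. Let $\tau$ be a locally finite positive Borel measure on $Y$ with $\int_{Y\cap\{|z|\ge 1\}}|z|^{-a}\,d\tau<\infty$ for some $a>0$, such that for all sufficiently large $r$ the triple $(Y_r,Q,\tau)$, $Y_r=\{z\in Y:|z|\le r\}$, has the weighted Bernstein–Markov property: there are $M_n$ (which may depend on $r$) with $\limsup_n M_n^{1/n}=1$ and $$\max_{Y_r}|p|e^{-nQ}\le M_n\Bigl(\int_{Y_r}|p|^2e^{-2nQ}\,d\tau\Bigr)^{1/2}\qquad(p\in\mathcal P_n,\ n\ge1).$$ Write $\|f\|_Y=\sup_Y|f|$ and define, for $z\in\mathbb C^m$, $$\phi_n(z)=\sup\{|g(z)|:g\in\mathcal P_n,\ \|ge^{-nQ}\|_Y\le1\},\qquad V_{Y,Q}(z)=\sup\Bigl\{\tfrac1{\deg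 p}\log|p(z)|:\deg p\ge 1,\ \|pe^{-(\deg p)Q}\|_Y\le1\Bigr\},$$ and let $f^*(z)=\limsup_{\zeta\to z}f(\zeta)$ be the upper semicontinuous regularization. For an orthonormal basis $(p^{(n)}_\nu)_{|\nu|\le n}$ of $\mathcal P_n$ in $L^2(e^{-2nQ}\tau)$ put $S_n(z,z)=\sum_{|\nu|\le n}|p^{(n)}_\nu(z)|^2$. Then: (i) For all sufficiently large $n$, $\mathcal P_n\subset L^2(e^{-2nQ}\tau)$ and $\mathcal P_n$ has an orthonormal basis in this space. (ii) For every $\epsilon>0$ there are constants $C_1,C_2>0$ such that for every $n\ge1$ for which $\mathcal P_n$ has an orthonormal basis in $L^2(e^{-2nQ}\tau)$ (by (i), for all large $n$), for every such basis and every $z\in\mathbb C^m$, $$\frac1{C_1(1+\epsilon)^{2n}m_n}\le\frac{S_n(z,z)}{\phi_n(z)^2}\le C_2(1+\epsilon)^{2n}m_n .$$ Now let orthonormal bases $(p^{(n)}_\nu)_{|\nu|\le n}$ as above be chosen for all large $n$. All limits below are as $n\to\infty$. (iii) $\lim_{n}\frac1{2n}\log S_n(z,z)=V_{Y,Q}(z)$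 for every $z\in\mathbb C^m$. (iv) Let $a^{(n)}_\nu$ ($|\nu|\le n$, $n=1,2,\dots$) be i.i.d. complex random variables whose law has a density $\phi$ with respect to Lebesgue measure on $\mathbb C$ (or, for real random variables, on $\mathbb R$) such that for some $T>0$, $\phi\le T$ and $\mathrm{Prob}(|a^{(n)}_\nu|\ge R)\le T/R^2$ for all sufficiently large $R$; let $H_n=\sum_{|\nu|\le n}a^{(n)}_\nu p^{(n)}_\nu$. Then almost surely $$\Bigl(\limsup_{n}\tfrac1n\log|H_n|\Bigr)^*(z)=V^*_{Y,Q}(z)\quad\text{for all }z\in\mathbb C^m ,$$ and almost surely $\frac1n\log|H_n|\to V^*_{Y,Q}$ in $L^1_{loc}(\mathbb C^m)$ and $dd^c\bigl(\frac1n\log|H_n|\bigr)\to dd^cV^*_{Y,Q}$ as positive currents, where $dd^c=\frac i\pi\partial\overline\partial$. (v) Let $1\le k\le m$, let $a^{(n,j)}_\nu$ ($1\le j\le k$, $|\nu|\le n$, $n=1,2,\dots$) be i.i.d. with a law as in (iv), let $H^{(j)}_n=\sum_{|\nu|\le n}a^{(n,j)}_\nu p^{(n)}_\nu$ and $\|F_n\|^2=\sum_{j=1}^k|H^{(j)}_n|^2$.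 Then almost surely $\bigl(\limsup_n\frac1n\log\|F_n\|\bigr)^*(z)=V^*_{Y,Q}(z)$ for all $z\in\mathbb C^m$, and almost surely $\frac1n\log\|F_n\|\to V^*_{Y,Q}$ in $L^1_{loc}(\mathbb C^m)$ and $dd^c\bigl(\frac1n\log\|F_n\|\bigr)\to dd^cV^*_{Y,Q}$ as positive currents. -/

import Mathlib

open Filter Topology MeasureTheory ProbabilityTheory
open scoped NNReal ENNReal ComplexConjugate

noncomputable section

namespace Pluripotential

/-- `ℂ^m` with its Euclidean norm, Borel σ-algebra and Lebesgue measure. -/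
abbrev Cn (m : ℕ) : Type := EuclideanSpace ℂ (Fin m)

/-- Value of a polynomial in `m` complex variables at a point of `ℂ^m`. -/
def peval {m : ℕ} (p : MvPolynomial (Fin m) ℂ) (z : Cn m) : ℂ :=
  MvPolynomial.eval (fun i => z i) p

/-- The multi-indices `ν ∈ ℕ^m` with `|ν| ≤ n` (each entry is then at most `n`). -/
abbrev MultiIndex (m n : ℕ) : Type :=
  {ν : Fin m → Fin (n + 1) // ∑ i, (ν i : ℕ) ≤ n}

/-! ### Plurisubharmonic functions and pluripolar sets -/

/-- Plurisubharmonic functions on `ℂ^m`, with values in `[-∞, ∞)`: upper semicontinuous functions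
with `u(a) ≤ (2π)⁻¹ ∫_0^{2π} u(a + e^{iθ} b) dθ` for all `a, b`.  As `u` is bounded above on
circles, the mean is written as `M - (2π)⁻¹ ∫ (M - u)` with any upper bound `M`, so that only
the integral of a nonnegative function occurs. -/
structure IsPlurisubharmonic {m : ℕ} (u : Cn m → EReal) : Prop where
  ne_top : ∀ z, u z ≠ ⊤
  usc : UpperSemicontinuous u
  submean : ∀ (a b : Cn m) (M : ℝ),
    (∀ θ : ℝ, u (a + Complex.exp (θ * Complex.I) • b) ≤ (M : EReal)) →
    u a ≤ (M : EReal) -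
      (((ENNReal.ofReal (2 * Real.pi))⁻¹ *
        ∫⁻ θ in Set.Ioc 0 (2 * Real.pi),
          ((M : EReal) - u (a + Complex.exp ((θ : ℝ) * Complex.I) • b)).toENNReal : ℝ≥0∞) : EReal)

/-- A set is pluripolar if it lies in the `-∞`-set of a plurisubharmonic function `≢ -∞`. -/
def IsPluripolar {m : ℕ} (E : Set (Cn m)) : Prop :=
  ∃ u : Cn m → EReal, IsPlurisubharmonic u ∧ (∃ z, u z ≠ ⊥) ∧ ∀ z ∈ E, u z = ⊥

/-! ### Weights, extremal functions, orthonormal polynomials -/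

/-- `log x` for `x ≥ 0`, with value `-∞` at `0`. -/
def elog (x : ℝ) : EReal := ENNReal.log (ENNReal.ofReal x)

/-- `‖p e^{-nQ}‖_Y ≤ 1`. -/
def WeightedLeOne {m : ℕ} (Y : Set (Cn m)) (Q : Cn m → ℝ) (n : ℕ)
    (p : MvPolynomial (Fin m) ℂ) : Prop :=
  ∀ z ∈ Y, ‖peval p z‖ * Real.exp (-(n * Q z)) ≤ 1

/-- `V_{Y,Q}(z) = sup { (1 / deg p) log |p(z)| : ‖p e^{-(deg p) Q}‖_Y ≤ 1 }`, the supremum being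
over nonconstant polynomials. -/
def extremalFunction {m : ℕ} (Y : Set (Cn m)) (Q : Cn m → ℝ) (z : Cn m) : EReal :=
  ⨆ (p : MvPolynomial (Fin m) ℂ) (_ : 0 < p.totalDegree)
    (_ : WeightedLeOne Y Q p.totalDegree p),
    (((1 : ℝ) / p.totalDegree : ℝ) : EReal) * elog ‖peval p z‖

/-- The upper semicontinuous regularization `f^*(z) = limsup_{ζ → z} f(ζ)`. -/
def uscReg {m : ℕ} (f : Cn m → EReal) (z : Cn m) : EReal :=
  limsup f (𝓝 z)

/-- `φ^{(n)}_{Y,Q}(z) = sup { |g(z)| : g ∈ P_n, ‖g e^{-nQ}‖_Y ≤ 1 }`. -/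
def phi {m : ℕ} (Y : Set (Cn m)) (Q : Cn m → ℝ) (n : ℕ) (z : Cn m) : ℝ :=
  sSup {x : ℝ | ∃ g : MvPolynomial (Fin m) ℂ,
    g.totalDegree ≤ n ∧ WeightedLeOne Y Q n g ∧ x = ‖peval g z‖}

/-- `Q(z) - (1 + b) log |z| → +∞` as `|z| → ∞` in `Y`, for some `b > 0`. -/
def SuperLogarithmic {m : ℕ} (Y : Set (Cn m)) (Q : Cn m → ℝ) : Prop :=
  ∃ b : ℝ, 0 < b ∧
    Tendsto (fun z => Q z - (1 + b) * Real.log ‖z‖) (Bornology.cobounded (Cn m) ⊓ 𝓟 Y) atTop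

/-- The weighted Bernstein–Markov property of `(K, Q, τ)` (for compact `K`):
`‖p e^{-nQ}‖_K ≤ M_n ‖p e^{-nQ}‖_{L²(τ|_K)}` for all `p ∈ P_n`, `n ≥ 1`, where
`limsup M_n^{1/n} = 1`. -/
def WeightedBernsteinMarkov {m : ℕ} (K : Set (Cn m)) (Q : Cn m → ℝ) (τ : Measure (Cn m)) : Prop :=
  ∃ M : ℕ → ℝ≥0,
    limsup (fun n : ℕ => (M n : ℝ≥0∞) ^ ((1 : ℝ) / n)) atTop = 1 ∧
    ∀ n : ℕ, 1 ≤ n → ∀ p : MvPolynomial (Fin m) ℂ, p.totalDegree ≤ n → ∀ z ∈ K,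
      ‖peval p z‖ * Real.exp (-(n * Q z)) ≤
        M n * Real.sqrt (∫ w in K, ‖peval p w‖ ^ 2 * Real.exp (-(2 * n * Q w)) ∂τ)

/-- `p_ν`, `|ν| ≤ n`, is an orthonormal basis of `P_n` in `L²(e^{-2nQ} τ)` (for instance the one
which the Gram–Schmidt process produces from any ordering of the monomials).  The integrands
are integrable: those with `ν = γ` since their integral is not `0`, hence all of them. -/
structure IsOrthonormalBasis {m : ℕ} (Y : Set (Cn m)) (Q : Cn m → ℝ) (τ : Measure (Cn m)) (n : ℕ)
    (p : MultiIndex m n → MvPolynomial (Fin m) ℂ) : Prop where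
  degree_le : ∀ ν, (p ν).totalDegree ≤ n
  orthonormal : ∀ ν γ,
    ∫ z in Y, peval (p ν) z * conj (peval (p γ) z) * (Real.exp (-(2 * n * Q z)) : ℂ) ∂τ
      = if ν = γ then 1 else 0
  span : ∀ q : MvPolynomial (Fin m) ℂ, q.totalDegree ≤ n → q ∈ Submodule.span ℂ (Set.range p)

/-- The Bergman kernel `S_n(z, ζ) = ∑_{|ν| ≤ n} p_ν(z) conj(p_ν(ζ))`. -/
def bergmanKernel {m n : ℕ} (p : MultiIndex m n → MvPolynomial (Fin m) ℂ) (z ζ : Cn m) : ℂ :=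
  ∑ ν, peval (p ν) z * conj (peval (p ν) ζ)

/-- The Bergman kernel on the diagonal, `S_n(z, z) = ∑_{|ν| ≤ n} |p_ν(z)|²`. -/
def bergmanDiag {m n : ℕ} (p : MultiIndex m n → MvPolynomial (Fin m) ℂ) (z : Cn m) : ℝ :=
  ∑ ν, ‖peval (p ν) z‖ ^ 2

theorem bergmanKernel_self {m n : ℕ} (p : MultiIndex m n → MvPolynomial (Fin m) ℂ) (z : Cn m) :
    bergmanKernel p z z = (bergmanDiag p z : ℂ) := by
  simp [bergmanKernel, bergmanDiag, Complex.mul_conj, Complex.normSq_eq_norm_sq]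

/-! ### Random polynomials -/

/-- The laws of the coefficients: probability measures on `ℂ` with a density `φ` with respect to
Lebesgue measure on `ℂ`, or with a density with respect to Lebesgue measure on `ℝ` (real
random variables), such that for some `T > 0` one has `φ ≤ T` and the tail bound
`Prob(|z| ≥ R) ≤ T / R²` for all sufficiently large `R`. -/
def IsAdmissibleLaw (μ : Measure ℂ) : Prop :=
  IsProbabilityMeasure μ ∧
  ∃ T : ℝ, 0 < T ∧
    ((∃ φ : ℂ → ℝ, Measurable φ ∧ (∀ z, 0 ≤ φ z ∧ φ z ≤ T) ∧
        μ = (volume : Measure ℂ).withDensity (fun z => ENNReal.ofReal (φ z))) ∨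
      (∃ φ : ℝ → ℝ, Measurable φ ∧ (∀ x, 0 ≤ φ x ∧ φ x ≤ T) ∧
        μ = ((volume : Measure ℝ).withDensity (fun x => ENNReal.ofReal (φ x))).map
          (fun x : ℝ => (x : ℂ)))) ∧
    ∀ᶠ R : ℝ in atTop, μ {z : ℂ | R ≤ ‖z‖} ≤ ENNReal.ofReal (T / R ^ 2)

/-- `a_i`, `i ∈ ι`, are i.i.d. complex random variables with an admissible law. -/
def IsIIDAdmissible {Ω ι : Type*} [MeasurableSpace Ω] (P : Measure Ω) (a : ι → Ω → ℂ) : Prop :=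
  (∀ i, Measurable (a i)) ∧ iIndepFun a P ∧
    ∃ μ : Measure ℂ, IsAdmissibleLaw μ ∧ ∀ i, P.map (a i) = μ

/-- `H(z) = ∑_{|ν| ≤ n} c_ν p_ν(z)`. -/
def combination {m n : ℕ} (p : MultiIndex m n → MvPolynomial (Fin m) ℂ) (c : MultiIndex m n → ℂ)
    (z : Cn m) : ℂ :=
  ∑ ν, c ν * peval (p ν) z

/-- `(1/n) log |H|` for `H = ∑ c_ν p_ν`. -/
def potential {m n : ℕ} (p : MultiIndex m n → MvPolynomial (Fin m) ℂ) (c : MultiIndex m n → ℂ)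
    (z : Cn m) : EReal :=
  (((1 : ℝ) / n : ℝ) : EReal) * elog ‖combination p c z‖

/-- `(1/n) log ‖F‖` for the polynomial mapping `F = (H^{(1)}, …, H^{(k)})`,
`H^{(j)} = ∑ c^{(j)}_ν p_ν`, where `‖F(z)‖² = ∑_j |H^{(j)}(z)|²`. -/
def potentialMap {m n k : ℕ} (p : MultiIndex m n → MvPolynomial (Fin m) ℂ)
    (c : Fin k → MultiIndex m n → ℂ) (z : Cn m) : EReal :=
  (((1 : ℝ) / n : ℝ) : EReal) * elog (Real.sqrt (∑ j, ‖combination p (c j) z‖ ^ 2))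

/-! ### Convergence in `L¹_loc` and of the currents `dd^c` -/

/-- `u ∈ L¹_loc(ℂ^m)`; in particular `u` is finite almost everywhere. -/
def IsL1Loc {m : ℕ} (u : Cn m → EReal) : Prop :=
  (∀ᵐ z, u z ≠ ⊤ ∧ u z ≠ ⊥) ∧ LocallyIntegrable (fun z => (u z).toReal)

/-- `u_n → v` in `L¹_loc(ℂ^m)` (the functions `u_n` being in `L¹_loc` for all large `n`). -/
def TendstoL1Loc {m : ℕ} (u : ℕ → Cn m → EReal) (v : Cn m → EReal) : Prop :=
  IsL1Loc v ∧ (∀ᶠ n in atTop, IsL1Loc (u n)) ∧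
    ∀ K : Set (Cn m), IsCompact K →
      Tendsto (fun n => ∫⁻ z in K, ‖(u n z).toReal - (v z).toReal‖ₑ) atTop (𝓝 0)

/-- The `j`-th standard basis vector of `ℂ^m`. -/
def stdVec {m : ℕ} (j : Fin m) : Cn m := EuclideanSpace.single j (1 : ℂ)

/-- `∂f/∂z_j = (∂f/∂x_j - i ∂f/∂y_j) / 2`. -/
def dz {m : ℕ} (j : Fin m) (f : Cn m → ℂ) (z : Cn m) : ℂ :=
  (fderiv ℝ f z (stdVec j) - Complex.I * fderiv ℝ f z (Complex.I • stdVec j)) / 2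

/-- `∂f/∂\bar z_j = (∂f/∂x_j + i ∂f/∂y_j) / 2`. -/
def dzbar {m : ℕ} (j : Fin m) (f : Cn m → ℂ) (z : Cn m) : ℂ :=
  (fderiv ℝ f z (stdVec j) + Complex.I * fderiv ℝ f z (Complex.I • stdVec j)) / 2

/-- Smooth complex-valued functions with compact support. -/
def IsTestFunction {m : ℕ} (χ : Cn m → ℂ) : Prop :=
  ContDiff ℝ ((⊤ : ℕ∞) : WithTop ℕ∞) χ ∧ HasCompactSupport χ

/-- The pairing of the `(1,1)`-current `dd^c u = (i/π) ∂∂̄u` with a test form of bidegree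
`(m-1, m-1)`.  Such a form is written `α = ∑_{j,k} χ_{jk} θ_{jk}`, where `θ_{jk}` is the constant
form which multiplied by `(i/2) dz_r ∧ d\bar z_s` gives Lebesgue measure if `(r, s) = (j, k)` and
`0` otherwise, and then
`⟨dd^c u, α⟩ = ∫ u dd^c α = (2/π) ∫ u ∑_{j,k} ∂²χ_{jk}/∂z_j∂\bar z_k`. -/
def ddcPairing {m : ℕ} (u : Cn m → EReal) (χ : Fin m → Fin m → Cn m → ℂ) : ℂ :=
  (2 / Real.pi : ℂ) * ∫ z, ((u z).toReal : ℂ) * ∑ j, ∑ k, dz j (dzbar k (χ j k)) z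

/-- `u ∈ L¹_loc` and the current `dd^c u` is positive: `∑_{j,k} ξ_j \bar ξ_k (dd^c u)_{jk}` is a
positive distribution for every `ξ ∈ ℂ^m`. -/
def IsPositiveDdc {m : ℕ} (u : Cn m → EReal) : Prop :=
  IsL1Loc u ∧
    ∀ (ξ : Fin m → ℂ) (χ : Cn m → ℝ), IsTestFunction (fun z => (χ z : ℂ)) → (∀ z, 0 ≤ χ z) →
      0 ≤ (ddcPairing u (fun j k z => ξ j * conj (ξ k) * (χ z : ℂ))).re ∧
      (ddcPairing u (fun j k z => ξ j * conj (ξ k) * (χ z : ℂ))).im = 0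

/-- `dd^c u_n → dd^c v` as positive currents: `dd^c v` and, for all large `n`, `dd^c u_n` are
positive currents, and `⟨dd^c u_n, α⟩ → ⟨dd^c v, α⟩` for every test form `α`. -/
def DdcTendsto {m : ℕ} (u : ℕ → Cn m → EReal) (v : Cn m → EReal) : Prop :=
  IsPositiveDdc v ∧ (∀ᶠ n in atTop, IsPositiveDdc (u n)) ∧
    ∀ χ : Fin m → Fin m → Cn m → ℂ, (∀ j k, IsTestFunction (χ j k)) →
      Tendsto (fun n => ddcPairing (u n) χ) atTop (𝓝 (ddcPairing v χ))

end Pluripotential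

end

open Pluripotential

/-! ### Polynomials on `ℂ^m` -/

namespace Pluripotential

/-! Everything is compared with the extremal quantity `phi`. Since `Y` is not pluripolar,
polynomials bounded on a bounded piece of `Y` grow at most like `(A * max 1 ‖z‖) ^ n`: otherwise
normalized logarithms of a sequence of bad polynomials would sum to a plurisubharmonic function
equal to `-∞` on `Y` (`exists_norm_peval_le_pow_of_not_isPluripolar`). Against a super-logarithmic
`Q` this growth loses, so weighted polynomials decay like `‖z‖ ^ (-(n * b))`. Their sup norms are
thus governed by a fixed ball, and for large `n` they lie in `L²` (`exists_weightedNorm_decay`).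

For the Bergman kernel `S_n`, Cauchy–Schwarz in an orthonormal basis gives `φ_n² ≤ C S_n`, and the
Bernstein–Markov property applied to each basis element gives `S_n ≤ C (1 + ε)^(2n) m_n φ_n²`.
Powers of near-optimal polynomials show that `n⁻¹ log φ_n` tends to `V`, hence so does `(2n)⁻¹ log
S_n`.

At a fixed point, `‖F_n‖ / √S_n` is the length of random sums whose coefficient vector has norm one.
The bounded density prevents concentration near `0` and the tail bound prevents large values, so the
logarithm of this ratio has second moment `O(1 + log² (k m_n))`; divided by `n²` this is summable
(`lintegral_log_randomLength_sq_le`, `exists_lintegral_sq_le`). Tonelli then gives almost sure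
convergence at each point and in `L¹_loc`. The `L¹_loc` limit is also `V^*`, because `V` obeys the
mean value inequality and Lebesgue differentiation yields `V^* = V` almost everywhere. For the
regularized upper limit, Borel–Cantelli gives an upper bound at all points simultaneously, and
convergence on a countable dense set suffices from below because `V` is lower semicontinuous.

The currents converge by duality with `L¹_loc`. They are positive because `log (‖F‖² + ε)` has
nonnegative Laplacian on complex lines, again by Cauchy–Schwarz, and `ε` may tend to `0` under the
integral. -/

theorem continuous_peval {m : ℕ} (p : MvPolynomial (Fin m) ℂ) : Continuous (peval p) := by
  unfold peval
  exact (MvPolynomial.continuous_eval p).comp (by fun_prop)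

/-- The restriction of a polynomial to the complex line `λ ↦ a + λ b`. -/
noncomputable def lineRestrict {m : ℕ} (p : MvPolynomial (Fin m) ℂ) (a b : Cn m) : Polynomial ℂ :=
  MvPolynomial.aeval (fun i => Polynomial.C (a i) + Polynomial.X * Polynomial.C (b i)) p

theorem eval_lineRestrict {m : ℕ} (p : MvPolynomial (Fin m) ℂ) (a b : Cn m) (c : ℂ) :
    (lineRestrict p a b).eval c = peval p (a + c • b) := by
  unfold lineRestrict peval
  rw [← Polynomial.coe_evalRingHom, MvPolynomial.aeval_def, MvPolynomial.hom_eval₂,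
    MvPolynomial.eval, MvPolynomial.coe_eval₂Hom]
  congr 1
  · ext x; simp
  · ext i; simp; exact mul_comm _ _

/-! ### The logarithmic defect `M - log x` -/

theorem elog_of_pos {x : ℝ} (hx : 0 < x) : elog x = (Real.log x : EReal) :=
  ENNReal.log_ofReal_of_pos hx

@[simp]
theorem elog_zero : elog 0 = ⊥ := by simp [elog]

theorem elog_mono {x y : ℝ} (h : x ≤ y) : elog x ≤ elog y :=
  ENNReal.log_monotone (ENNReal.ofReal_le_ofReal h)

theorem continuous_elog : Continuous elog :=
  ENNReal.continuous_log.comp ENNReal.continuous_ofReal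

/-- `M - log x` as an element of `[0, ∞]`. -/
noncomputable def logDefect (M x : ℝ) : ℝ≥0∞ := ((M : EReal) - elog x).toENNReal

theorem logDefect_of_pos {M x : ℝ} (hx : 0 < x) :
    logDefect M x = ENNReal.ofReal (M - Real.log x) := by
  rw [logDefect, elog_of_pos hx, ← EReal.coe_sub, EReal.real_coe_toENNReal]

@[simp]
theorem logDefect_zero (M : ℝ) : logDefect M 0 = ⊤ := by
  simp [logDefect]

theorem continuous_logDefect {X : Type*} [TopologicalSpace X] {f g : X → ℝ} (hf : Continuous f)
    (hg : Continuous g) : Continuous fun x => logDefect (f x) (g x) := by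
  refine EReal.continuous_toENNReal.comp (continuous_iff_continuousAt.2 fun x => ?_)
  simp only [sub_eq_add_neg]
  have h1 : ContinuousAt (fun x => ((f x : ℝ) : EReal)) x :=
    (continuous_coe_real_ereal.comp hf).continuousAt
  have h2 : ContinuousAt (fun x => -elog (g x)) x :=
    (continuous_neg.comp (continuous_elog.comp hg)).continuousAt
  -- Addition in `EReal` is continuous away from `∞ - ∞`, which cannot occur because the first
  -- summand is real.
  exact ContinuousAt.comp (f := fun x => (((f x : ℝ) : EReal), -elog (g x)))
    (g := fun p : EReal × EReal => p.1 + p.2)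
    (EReal.continuousAt_add (Or.inl (EReal.coe_ne_top _)) (Or.inl (EReal.coe_ne_bot _)))
    (h1.prodMk h2)

/-! ### Mean value inequalities -/

/-- Jensen's inequality, read off from the bound of the constant coefficient by the Mahler measure.
-/
theorem log_norm_eval_zero_le (q : Polynomial ℂ) (h0 : q.eval 0 ≠ 0) :
    Real.log ‖q.eval 0‖ ≤
      (2 * Real.pi)⁻¹ * ∫ θ in Set.Ioc 0 (2 * Real.pi), Real.log ‖q.eval (circleMap 0 1 θ)‖ := by
  have hq : q ≠ 0 := by rintro rfl; simp at h0
  have h1 := Polynomial.norm_coeff_le_choose_mul_mahlerMeasure 0 q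
  rw [Nat.choose_zero_right, Nat.cast_one, one_mul, Polynomial.coeff_zero_eq_eval_zero,
    Polynomial.mahlerMeasure_def_of_ne_zero hq,
    intervalIntegral.integral_of_le (by positivity)] at h1
  rwa [Real.log_le_iff_le_exp (norm_pos_iff.2 h0)]

/-- Jensen's inequality for the nonnegative function `M - log |q|`. In this form a zero at the
centre is harmless (the right side is `⊤`) and Tonelli applies later without integrability
conditions. -/
theorem lintegral_circle_logDefect_le (q : Polynomial ℂ) (M : ℝ)
    (hM : ∀ θ : ℝ, ‖q.eval (circleMap 0 1 θ)‖ ≤ Real.exp M) :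
    ∫⁻ θ in Set.Ioc 0 (2 * Real.pi), logDefect M ‖q.eval (circleMap 0 1 θ)‖ ≤
      ENNReal.ofReal (2 * Real.pi) * logDefect M ‖q.eval 0‖ := by
  have hpi : (0 : ℝ) < 2 * Real.pi := by positivity
  by_cases h0 : q.eval 0 = 0
  · rw [h0, norm_zero, logDefect_zero, ENNReal.mul_top (by simpa using hpi)]
    exact le_top
  have hq : q ≠ 0 := by rintro rfl; simp at h0
  -- Only countably many angles are mapped to one of the finitely many roots.
  have hae : ∀ᵐ θ ∂(volume : Measure ℝ), q.eval (circleMap 0 1 θ) ≠ 0 := by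
    have hc : (circleMap 0 1 ⁻¹' {z | q.IsRoot z}).Countable :=
      ((Polynomial.finite_setOfPred_isRoot hq).countable).preimage_circleMap 0 one_ne_zero
    filter_upwards [hc.ae_notMem volume] with θ hθ using hθ
  have hint : IntegrableOn (fun θ => M - Real.log ‖q.eval (circleMap 0 1 θ)‖)
      (Set.Ioc 0 (2 * Real.pi)) := by
    have := Polynomial.intervalIntegrable_mahlerMeasure q
    rw [intervalIntegrable_iff_integrableOn_Ioc_of_le hpi.le] at this
    exact Integrable.sub (by simp) this
  have hnn : ∀ᵐ θ ∂(volume : Measure ℝ).restrict (Set.Ioc 0 (2 * Real.pi)),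
      0 ≤ M - Real.log ‖q.eval (circleMap 0 1 θ)‖ := by
    filter_upwards [ae_restrict_of_ae hae] with θ hθ
    rw [sub_nonneg, Real.log_le_iff_le_exp (norm_pos_iff.2 hθ)]
    exact hM θ
  calc ∫⁻ θ in Set.Ioc 0 (2 * Real.pi), logDefect M ‖q.eval (circleMap 0 1 θ)‖
      = ∫⁻ θ in Set.Ioc 0 (2 * Real.pi),
          ENNReal.ofReal (M - Real.log ‖q.eval (circleMap 0 1 θ)‖) := by
        refine lintegral_congr_ae ?_
        filter_upwards [ae_restrict_of_ae hae] with θ hθ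
        exact logDefect_of_pos (norm_pos_iff.2 hθ)
    _ = ENNReal.ofReal (∫ θ in Set.Ioc 0 (2 * Real.pi),
          (M - Real.log ‖q.eval (circleMap 0 1 θ)‖)) :=
        (ofReal_integral_eq_lintegral_ofReal hint hnn).symm
    _ ≤ ENNReal.ofReal (2 * Real.pi * (M - Real.log ‖q.eval 0‖)) := by
        refine ENNReal.ofReal_le_ofReal ?_
        have h1 := log_norm_eval_zero_le q h0
        have h2 := Polynomial.intervalIntegrable_mahlerMeasure q
        rw [intervalIntegrable_iff_integrableOn_Ioc_of_le hpi.le] at h2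
        rw [integral_sub (by simp) h2]
        have h3 : ∫ _ in Set.Ioc 0 (2 * Real.pi), M = 2 * Real.pi * M := by
          simp [hpi.le]
        rw [h3, mul_sub]
        rw [inv_mul_eq_div, le_div_iff₀ hpi] at h1
        linarith
    _ = _ := by
        rw [ENNReal.ofReal_mul hpi.le, logDefect_of_pos (norm_pos_iff.2 h0)]

/-- The mean value inequality for `log |p|` on circles in complex lines. -/
theorem lintegral_line_logDefect_le {m : ℕ} (p : MvPolynomial (Fin m) ℂ) (a b : Cn m) (M : ℝ)
    (hM : ∀ θ : ℝ, ‖peval p (a + circleMap 0 1 θ • b)‖ ≤ Real.exp M) :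
    ∫⁻ θ in Set.Ioc 0 (2 * Real.pi), logDefect M ‖peval p (a + circleMap 0 1 θ • b)‖ ≤
      ENNReal.ofReal (2 * Real.pi) * logDefect M ‖peval p a‖ := by
  have := lintegral_circle_logDefect_le (lineRestrict p a b) M
    (by simpa only [eval_lineRestrict] using hM)
  simpa only [eval_lineRestrict, zero_smul, add_zero] using this

/-- Multiplication by a unimodular scalar is a linear isometry, so it preserves Lebesgue measure and
balls about `0`. -/
theorem lintegral_closedBall_rotate {m : ℕ} (F : Cn m → ℝ≥0∞) (R : ℝ) (c : Circle) :
    ∫⁻ w in Metric.closedBall (0 : Cn m) R, F ((c : ℂ) • w) =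
      ∫⁻ w in Metric.closedBall (0 : Cn m) R, F w := by
  let e : Cn m ≃ₗᵢ[ℂ] Cn m :=
    { (LinearEquiv.smulOfNeZero ℂ (Cn m) (c : ℂ) (Circle.coe_ne_zero c)) with
      norm_map' := fun x => by
        change ‖(c : ℂ) • x‖ = ‖x‖
        rw [norm_smul, Circle.norm_coe, one_mul] }
  let e' : Cn m ≃ₗᵢ[ℝ] Cn m :=
    { e.toLinearEquiv.restrictScalars ℝ with norm_map' := e.norm_map }
  have he : ∀ x, e' x = (c : ℂ) • x := fun x => rfl
  have hmp : MeasurePreserving e' volume volume := e'.measurePreserving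
  have hpre : e' ⁻¹' Metric.closedBall (0 : Cn m) R = Metric.closedBall 0 R := by
    ext x; simp
  have := (hmp.restrict_preimage_emb e'.toHomeomorph.measurableEmbedding
    (Metric.closedBall (0 : Cn m) R)).lintegral_comp_emb e'.toHomeomorph.measurableEmbedding F
  rw [hpre] at this
  exact this

/-- The mean value inequality for `log |p|` on balls. -/
theorem lintegral_closedBall_logDefect_le {m : ℕ} (p : MvPolynomial (Fin m) ℂ) (a : Cn m)
    (R M : ℝ) (hM : ∀ z ∈ Metric.closedBall a R, ‖peval p z‖ ≤ Real.exp M) :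
    ∫⁻ z in Metric.closedBall a R, logDefect M ‖peval p z‖ ≤
      volume (Metric.closedBall (0 : Cn m) R) * logDefect M ‖peval p a‖ := by
  have hpi : (0 : ℝ) < 2 * Real.pi := by positivity
  set F : Cn m → ℝ≥0∞ := fun w => logDefect M ‖peval p (a + w)‖ with hF
  have hFc : Continuous F :=
    continuous_logDefect continuous_const
      ((continuous_peval p).comp (continuous_const.add continuous_id)).norm
  have h1 : ∫⁻ z in Metric.closedBall a R, logDefect M ‖peval p z‖ =
      ∫⁻ w in Metric.closedBall (0 : Cn m) R, F w := by
    have hmp := measurePreserving_add_left (volume : Measure (Cn m)) a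
    have hpre : (a + ·) ⁻¹' Metric.closedBall a R = Metric.closedBall (0 : Cn m) R := by
      ext x; simp
    have := (hmp.restrict_preimage_emb (MeasurableEquiv.addLeft a).measurableEmbedding
      (Metric.closedBall a R)).lintegral_comp_emb (MeasurableEquiv.addLeft a).measurableEmbedding
      (fun z => logDefect M ‖peval p z‖)
    rw [hpre] at this
    exact this.symm
  rw [h1]
  -- By rotation invariance the ball integral may be averaged over `θ`. After exchanging the
  -- integrals, the inner one runs over a circle in a complex line through `a`.
  have h2 : ENNReal.ofReal (2 * Real.pi) * ∫⁻ w in Metric.closedBall (0 : Cn m) R, F w ≤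
      ENNReal.ofReal (2 * Real.pi) *
        (volume (Metric.closedBall (0 : Cn m) R) * logDefect M ‖peval p a‖) := by
    calc ENNReal.ofReal (2 * Real.pi) * ∫⁻ w in Metric.closedBall (0 : Cn m) R, F w
        = ∫⁻ θ in Set.Ioc 0 (2 * Real.pi),
            ∫⁻ w in Metric.closedBall (0 : Cn m) R, F (circleMap 0 1 θ • w) := by
          have : ∀ θ : ℝ, ∫⁻ w in Metric.closedBall (0 : Cn m) R, F (circleMap 0 1 θ • w) =
              ∫⁻ w in Metric.closedBall (0 : Cn m) R, F w := by
            intro θ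
            have := lintegral_closedBall_rotate F R (Circle.exp θ)
            simpa [circleMap, Circle.coe_exp] using this
          simp only [this]
          rw [setLIntegral_const, Real.volume_Ioc, sub_zero, mul_comm]
      _ = ∫⁻ w in Metric.closedBall (0 : Cn m) R,
            ∫⁻ θ in Set.Ioc 0 (2 * Real.pi), F (circleMap 0 1 θ • w) := by
          refine lintegral_lintegral_swap ?_
          refine (Continuous.measurable ?_).aemeasurable
          exact hFc.comp (((continuous_circleMap 0 1).comp continuous_fst).smul continuous_snd)
      _ ≤ ∫⁻ w in Metric.closedBall (0 : Cn m) R,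
            ENNReal.ofReal (2 * Real.pi) * logDefect M ‖peval p a‖ := by
          refine setLIntegral_mono' Metric.isClosed_closedBall.measurableSet fun w hw => ?_
          refine lintegral_line_logDefect_le p a w M fun θ => hM _ ?_
          simpa [norm_smul] using hw
      _ = _ := by
          rw [setLIntegral_const]; ring
  exact (ENNReal.mul_le_mul_iff_right (by simpa using hpi) ENNReal.ofReal_ne_top).1 h2

/-! ### Growth of polynomials along lines -/

/-- Homogenization: because the degree is at most `n`, `c ^ n * p(w / c)` is a polynomial in `c`.
This moves infinity to `c = 0`, where the maximum principle can be used. -/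
theorem norm_monomial_smul {m : ℕ} (p : MvPolynomial (Fin m) ℂ) (n : ℕ) (hp : p.totalDegree ≤ n)
    (w : Cn m) {c : ℂ} (hc : c ≠ 0) :
    c ^ n * peval p (c⁻¹ • w) =
      ∑ d ∈ p.support, p.coeff d * (∏ i, w i ^ d i) * c ^ (n - ∑ i, d i) := by
  unfold peval
  rw [MvPolynomial.eval_eq', Finset.mul_sum]
  refine Finset.sum_congr rfl fun d hd => ?_
  have hdn : ∑ i, d i ≤ n := by
    refine le_trans ?_ hp
    have := MvPolynomial.le_totalDegree hd
    rwa [Finsupp.sum_fintype _ _ (fun _ => rfl)] at this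
  have h1 : ∏ i, ((c⁻¹ • w) i) ^ d i = (c⁻¹) ^ (∑ i, d i) * ∏ i, w i ^ d i := by
    rw [← Finset.prod_pow_eq_pow_sum, ← Finset.prod_mul_distrib]
    exact Finset.prod_congr rfl fun i _ => by simp [mul_pow]
  have h2 : c ^ n = c ^ (n - ∑ i, d i) * c ^ (∑ i, d i) := by
    rw [← pow_add, Nat.sub_add_cancel hdn]
  rw [h1, h2]
  have h3 : c ^ (∑ i, d i) * c⁻¹ ^ (∑ i, d i) = 1 := by
    rw [← mul_pow, mul_inv_cancel₀ hc, one_pow]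
  linear_combination (c ^ (n - ∑ i, d i) * p.coeff d * ∏ i, w i ^ d i) * h3

/-- A polynomial of degree at most `n` which is bounded by `K` on the unit ball is bounded by
`K max(1, |z|)^n`. -/
theorem norm_peval_le_max_pow {m : ℕ} (p : MvPolynomial (Fin m) ℂ) (n : ℕ)
    (hp : p.totalDegree ≤ n) (K : ℝ) (hK : ∀ z : Cn m, ‖z‖ ≤ 1 → ‖peval p z‖ ≤ K) (z : Cn m) :
    ‖peval p z‖ ≤ K * max 1 ‖z‖ ^ n := by
  rcases le_or_gt ‖z‖ 1 with hz1 | hz1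
  · simpa [max_eq_left hz1] using hK z hz1
  rw [max_eq_right hz1.le]
  have hz : 0 < ‖z‖ := by linarith
  set w : Cn m := ((‖z‖⁻¹ : ℝ) : ℂ) • z with hw
  have hwn : ‖w‖ = 1 := by
    rw [hw, norm_smul, Complex.norm_real, Real.norm_eq_abs, abs_of_pos (by positivity),
      inv_mul_cancel₀ hz.ne']
  -- The entire function `c ^ n * p(w / c)` is bounded by `K` on `|c| = 1`, hence on the disc. Its
  -- value at `c = 1 / ‖z‖` is `p z / ‖z‖ ^ n`.
  let h : ℂ → ℂ := fun c => ∑ d ∈ p.support, p.coeff d * (∏ i, w i ^ d i) * c ^ (n - ∑ i, d i)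
  have hdiff : Differentiable ℂ h := by
    unfold h; fun_prop
  have hb : ∀ c ∈ frontier (Metric.ball (0 : ℂ) 1), ‖h c‖ ≤ K := by
    intro c hc
    rw [frontier_ball _ one_ne_zero, mem_sphere_zero_iff_norm] at hc
    have hc0 : c ≠ 0 := by rintro rfl; simp at hc
    have := norm_monomial_smul p n hp w hc0
    change ‖∑ d ∈ p.support, p.coeff d * (∏ i, w i ^ d i) * c ^ (n - ∑ i, d i)‖ ≤ K
    rw [← this, norm_mul, norm_pow, hc, one_pow, one_mul]
    refine hK _ ?_
    rw [norm_smul, norm_inv, hc, hwn]; simp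
  set c : ℂ := ((‖z‖⁻¹ : ℝ) : ℂ) with hcdef
  have hcn : ‖c‖ = ‖z‖⁻¹ := by
    rw [hcdef, Complex.norm_real, Real.norm_eq_abs, abs_of_pos (by positivity)]
  have hc0 : c ≠ 0 := by
    rw [← norm_pos_iff, hcn]; positivity
  have h1 : ‖h c‖ ≤ K := by
    refine Complex.norm_le_of_forall_mem_frontier_norm_le Metric.isBounded_ball
      hdiff.diffContOnCl hb (subset_closure ?_)
    rw [mem_ball_zero_iff, hcn]
    exact inv_lt_one_of_one_lt₀ hz1
  have h2 := norm_monomial_smul p n hp w hc0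
  have h3 : c⁻¹ • w = z := by rw [hw, smul_smul, inv_mul_cancel₀ hc0, one_smul]
  rw [h3] at h2
  change ‖∑ d ∈ p.support, p.coeff d * (∏ i, w i ^ d i) * c ^ (n - ∑ i, d i)‖ ≤ K at h1
  rw [← h2, norm_mul, norm_pow, hcn, inv_pow, inv_mul_le_iff₀ (by positivity)] at h1
  linarith

end Pluripotential

/-! ### Nonpluripolar sets -/

namespace Pluripotential

/-- The bound `x ≤ exp M` ensures that nothing is truncated at `0`, so raising `M` by `d` adds
exactly `d`. -/
theorem logDefect_add {M d x : ℝ} (hd : 0 ≤ d) (hx : 0 ≤ x) (hxM : x ≤ Real.exp M) :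
    logDefect (M + d) x = ENNReal.ofReal d + logDefect M x := by
  rcases hx.eq_or_lt with rfl | hx
  · simp
  · have : Real.log x ≤ M := by rwa [Real.log_le_iff_le_exp hx]
    rw [logDefect_of_pos hx, logDefect_of_pos hx, ← ENNReal.ofReal_add hd (by linarith)]
    congr 1; ring

theorem ofReal_le_logDefect {M x : ℝ} (hx : 0 ≤ x) (hx1 : x ≤ 1) :
    ENNReal.ofReal M ≤ logDefect M x := by
  rcases hx.eq_or_lt with rfl | hx
  · simp
  · rw [logDefect_of_pos hx]
    exact ENNReal.ofReal_le_ofReal (by linarith [Real.log_nonpos hx.le hx1])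

theorem tsum_ofReal_half {c : ℝ} (hc : 0 ≤ c) :
    ∑' j : ℕ, ENNReal.ofReal (c / 2 / 2 ^ j) = ENNReal.ofReal c := by
  rw [← ENNReal.ofReal_tsum_of_nonneg (fun j => by positivity) (summable_geometric_two' c),
    tsum_geometric_two']

theorem coe_sub_coe_add (N d : ℝ) (hd : 0 ≤ d) (x : ℝ≥0∞) :
    ((N + d : ℝ) : EReal) - ((ENNReal.ofReal d + x : ℝ≥0∞) : EReal) = (N : EReal) - (x : EReal) := by
  induction x with
  | top => simp
  | coe x =>
    rw [EReal.coe_ennreal_add, EReal.coe_ennreal_ofReal, max_eq_left hd,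
      EReal.coe_nnreal_eq_coe_real, ← EReal.coe_add, ← EReal.coe_sub, ← EReal.coe_sub]
    congr 1; ring

theorem continuous_coe_sub_ennreal (N : ℝ) :
    Continuous fun x : ℝ≥0∞ => (N : EReal) - (x : EReal) := by
  refine continuous_iff_continuousAt.2 fun x => ?_
  simp only [sub_eq_add_neg]
  have h2 : ContinuousAt (fun x : ℝ≥0∞ => -(x : EReal)) x :=
    (continuous_neg.comp continuous_coe_ennreal_ereal).continuousAt
  exact ContinuousAt.comp (f := fun x : ℝ≥0∞ => ((N : EReal), -(x : EReal)))
    (g := fun p : EReal × EReal => p.1 + p.2)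
    (EReal.continuousAt_add (Or.inl (EReal.coe_ne_top _)) (Or.inl (EReal.coe_ne_bot _)))
    (continuousAt_const.prodMk h2)

theorem antitone_coe_sub_ennreal (N : ℝ) :
    Antitone fun x : ℝ≥0∞ => (N : EReal) - (x : EReal) := fun x y h =>
  EReal.sub_le_sub le_rfl (by exact_mod_cast h)

/-- A function which on each set `{L ≤ N}` has the form `N - G_N`, with `G_N ≥ 0` lower
semicontinuous and satisfying the reverse mean value inequality there, is plurisubharmonic. -/
theorem isPlurisubharmonic_of_eq_sub {m : ℕ} (u : Cn m → EReal) (L : Cn m → ℝ)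
    (hL : Continuous L) (G : ℝ → Cn m → ℝ≥0∞)
    (hu : ∀ N z, L z ≤ N → u z = (N : EReal) - (G N z : EReal))
    (hlsc : ∀ N, LowerSemicontinuous (G N))
    (hmean : ∀ (N : ℝ) (a b : Cn m), (∀ θ : ℝ, L (a + circleMap 0 1 θ • b) ≤ N) →
      ∫⁻ θ in Set.Ioc 0 (2 * Real.pi), G N (a + circleMap 0 1 θ • b) ≤
        ENNReal.ofReal (2 * Real.pi) * G N a) :
    IsPlurisubharmonic u := by
  have hpi : (0 : ℝ) < 2 * Real.pi := by positivity
  refine ⟨fun z => ?_, fun z => ?_, fun a b M hM => ?_⟩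
  · rw [hu (L z) z le_rfl]
    exact ne_top_of_le_ne_top (EReal.coe_ne_top (L z))
      (EReal.sub_le_of_le_add (le_add_of_nonneg_right (EReal.coe_ennreal_nonneg _)))
  -- The level `L z + 1` is admissible on a whole neighbourhood of `z`, so a single representation
  -- of `u` can be used there.
  · have h1 : UpperSemicontinuousAt (fun w => ((L z + 1 : ℝ) : EReal) - (G (L z + 1) w : EReal)) z :=
      ContinuousAt.comp_lowerSemicontinuousAt_antitone
        (g := fun x : ℝ≥0∞ => ((L z + 1 : ℝ) : EReal) - (x : EReal)) (continuous_coe_sub_ennreal (L z + 1)).continuousAt (hlsc _ z)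
        (antitone_coe_sub_ennreal _)
    have h2 : ∀ᶠ w in 𝓝 z, u w = ((L z + 1 : ℝ) : EReal) - (G (L z + 1) w : EReal) := by
      filter_upwards [hL.continuousAt.eventually_lt continuousAt_const (lt_add_one (L z))] with w hw
      exact hu _ _ hw.le
    intro y hy
    rw [h2.self_of_nhds] at hy
    filter_upwards [h1 y hy, h2] with w hw1 hw2
    rwa [hw2]
  · have hexp : ∀ θ : ℝ, Complex.exp (θ * Complex.I) = circleMap 0 1 θ := by
      intro θ; simp [circleMap]
    simp only [hexp] at hM ⊢
    obtain ⟨B, hB⟩ : ∃ B, ∀ θ : ℝ, L (a + circleMap 0 1 θ • b) ≤ B := by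
      obtain ⟨B, hB⟩ := ((isCompact_closedBall (0 : ℂ) 1).image
        (f := fun c => L (a + c • b)) (by fun_prop)).bddAbove
      refine ⟨B, fun θ => hB ⟨circleMap 0 1 θ, by simp, rfl⟩⟩
    -- A level admissible on the circle and at its centre, and at least as large as the prescribed
    -- `M`.
    set N : ℝ := max (max B (L a)) M with hN
    have hNB : ∀ θ : ℝ, L (a + circleMap 0 1 θ • b) ≤ N := fun θ =>
      (hB θ).trans ((le_max_left _ _).trans (le_max_left _ _))
    have hNa : L a ≤ N := (le_max_right _ _).trans (le_max_left _ _)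
    have hNM : M ≤ N := le_max_right _ _
    have hm := hmean N a b hNB
    set d : ℝ := N - M with hd
    have hd0 : 0 ≤ d := sub_nonneg.2 hNM
    have hNMd : N = M + d := by rw [hd]; ring
    -- On the circle the defects relative to `M` and to `N` differ by the constant `d`. This
    -- transfers the mean value inequality from `N` to `M`.
    have hpt : ∀ θ : ℝ, ENNReal.ofReal d + ((M : EReal) - u (a + circleMap 0 1 θ • b)).toENNReal =
        G N (a + circleMap 0 1 θ • b) := by
      intro θ
      have h1 := hM θ
      rw [hu N _ (hNB θ)] at h1 ⊢
      generalize G N (a + circleMap 0 1 θ • b) = x at h1 ⊢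
      induction x with
      | top => simp
      | coe x =>
        rw [EReal.coe_nnreal_eq_coe_real, ← EReal.coe_sub, EReal.coe_le_coe_iff] at h1
        rw [EReal.coe_nnreal_eq_coe_real, ← EReal.coe_sub, ← EReal.coe_sub,
          EReal.real_coe_toENNReal, ← ENNReal.ofReal_add hd0 (by linarith)]
        rw [← ENNReal.ofReal_coe_nnreal]
        congr 1; rw [hd]; ring
    have hm2 : ENNReal.ofReal (2 * Real.pi) * ENNReal.ofReal d +
        ∫⁻ θ in Set.Ioc 0 (2 * Real.pi),
          ((M : EReal) - u (a + circleMap 0 1 θ • b)).toENNReal ≤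
        ENNReal.ofReal (2 * Real.pi) * G N a := by
      refine le_trans (le_of_eq ?_) hm
      simp only [← hpt]
      rw [lintegral_add_left measurable_const, setLIntegral_const, Real.volume_Ioc, sub_zero,
        mul_comm]
    set I := ∫⁻ θ in Set.Ioc 0 (2 * Real.pi),
          ((M : EReal) - u (a + circleMap 0 1 θ • b)).toENNReal with hI
    have hpi0 : ENNReal.ofReal (2 * Real.pi) ≠ 0 := by simpa using hpi
    have hm3 : ENNReal.ofReal d + (ENNReal.ofReal (2 * Real.pi))⁻¹ * I ≤ G N a := by
      have := mul_le_mul_right hm2 (ENNReal.ofReal (2 * Real.pi))⁻¹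
      rwa [mul_add, ← mul_assoc, ← mul_assoc, ENNReal.inv_mul_cancel hpi0 ENNReal.ofReal_ne_top,
        one_mul, one_mul] at this
    rw [hu N a hNa, ← coe_sub_coe_add M d hd0, ← hNMd]
    exact antitone_coe_sub_ennreal N hm3

/-- A nonpluripolar set has a bounded part on which an unweighted Bernstein–Walsh inequality
holds. -/
theorem exists_norm_peval_le_pow_of_not_isPluripolar {m : ℕ} (Y : Set (Cn m))
    (hY : ¬ IsPluripolar Y) :
    ∃ r A : ℝ, 1 ≤ A ∧ ∀ n : ℕ, 1 ≤ n → ∀ p : MvPolynomial (Fin m) ℂ, p.totalDegree ≤ n →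
      (∀ z ∈ Y, ‖z‖ ≤ r → ‖peval p z‖ ≤ 1) → ∀ z : Cn m, ‖z‖ ≤ 1 → ‖peval p z‖ ≤ A ^ n := by
  by_contra hcon
  push Not at hcon
  -- The failure is used with radius `j` and constant `exp (4 ^ j)`: the exponent `4 ^ j` will
  -- outweigh the summation weights `2 ^ (-j-1)`.
  have hcon' : ∀ j : ℕ, ∃ n : ℕ, 1 ≤ n ∧ ∃ p : MvPolynomial (Fin m) ℂ, p.totalDegree ≤ n ∧
      (∀ z ∈ Y, ‖z‖ ≤ j → ‖peval p z‖ ≤ 1) ∧ ∃ z : Cn m, ‖z‖ ≤ 1 ∧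
        Real.exp (4 ^ j) ^ n < ‖peval p z‖ :=
    fun j => hcon j (Real.exp (4 ^ j)) (Real.one_le_exp (by positivity))
  choose n hn p hdeg hpY z0 hz0 hz0lt using hcon'
  have hmax : ∀ j, ∃ a : Cn m, ‖a‖ ≤ 1 ∧ ∀ z : Cn m, ‖z‖ ≤ 1 → ‖peval (p j) z‖ ≤ ‖peval (p j) a‖ := by
    intro j
    obtain ⟨a, ha, hamax⟩ := (isCompact_closedBall (0 : Cn m) 1).exists_isMaxOn
      ⟨0, by simp⟩ (continuous_peval (p j)).norm.continuousOn
    exact ⟨a, by simpa using ha, fun z hz => hamax (by simpa using hz)⟩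
  choose a ha hamax using hmax
  have hn0 : ∀ j, (0 : ℝ) < n j := fun j => by exact_mod_cast hn j
  have hapos : ∀ j, 0 < ‖peval (p j) (a j)‖ := fun j =>
    lt_of_lt_of_le (lt_trans (by positivity) (hz0lt j)) (hamax j _ (hz0 j))
  set M : ℕ → ℝ := fun j => Real.log ‖peval (p j) (a j)‖ / n j with hM
  have hMe : ∀ j, ‖peval (p j) (a j)‖ = Real.exp (n j * M j) := by
    intro j
    rw [hM]; dsimp only
    rw [mul_div_cancel₀ _ (hn0 j).ne', Real.exp_log (hapos j)]
  have hM4 : ∀ j, (4 : ℝ) ^ j ≤ M j := by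
    intro j
    have h1 := (hz0lt j).le.trans (hamax j _ (hz0 j))
    rw [hMe, ← Real.exp_nat_mul, Real.exp_le_exp] at h1
    exact le_of_mul_le_mul_left h1 (hn0 j)
  -- A continuous majorant for the logarithmic growth: `(1 / n_j) log |p_j|` exceeds its maximum
  -- `M_j` over the unit ball by at most `L`.
  set L : Cn m → ℝ := fun z => Real.log (1 + ‖z‖) with hL
  have hLc : Continuous L := by
    refine Continuous.log (by fun_prop) fun z => ?_
    positivity
  have hL0 : ∀ z, 0 ≤ L z := fun z => Real.log_nonneg (by linarith [norm_nonneg z])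
  have hgrow : ∀ j z N, L z ≤ N → ‖peval (p j) z‖ ≤ Real.exp (n j * (M j + N)) := by
    intro j z N hN
    refine (norm_peval_le_max_pow (p j) (n j) (hdeg j) _ (hamax j) z).trans ?_
    rw [hMe, mul_add, Real.exp_add]
    refine mul_le_mul_of_nonneg_left ?_ (Real.exp_pos _).le
    rw [Real.exp_nat_mul]
    refine pow_le_pow_left₀ (by positivity) ?_ _
    rw [← Real.log_le_iff_le_exp (by positivity)]
    refine le_trans (Real.log_le_log (by positivity) ?_) hN
    exact max_le (by linarith [norm_nonneg z]) (by linarith)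
  -- The weighted defects `2 ^ (-j-1) * (M_j + N - (1 / n_j) log |p_j|)`, nonnegative without
  -- truncation where `L ≤ N`.
  set D : ℕ → ℝ → Cn m → ℝ≥0∞ := fun j N z =>
    ENNReal.ofReal (1 / 2 / 2 ^ j / n j) * logDefect (n j * (M j + N)) ‖peval (p j) z‖ with hD
  have hDc : ∀ j N, Continuous (D j N) := by
    intro j N
    exact (ENNReal.continuous_const_mul ENNReal.ofReal_ne_top).comp
      (continuous_logDefect continuous_const (continuous_peval (p j)).norm)
  set G : ℝ → Cn m → ℝ≥0∞ := fun N z => ∑' j, D j N z with hG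
  -- As the weights add up to `1`, raising `N` by `d` raises the sum by exactly `d`; thus `N - G N
  -- z` does not depend on the admissible level.
  have hshift : ∀ N d z, 0 ≤ d → L z ≤ N → G (N + d) z = ENNReal.ofReal d + G N z := by
    intro N d z hd hN
    rw [hG]; dsimp only
    rw [← tsum_ofReal_half hd, ← ENNReal.tsum_add]
    refine tsum_congr fun j => ?_
    rw [hD]; dsimp only
    have : (n j : ℝ) * (M j + (N + d)) = n j * (M j + N) + n j * d := by ring
    rw [this, logDefect_add (by have := hn0 j; positivity) (norm_nonneg _) (hgrow j z N hN), mul_add,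
      ← ENNReal.ofReal_mul (by positivity)]
    congr 2
    field_simp [(hn0 j).ne']
  -- The function is `∑ 2 ^ (-j-1) * ((1 / n_j) log |p_j| - M_j)`, written at the smallest
  -- admissible level `L z`.
  refine hY ⟨fun z => (L z : EReal) - (G (L z) z : EReal), ?_, ?_, ?_⟩
  · refine isPlurisubharmonic_of_eq_sub _ L hLc G ?_ ?_ ?_
    · intro N z hN
      have h1 := hshift (L z) (N - L z) z (sub_nonneg.2 hN) le_rfl
      have h2 := coe_sub_coe_add (L z) (N - L z) (sub_nonneg.2 hN) (G (L z) z)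
      rw [← h1] at h2
      simpa using h2.symm
    · intro N
      exact lowerSemicontinuous_tsum fun j => (hDc j N).lowerSemicontinuous
    · intro N a b hN
      rw [hG]; dsimp only
      rw [lintegral_tsum, ← ENNReal.tsum_mul_left]
      · refine ENNReal.tsum_le_tsum fun j => ?_
        rw [hD]; dsimp only
        rw [lintegral_const_mul', mul_left_comm]
        · gcongr
          exact lintegral_line_logDefect_le (p j) a b _ fun θ => hgrow j _ N (hN θ)
        · exact ENNReal.ofReal_ne_top
      · intro j
        refine (Continuous.measurable ?_).aemeasurable
        exact (hDc j N).comp (continuous_const.add ((continuous_circleMap 0 1).smul continuous_const))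
  -- It is not identically `-∞`. The ball of radius 2 about the maximum point `a_j` contains the
  -- unit ball and lies in `‖z‖ ≤ 3`, where `L ≤ log 4`. The defect at `a_j` is exactly `n_j N`, so
  -- the mean value inequality bounds the integrals of the `D_j` by a convergent series.
  · set N : ℝ := Real.log 4 with hN
    have hLN : ∀ z : Cn m, ‖z‖ ≤ 3 → L z ≤ N := by
      intro z hz
      exact Real.log_le_log (by positivity) (by linarith)
    have hN0 : 0 ≤ N := Real.log_nonneg (by norm_num)
    have hint : ∫⁻ z in Metric.closedBall (0 : Cn m) 1, G N z ≠ ⊤ := by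
      rw [hG]; dsimp only
      rw [lintegral_tsum fun j => (hDc j N).measurable.aemeasurable]
      have hle : ∀ j, ∫⁻ z in Metric.closedBall (0 : Cn m) 1, D j N z ≤
          ENNReal.ofReal (N / 2 / 2 ^ j) * volume (Metric.closedBall (0 : Cn m) 2) := by
        intro j
        have hsub : Metric.closedBall (0 : Cn m) 1 ⊆ Metric.closedBall (a j) 2 := by
          refine Metric.closedBall_subset_closedBall' ?_
          rw [dist_zero_left]; linarith [ha j]
        calc ∫⁻ z in Metric.closedBall (0 : Cn m) 1, D j N z
            ≤ ∫⁻ z in Metric.closedBall (a j) 2, D j N z := lintegral_mono_set hsub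
          _ = ENNReal.ofReal (1 / 2 / 2 ^ j / n j) *
                ∫⁻ z in Metric.closedBall (a j) 2,
                  logDefect (n j * (M j + N)) ‖peval (p j) z‖ := by
              rw [hD]; dsimp only
              rw [lintegral_const_mul' _ _ ENNReal.ofReal_ne_top]
          _ ≤ ENNReal.ofReal (1 / 2 / 2 ^ j / n j) *
                (volume (Metric.closedBall (0 : Cn m) 2) *
                  logDefect (n j * (M j + N)) ‖peval (p j) (a j)‖) := by
              gcongr
              refine lintegral_closedBall_logDefect_le (p j) (a j) 2 _ fun z hz => ?_
              refine hgrow j z N (hLN z ?_)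
              have := norm_le_norm_add_norm_sub' z (a j)
              rw [Metric.mem_closedBall, dist_eq_norm] at hz
              linarith [ha j]
          _ = _ := by
              rw [logDefect_of_pos (hapos j), hMe, Real.log_exp, mul_left_comm, mul_comm,
                ← ENNReal.ofReal_mul (by positivity)]
              congr 2
              field_simp [(hn0 j).ne']
              ring
      refine ne_top_of_le_ne_top ?_ (ENNReal.tsum_le_tsum hle)
      rw [ENNReal.tsum_mul_right, tsum_ofReal_half hN0]
      exact ENNReal.mul_ne_top ENNReal.ofReal_ne_top
        (isCompact_closedBall _ _).measure_lt_top.ne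
    have hGm : Measurable (G N) := Measurable.tsum fun j => (hDc j N).measurable
    have hae := ae_lt_top hGm hint
    have hne : (volume.restrict (Metric.closedBall (0 : Cn m) 1)) ≠ 0 := by
      rw [Ne, Measure.restrict_eq_zero]
      exact (Metric.measure_closedBall_pos volume 0 one_pos).ne'
    have : (ae (volume.restrict (Metric.closedBall (0 : Cn m) 1))).NeBot := ae_neBot.2 hne
    obtain ⟨z, hz, hz1⟩ := (hae.and (ae_restrict_mem
      Metric.isClosed_closedBall.measurableSet)).exists
    refine ⟨z, ?_⟩
    rw [mem_closedBall_zero_iff] at hz1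
    have hGz : G (L z) z ≠ ⊤ := by
      have h1 := hshift (L z) (N - L z) z (sub_nonneg.2 (hLN z (by linarith))) le_rfl
      intro h
      rw [add_sub_cancel, h] at h1
      rw [h1] at hz
      simp at hz
    lift G (L z) z to ℝ≥0 using hGz with x
    rw [EReal.coe_nnreal_eq_coe_real, ← EReal.coe_sub]
    exact EReal.coe_ne_bot _
  · intro z hz
    have : G (L z) z = ⊤ := by
      by_contra h
      have h0 := ENNReal.tendsto_cofinite_zero_of_tsum_ne_top h
      rw [Nat.cofinite_eq_atTop] at h0
      -- Once `j ≥ ‖z‖`, one has `|p_j z| ≤ 1`, and the term is at least `2 ^ (-j-1) * 4 ^ j ≥ 1 /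
      -- 2`. Hence the series diverges on `Y`.
      have hev : ∀ᶠ j : ℕ in atTop, ENNReal.ofReal (1 / 2) ≤ D j (L z) z := by
        filter_upwards [eventually_ge_atTop ⌈‖z‖⌉₊] with j hj
        have hzj : ‖z‖ ≤ j := Nat.ceil_le.1 hj
        have h1 := ofReal_le_logDefect (M := n j * (M j + L z)) (norm_nonneg _) (hpY j z hz hzj)
        refine le_trans ?_ (mul_le_mul_right h1 _)
        rw [← ENNReal.ofReal_mul (by positivity)]
        refine ENNReal.ofReal_le_ofReal ?_
        have h2 : 1 / 2 / 2 ^ j / (n j : ℝ) * (n j * (M j + L z)) = 1 / 2 / 2 ^ j * (M j + L z) := by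
          field_simp [(hn0 j).ne']
        rw [h2]
        have h3 : (2 : ℝ) ^ j ≤ M j + L z := by
          have : (2 : ℝ) ^ j ≤ 4 ^ j := pow_le_pow_left₀ (by norm_num) (by norm_num) _
          linarith [hM4 j, hL0 z]
        rw [div_mul_eq_mul_div, le_div_iff₀ (by positivity)]
        linarith
      have := ge_of_tendsto h0 hev
      simp at this
    simp [this]

/-- Weighted Bernstein–Walsh inequality: weighted bounds on a bounded part of `Y` imply growth
bounds on `ℂ^m`. -/
theorem exists_bernsteinWalsh {m : ℕ} (Y : Set (Cn m)) (hYc : IsClosed Y)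
    (hY : ¬ IsPluripolar Y) (Q : Cn m → ℝ) (hQ : ContinuousOn Q Y) :
    ∃ r A : ℝ, 1 ≤ A ∧ ∀ n : ℕ, 1 ≤ n → ∀ p : MvPolynomial (Fin m) ℂ, p.totalDegree ≤ n →
      (∀ z ∈ Y, ‖z‖ ≤ r → ‖peval p z‖ * Real.exp (-(n * Q z)) ≤ 1) →
        ∀ z : Cn m, ‖peval p z‖ ≤ (A * max 1 ‖z‖) ^ n := by
  obtain ⟨r, A, hA, h⟩ := exists_norm_peval_le_pow_of_not_isPluripolar Y hY
  have hK : IsCompact (Y ∩ Metric.closedBall 0 r) := (isCompact_closedBall 0 r).inter_left hYc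
  obtain ⟨B, hB⟩ := (hK.image_of_continuousOn (hQ.mono Set.inter_subset_left)).bddAbove
  have hB' : ∀ z ∈ Y, ‖z‖ ≤ r → Q z ≤ max B 0 := fun z hz hzr =>
    (hB ⟨z, ⟨hz, by simpa using hzr⟩, rfl⟩).trans (le_max_left _ _)
  refine ⟨r, A * Real.exp (max B 0), one_le_mul_of_one_le_of_one_le hA
    (Real.one_le_exp (le_max_right _ _)), fun n hn p hp hpY z => ?_⟩
  rw [mul_pow]
  refine norm_peval_le_max_pow p n hp _ (fun w hw => ?_) z
  -- On the bounded piece `exp (n Q)` is at most `c`, so `p / c` satisfies the unweighted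
  -- hypothesis; the factor `c` is absorbed in the base of the power.
  set c : ℝ := Real.exp (n * max B 0) with hc
  have hcpos : 0 < c := Real.exp_pos _
  have hq : ∀ v : Cn m, peval (MvPolynomial.C ((c⁻¹ : ℝ) : ℂ) * p) v = ((c⁻¹ : ℝ) : ℂ) * peval p v := by
    intro v; simp [peval]
  have hqn : ∀ v : Cn m, ‖peval (MvPolynomial.C ((c⁻¹ : ℝ) : ℂ) * p) v‖ = c⁻¹ * ‖peval p v‖ := by
    intro v
    rw [hq, norm_mul, Complex.norm_real, Real.norm_eq_abs, abs_of_pos (by positivity)]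
  have h1 := h n hn (MvPolynomial.C ((c⁻¹ : ℝ) : ℂ) * p)
    ((MvPolynomial.totalDegree_mul _ _).trans (by simpa using hp)) (fun v hv hvr => by
      rw [hqn, inv_mul_le_iff₀ hcpos, mul_one]
      have h2 := hpY v hv hvr
      rw [Real.exp_neg, mul_inv_le_iff₀ (Real.exp_pos _), one_mul] at h2
      refine h2.trans (Real.exp_le_exp.2 ?_)
      have := hB' v hv hvr
      gcongr) w hw
  rw [hqn, inv_mul_le_iff₀ hcpos] at h1
  refine h1.trans (le_of_eq ?_)
  rw [mul_pow, hc, Real.exp_nat_mul, mul_comm]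

end Pluripotential

/-! ### Weighted polynomials -/

namespace Pluripotential

theorem peval_C_mul {m : ℕ} (c : ℂ) (p : MvPolynomial (Fin m) ℂ) (z : Cn m) :
    peval (MvPolynomial.C c * p) z = c * peval p z := by
  simp [peval]

theorem peval_add {m : ℕ} (p q : MvPolynomial (Fin m) ℂ) (z : Cn m) :
    peval (p + q) z = peval p z + peval q z := by
  simp [peval]

theorem peval_sum_smul {m : ℕ} {ι : Type*} [Fintype ι] (x : ι → ℂ)
    (f : ι → MvPolynomial (Fin m) ℂ) (z : Cn m) :
    peval (∑ i, x i • f i) z = ∑ i, x i * peval (f i) z := by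
  simp [peval, map_sum, MvPolynomial.smul_eval]

theorem totalDegree_C_mul_le {m : ℕ} (c : ℂ) (p : MvPolynomial (Fin m) ℂ) :
    (MvPolynomial.C c * p).totalDegree ≤ p.totalDegree :=
  (MvPolynomial.totalDegree_mul _ _).trans (by simp)

theorem totalDegree_sum_smul_le {m n : ℕ} {ι : Type*} [Fintype ι] (x : ι → ℂ)
    (f : ι → MvPolynomial (Fin m) ℂ) (hf : ∀ i, (f i).totalDegree ≤ n) :
    (∑ i, x i • f i).totalDegree ≤ n :=
  MvPolynomial.totalDegree_finsetSum_le fun i _ =>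
    (MvPolynomial.totalDegree_smul_le _ _).trans (hf i)

theorem eq_zero_of_peval_eq_zero {m : ℕ} (p : MvPolynomial (Fin m) ℂ)
    (h : ∀ z : Cn m, peval p z = 0) : p = 0 := by
  refine MvPolynomial.funext fun x => ?_
  simpa [peval] using h (WithLp.toLp 2 x)

/-- `|p| e^{-nQ}`. -/
noncomputable def weightedNorm {m : ℕ} (Q : Cn m → ℝ) (n : ℕ) (p : MvPolynomial (Fin m) ℂ)
    (z : Cn m) : ℝ :=
  ‖peval p z‖ * Real.exp (-(n * Q z))

theorem weightedNorm_nonneg {m : ℕ} (Q : Cn m → ℝ) (n : ℕ) (p : MvPolynomial (Fin m) ℂ)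
    (z : Cn m) : 0 ≤ weightedNorm Q n p z := by
  unfold weightedNorm; positivity

theorem weightedNorm_C_mul {m : ℕ} (Q : Cn m → ℝ) (n : ℕ) (c : ℂ) (p : MvPolynomial (Fin m) ℂ)
    (z : Cn m) : weightedNorm Q n (MvPolynomial.C c * p) z = ‖c‖ * weightedNorm Q n p z := by
  unfold weightedNorm
  rw [peval_C_mul, norm_mul, mul_assoc]

theorem weightedNorm_sq {m : ℕ} (Q : Cn m → ℝ) (n : ℕ) (p : MvPolynomial (Fin m) ℂ)
    (z : Cn m) :
    weightedNorm Q n p z ^ 2 = ‖peval p z‖ ^ 2 * Real.exp (-(2 * n * Q z)) := by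
  unfold weightedNorm
  rw [mul_pow, ← Real.exp_nat_mul]
  congr 2; push_cast; ring

theorem continuousOn_weightedNorm {m : ℕ} {Y : Set (Cn m)} {Q : Cn m → ℝ} (hQ : ContinuousOn Q Y)
    (n : ℕ) (p : MvPolynomial (Fin m) ℂ) : ContinuousOn (weightedNorm Q n p) Y := by
  unfold weightedNorm
  exact (continuous_peval p).norm.continuousOn.mul
    (Real.continuous_exp.comp_continuousOn ((continuousOn_const.mul hQ).neg))

theorem exists_weightedNorm_le {m : ℕ} {Y : Set (Cn m)} {Q : Cn m → ℝ} (hYc : IsClosed Y)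
    (hQ : ContinuousOn Q Y) (n : ℕ) (p : MvPolynomial (Fin m) ℂ) (r : ℝ) :
    ∃ c : ℝ, 0 < c ∧ ∀ z ∈ Y, ‖z‖ ≤ r → weightedNorm Q n p z ≤ c := by
  have hK : IsCompact (Y ∩ Metric.closedBall 0 r) := (isCompact_closedBall 0 r).inter_left hYc
  obtain ⟨B, hB⟩ := (hK.image_of_continuousOn
    ((continuousOn_weightedNorm hQ n p).mono Set.inter_subset_left)).bddAbove
  exact ⟨max B 1, by positivity, fun z hz hzr =>
    (hB ⟨z, ⟨hz, by simpa using hzr⟩, rfl⟩).trans (le_max_left _ _)⟩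

theorem SuperLogarithmic.exists_le {m : ℕ} {Y : Set (Cn m)} {Q : Cn m → ℝ}
    (hQ : SuperLogarithmic Y Q) :
    ∃ b : ℝ, 0 < b ∧ ∀ C : ℝ, ∃ R : ℝ, 1 ≤ R ∧ ∀ z ∈ Y, R ≤ ‖z‖ →
      C + (1 + b) * Real.log ‖z‖ ≤ Q z := by
  obtain ⟨b, hb, h⟩ := hQ
  refine ⟨b, hb, fun C => ?_⟩
  have h1 := h.eventually_ge_atTop C
  rw [eventually_inf_principal, ← comap_norm_atTop, eventually_comap] at h1
  obtain ⟨R, hR⟩ := eventually_atTop.1 h1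
  exact ⟨max R 1, le_max_right _ _, fun z hz hzR => by
    linarith [hR ‖z‖ ((le_max_left _ _).trans hzR) z rfl hz]⟩

/-- A lower bound `q` for `Q` makes the constants `exp (n q)` admissible competitors, which bounds
`phi` and `extremalFunction` from below. -/
theorem exists_weight_lower_bound {m : ℕ} {Y : Set (Cn m)} {Q : Cn m → ℝ} (hYc : IsClosed Y)
    (hQ : ContinuousOn Q Y) (hQs : SuperLogarithmic Y Q) : ∃ q : ℝ, ∀ z ∈ Y, q ≤ Q z := by
  obtain ⟨b, hb, h⟩ := hQs.exists_le
  obtain ⟨R, hR1, hR⟩ := h 0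
  have hK : IsCompact (Y ∩ Metric.closedBall 0 R) := (isCompact_closedBall 0 R).inter_left hYc
  obtain ⟨B, hB⟩ := (hK.image_of_continuousOn (hQ.mono Set.inter_subset_left)).bddBelow
  refine ⟨min B 0, fun z hz => ?_⟩
  rcases le_total ‖z‖ R with hzR | hzR
  · exact (min_le_left _ _).trans (hB ⟨z, ⟨hz, by simpa using hzR⟩, rfl⟩)
  · refine (min_le_right _ _).trans (le_trans ?_ (hR z hz hzR))
    have := Real.log_nonneg (hR1.trans hzR)
    positivity

/-- Weighted polynomials which are bounded on a certain bounded part of `Y` are bounded on `Y` and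
decay at infinity. -/
theorem exists_weightedNorm_decay {m : ℕ} {Y : Set (Cn m)} {Q : Cn m → ℝ} (hYc : IsClosed Y)
    (hYn : ¬ IsPluripolar Y) (hQ : ContinuousOn Q Y) (hQs : SuperLogarithmic Y Q) :
    ∃ b A r : ℝ, 0 < b ∧ 1 ≤ A ∧ 1 ≤ r ∧ ∀ n : ℕ, 1 ≤ n → ∀ p : MvPolynomial (Fin m) ℂ,
      p.totalDegree ≤ n → ∀ c : ℝ, 0 < c → (∀ z ∈ Y, ‖z‖ ≤ r → weightedNorm Q n p z ≤ c) →
        (∀ z, ‖peval p z‖ ≤ c * (A * max 1 ‖z‖) ^ n) ∧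
        (∀ z ∈ Y, r ≤ ‖z‖ → weightedNorm Q n p z ≤ c * ‖z‖ ^ (-(n * b))) ∧
        ∀ z ∈ Y, weightedNorm Q n p z ≤ c := by
  obtain ⟨r₀, A, hA, hBW⟩ := exists_bernsteinWalsh Y hYc hYn Q hQ
  obtain ⟨b, hb, h⟩ := hQs.exists_le
  -- The additive constant `log A` cancels the factor `A ^ n` of the Bernstein–Walsh bound, leaving
  -- precisely `‖z‖ ^ (-(n * b))`.
  obtain ⟨R, hR1, hR⟩ := h (Real.log A)
  refine ⟨b, A, max r₀ R, hb, hA, hR1.trans (le_max_right _ _), fun n hn p hp c hc hpc => ?_⟩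
  have hgrow : ∀ z, ‖peval p z‖ ≤ c * (A * max 1 ‖z‖) ^ n := by
    intro z
    have hcn : ‖((c⁻¹ : ℝ) : ℂ)‖ = c⁻¹ := by
      rw [Complex.norm_real, Real.norm_eq_abs, abs_of_pos (by positivity)]
    have := hBW n hn (MvPolynomial.C ((c⁻¹ : ℝ) : ℂ) * p) ((totalDegree_C_mul_le _ _).trans hp)
      (fun w hw hwr => by
        have h1 := weightedNorm_C_mul Q n ((c⁻¹ : ℝ) : ℂ) p w
        unfold weightedNorm at h1
        rw [h1, hcn, inv_mul_le_iff₀ hc, mul_one]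
        exact hpc w hw (hwr.trans (le_max_left _ _))) z
    rwa [peval_C_mul, norm_mul, hcn, inv_mul_le_iff₀ hc] at this
  have hdecay : ∀ z ∈ Y, max r₀ R ≤ ‖z‖ → weightedNorm Q n p z ≤ c * ‖z‖ ^ (-(n * b)) := by
    intro z hz hzr
    have hzR : R ≤ ‖z‖ := (le_max_right _ _).trans hzr
    have hz1 : 1 ≤ ‖z‖ := hR1.trans hzR
    have hz0 : 0 < ‖z‖ := by linarith
    have hA0 : 0 < A := by linarith
    have h1 := hR z hz hzR
    have h2 := hgrow z
    rw [max_eq_right hz1] at h2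
    unfold weightedNorm
    have h3 : Real.exp (-(n * Q z)) ≤ Real.exp (-(n * (Real.log A + (1 + b) * Real.log ‖z‖))) := by
      gcongr
    refine (mul_le_mul h2 h3 (Real.exp_pos _).le (by positivity)).trans (le_of_eq ?_)
    have h4 : (A * ‖z‖) ^ n = Real.exp (n * (Real.log A + Real.log ‖z‖)) := by
      rw [← Real.log_mul hA0.ne' hz0.ne', Real.exp_nat_mul, Real.exp_log (by positivity)]
    rw [h4, mul_assoc, ← Real.exp_add, Real.rpow_def_of_pos hz0]
    congr 2; ring
  refine ⟨hgrow, hdecay, fun z hz => ?_⟩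
  rcases le_total ‖z‖ (max r₀ R) with hzr | hzr
  · exact hpc z hz hzr
  · refine (hdecay z hz hzr).trans (mul_le_of_le_one_right hc.le ?_)
    refine Real.rpow_le_one_of_one_le_of_nonpos (hR1.trans ((le_max_right _ _).trans hzr)) ?_
    have : 0 ≤ (n : ℝ) * b := by positivity
    linarith

/-- Every multiple `k * p` is bounded by `1` on `Y`, so `k * |p| ≤ A ^ n` on the unit ball for all
`k`. -/
theorem eq_zero_of_peval_eq_zero_on {m : ℕ} {Y : Set (Cn m)} (hYn : ¬ IsPluripolar Y)
    (p : MvPolynomial (Fin m) ℂ) (h : ∀ z ∈ Y, peval p z = 0) : p = 0 := by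
  obtain ⟨r, A, -, hA⟩ := exists_norm_peval_le_pow_of_not_isPluripolar Y hYn
  set n := max 1 p.totalDegree with hn
  refine eq_zero_of_peval_eq_zero p fun z => ?_
  have hball : ∀ w : Cn m, ‖w‖ ≤ 1 → peval p w = 0 := by
    intro w hw
    by_contra hne
    have hpos : 0 < ‖peval p w‖ := norm_pos_iff.2 hne
    obtain ⟨k, hk⟩ := exists_nat_gt (A ^ n / ‖peval p w‖)
    have := hA n (le_max_left _ _) (MvPolynomial.C (k : ℂ) * p)
      ((totalDegree_C_mul_le _ _).trans (le_max_right _ _))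
      (fun v hv _ => by rw [peval_C_mul, h v hv]; simp) w hw
    rw [peval_C_mul, norm_mul, Complex.norm_natCast, ← le_div_iff₀ hpos] at this
    linarith
  have := norm_peval_le_max_pow p n (le_max_right _ _) 0 (fun w hw => by simp [hball w hw]) z
  simpa using this

/-! ### The inner product of `L²(e^{-2nQ} τ)` -/

/-- `p ∈ L²(e^{-2nQ} τ)`. -/
def WeightedL2 {m : ℕ} (Y : Set (Cn m)) (Q : Cn m → ℝ) (τ : Measure (Cn m)) (n : ℕ)
    (p : MvPolynomial (Fin m) ℂ) : Prop :=
  IntegrableOn (fun z => ‖peval p z‖ ^ 2 * Real.exp (-(2 * n * Q z))) Y τ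

/-- The inner product of `L²(e^{-2nQ} τ)`. -/
noncomputable def weightedInner {m : ℕ} (Y : Set (Cn m)) (Q : Cn m → ℝ) (τ : Measure (Cn m))
    (n : ℕ) (p q : MvPolynomial (Fin m) ℂ) : ℂ :=
  ∫ z in Y, peval p z * conj (peval q z) * (Real.exp (-(2 * n * Q z)) : ℂ) ∂τ

section WeightedInner

variable {m n : ℕ} {Y : Set (Cn m)} {Q : Cn m → ℝ} {τ : Measure (Cn m)}

theorem aestronglyMeasurable_weightedInner (hYc : IsClosed Y) (hQ : ContinuousOn Q Y)
    (p q : MvPolynomial (Fin m) ℂ) :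
    AEStronglyMeasurable
      (fun z => peval p z * conj (peval q z) * (Real.exp (-(2 * n * Q z)) : ℂ)) (τ.restrict Y) := by
  refine ContinuousOn.aestronglyMeasurable ?_ hYc.measurableSet
  refine ((continuous_peval p).mul
    (Complex.continuous_conj.comp (continuous_peval q))).continuousOn.mul ?_
  exact Complex.continuous_ofReal.comp_continuousOn
    (Real.continuous_exp.comp_continuousOn ((continuousOn_const.mul hQ).neg))

theorem WeightedL2.integrable_inner (hYc : IsClosed Y) (hQ : ContinuousOn Q Y)
    {p q : MvPolynomial (Fin m) ℂ} (hp : WeightedL2 Y Q τ n p) (hq : WeightedL2 Y Q τ n q) :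
    IntegrableOn (fun z => peval p z * conj (peval q z) * (Real.exp (-(2 * n * Q z)) : ℂ)) Y τ := by
  refine Integrable.mono' (Integrable.add hp hq) (aestronglyMeasurable_weightedInner hYc hQ p q)
    (Eventually.of_forall fun z => ?_)
  simp only [norm_mul, RCLike.norm_conj, Complex.norm_real, Real.norm_eq_abs, Real.abs_exp,
    Pi.add_apply]
  rw [← add_mul]
  refine mul_le_mul_of_nonneg_right ?_ (Real.exp_pos _).le
  nlinarith [sq_nonneg (‖peval p z‖ - ‖peval q z‖), sq_nonneg (‖peval p z‖ + ‖peval q z‖)]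

theorem weightedInner_self_integrand (p : MvPolynomial (Fin m) ℂ) (z : Cn m) :
    peval p z * conj (peval p z) * (Real.exp (-(2 * n * Q z)) : ℂ) =
      ((‖peval p z‖ ^ 2 * Real.exp (-(2 * n * Q z)) : ℝ) : ℂ) := by
  rw [Complex.mul_conj, Complex.normSq_eq_norm_sq]; push_cast; ring

theorem weightedInner_self (p : MvPolynomial (Fin m) ℂ) :
    weightedInner Y Q τ n p p =
      ((∫ z in Y, ‖peval p z‖ ^ 2 * Real.exp (-(2 * n * Q z)) ∂τ : ℝ) : ℂ) := by
  unfold weightedInner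
  simp only [weightedInner_self_integrand]
  exact integral_ofReal

/-- The Bochner integral of a nonintegrable function is `0` by convention, so a nonzero value
certifies integrability. -/
theorem weightedL2_of_weightedInner_self_ne_zero {p : MvPolynomial (Fin m) ℂ}
    (h : weightedInner Y Q τ n p p ≠ 0) : WeightedL2 Y Q τ n p := by
  by_contra hn
  refine h ?_
  rw [weightedInner_self, integral_undef hn, Complex.ofReal_zero]

theorem conj_weightedInner (p q : MvPolynomial (Fin m) ℂ) :
    conj (weightedInner Y Q τ n p q) = weightedInner Y Q τ n q p := by
  unfold weightedInner
  rw [← integral_conj]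
  refine integral_congr_ae (Eventually.of_forall fun z => ?_)
  simp only [map_mul, Complex.conj_conj, Complex.conj_ofReal]
  ring

theorem weightedInner_sum_smul (hYc : IsClosed Y) (hQ : ContinuousOn Q Y) {ι : Type*} [Fintype ι]
    {f : ι → MvPolynomial (Fin m) ℂ} (hf : ∀ i, WeightedL2 Y Q τ n (f i)) (x y : ι → ℂ) :
    weightedInner Y Q τ n (∑ i, x i • f i) (∑ i, y i • f i) =
      ∑ i, ∑ j, x i * conj (y j) * weightedInner Y Q τ n (f i) (f j) := by
  unfold weightedInner
  have h0 : ∀ i j, IntegrableOn (fun z => x i * conj (y j) *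
      (peval (f i) z * conj (peval (f j) z) * (Real.exp (-(2 * n * Q z)) : ℂ))) Y τ := fun i j =>
      ((hf i).integrable_inner hYc hQ (hf j)).const_mul _
  simp only [← integral_const_mul]
  simp_rw [← integral_finsetSum _ (fun j _ => h0 _ j)]
  rw [← integral_finsetSum _ (fun i _ => integrable_finsetSum _ fun j _ => h0 i j)]
  refine integral_congr_ae (Eventually.of_forall fun z => ?_)
  dsimp only
  rw [peval_sum_smul, peval_sum_smul, map_sum, Finset.sum_mul_sum, Finset.sum_mul]
  refine Finset.sum_congr rfl fun i _ => ?_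
  rw [Finset.sum_mul]
  refine Finset.sum_congr rfl fun j _ => ?_
  rw [map_mul]; ring

end WeightedInner

/-! ### Monomials and orthonormal bases -/

/-- The monomial `z^ν`. -/
noncomputable def multiMonomial {m n : ℕ} (ν : MultiIndex m n) : MvPolynomial (Fin m) ℂ :=
  MvPolynomial.monomial (Finsupp.equivFunOnFinite.symm fun i => (ν.1 i : ℕ)) 1

theorem totalDegree_multiMonomial_le {m n : ℕ} (ν : MultiIndex m n) :
    (multiMonomial ν).totalDegree ≤ n := by
  refine (MvPolynomial.totalDegree_monomial_le _ _).trans ?_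
  rw [Finsupp.sum_fintype _ _ (fun _ => rfl)]
  simpa using ν.2

theorem multiMonomial_exponent_injective {m n : ℕ} :
    Function.Injective fun ν : MultiIndex m n =>
      (Finsupp.equivFunOnFinite.symm fun i => (ν.1 i : ℕ) : Fin m →₀ ℕ) := by
  intro ν γ h
  have h1 := Finsupp.equivFunOnFinite.symm.injective h
  exact Subtype.ext (funext fun i => Fin.ext (congrFun h1 i))

theorem sum_smul_multiMonomial_injective {m n : ℕ} (x : MultiIndex m n → ℂ)
    (h : ∑ ν, x ν • multiMonomial ν = 0) : x = 0 := by
  ext γ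
  have h1 := congrArg (MvPolynomial.coeff
    (Finsupp.equivFunOnFinite.symm fun i => (γ.1 i : ℕ))) h
  rw [MvPolynomial.coeff_sum] at h1
  simp only [multiMonomial, MvPolynomial.coeff_smul, MvPolynomial.coeff_monomial] at h1
  rw [Finset.sum_eq_single γ] at h1
  · simpa using h1
  · intro ν _ hν
    rw [if_neg, smul_zero]
    exact fun hh => hν (multiMonomial_exponent_injective hh)
  · simp

theorem mem_span_multiMonomial {m n : ℕ} (q : MvPolynomial (Fin m) ℂ) (hq : q.totalDegree ≤ n) :
    q ∈ Submodule.span ℂ (Set.range (multiMonomial : MultiIndex m n → _)) := by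
  rw [q.as_sum]
  refine Submodule.sum_mem _ fun d hd => ?_
  have hdn : ∑ i, d i ≤ n := by
    refine le_trans ?_ hq
    have := MvPolynomial.le_totalDegree hd
    rwa [Finsupp.sum_fintype _ _ (fun _ => rfl)] at this
  have hdi : ∀ i, d i < n + 1 := fun i =>
    Nat.lt_succ_of_le ((Finset.single_le_sum (fun _ _ => Nat.zero_le _) (Finset.mem_univ i)).trans hdn)
  have h1 : MvPolynomial.monomial d (q.coeff d) =
      q.coeff d • multiMonomial (⟨fun i => ⟨d i, hdi i⟩, hdn⟩ : MultiIndex m n) := by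
    rw [multiMonomial, MvPolynomial.smul_monomial, smul_eq_mul, mul_one]
    congr 1
    ext i; simp
  rw [h1]
  exact Submodule.smul_mem _ _ (Submodule.subset_span ⟨_, rfl⟩)

theorem card_multiIndex_le_pow (m n : ℕ) : Fintype.card (MultiIndex m n) ≤ (n + 1) ^ m := by
  refine (Fintype.card_subtype_le _).trans ?_
  simp

/-- Stars and bars: the slack `n - |ν|`, added as an extra coordinate, gives an injection into the
exponents of total exactly `n` in `m + 1` variables. -/
theorem card_multiIndex_le_choose (m n : ℕ) :
    Fintype.card (MultiIndex m n) ≤ (m + n).choose n := by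
  have h := Finset.card_finsuppAntidiag_nat_eq_choose (s := (Finset.univ : Finset (Fin (m + 1)))) n
  simp only [Finset.card_univ, Fintype.card_fin] at h
  have h2 : m + 1 + n - 1 = m + n := by omega
  rw [h2] at h
  rw [← h, ← Finset.card_univ]
  refine Finset.card_le_card_of_injOn
    (fun ν => Finsupp.equivFunOnFinite.symm
      (Fin.cons (n - ∑ i, (ν.1 i : ℕ)) fun i => (ν.1 i : ℕ))) ?_ ?_
  · intro ν _
    have := ν.2
    simp only [Finset.mem_coe, Finset.mem_finsuppAntidiag,
      Finset.subset_univ, and_true]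
    change ∑ j, (Fin.cons (n - ∑ i, (ν.1 i : ℕ)) fun i => (ν.1 i : ℕ) : Fin (m + 1) → ℕ) j = n
    rw [Fin.sum_univ_succ]
    simp only [Fin.cons_zero, Fin.cons_succ]
    omega
  · intro ν _ γ _ hh
    have h1 := Finsupp.equivFunOnFinite.symm.injective hh
    refine Subtype.ext (funext fun i => Fin.ext ?_)
    simpa using congrFun h1 i.succ

-- The Gram matrix of the monomials is positive definite, hence of the form `B* B` with `B`
-- invertible. The columns of `B⁻¹` are the coefficient vectors of an orthonormal basis.
open scoped ComplexOrder in
theorem exists_isOrthonormalBasis {m n : ℕ} {Y : Set (Cn m)} {Q : Cn m → ℝ} {τ : Measure (Cn m)}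
    (hYc : IsClosed Y) (hQ : ContinuousOn Q Y)
    (hint : ∀ q : MvPolynomial (Fin m) ℂ, q.totalDegree ≤ n → WeightedL2 Y Q τ n q)
    (hpos : ∀ q : MvPolynomial (Fin m) ℂ, q.totalDegree ≤ n →
      ∫ z in Y, ‖peval q z‖ ^ 2 * Real.exp (-(2 * n * Q z)) ∂τ = 0 → q = 0) :
    ∃ p : MultiIndex m n → MvPolynomial (Fin m) ℂ, IsOrthonormalBasis Y Q τ n p := by
  classical
  have hmono : ∀ ν : MultiIndex m n, WeightedL2 Y Q τ n (multiMonomial ν) := fun ν =>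
    hint _ (totalDegree_multiMonomial_le ν)
  -- The indices are exchanged because the inner product is conjugate linear in its second argument;
  -- this makes it equal to `y* G x`.
  let G : Matrix (MultiIndex m n) (MultiIndex m n) ℂ := fun ν γ =>
    weightedInner Y Q τ n (multiMonomial γ) (multiMonomial ν)
  have hquad : ∀ x y : MultiIndex m n → ℂ,
      weightedInner Y Q τ n (∑ ν, x ν • multiMonomial ν) (∑ ν, y ν • multiMonomial ν) =
        star y ⬝ᵥ (G.mulVec x) := by
    intro x y
    rw [weightedInner_sum_smul hYc hQ hmono, Finset.sum_comm]
    simp only [dotProduct, Matrix.mulVec, Finset.mul_sum, G]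
    refine Finset.sum_congr rfl fun j _ => Finset.sum_congr rfl fun i _ => ?_
    simp only [Pi.star_apply, RCLike.star_def]
    ring
  have hG : G.PosDef := by
    refine Matrix.PosDef.of_dotProduct_mulVec_pos ?_ fun x hx => ?_
    · ext ν γ
      exact conj_weightedInner _ _
    · rw [← hquad, weightedInner_self]
      have h1 : 0 ≤ ∫ z in Y, ‖peval (∑ ν, x ν • multiMonomial ν) z‖ ^ 2 *
          Real.exp (-(2 * n * Q z)) ∂τ := integral_nonneg fun z => by positivity
      have h2 := h1.lt_of_ne' fun h0 => hx (sum_smul_multiMonomial_injective x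
        (hpos _ (totalDegree_sum_smul_le _ _ totalDegree_multiMonomial_le) h0))
      exact_mod_cast h2
  obtain ⟨B, hB⟩ : ∃ B : Matrix (MultiIndex m n) (MultiIndex m n) ℂ, G = B.conjTranspose * B := by
    open scoped MatrixOrder in
      exact CStarAlgebra.nonneg_iff_eq_star_mul_self.mp hG.posSemidef.nonneg
  have hBu : IsUnit B := by
    have h1 := hG.isUnit
    rw [hB, Matrix.isUnit_iff_isUnit_det, Matrix.det_mul] at h1
    rw [Matrix.isUnit_iff_isUnit_det]
    exact isUnit_of_mul_isUnit_right h1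
  have hBd : IsUnit B.det := (Matrix.isUnit_iff_isUnit_det B).1 hBu
  let p : MultiIndex m n → MvPolynomial (Fin m) ℂ := fun γ => ∑ ν, B⁻¹ ν γ • multiMonomial ν
  refine ⟨p, ?_, ?_, ?_⟩
  · exact fun ν => totalDegree_sum_smul_le _ _ totalDegree_multiMonomial_le
  · intro ν γ
    change weightedInner Y Q τ n (p ν) (p γ) = _
    have h1 : weightedInner Y Q τ n (p ν) (p γ) =
        ((B⁻¹).conjTranspose * (G * B⁻¹)) γ ν := by
      rw [hquad]; rfl
    rw [h1, hB, Matrix.mul_assoc, Matrix.mul_nonsing_inv B hBd, Matrix.mul_one,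
      ← Matrix.conjTranspose_mul, Matrix.mul_nonsing_inv B hBd, Matrix.conjTranspose_one,
      Matrix.one_apply]
    simp only [eq_comm]
  · intro q hq
    refine Submodule.span_le.2 ?_ (mem_span_multiMonomial q hq)
    rintro _ ⟨ν, rfl⟩
    have h1 : multiMonomial ν = ∑ γ, B γ ν • p γ := by
      have h2 : ∀ κ, ∑ γ, B γ ν * B⁻¹ κ γ = if κ = ν then 1 else 0 := by
        intro κ
        have := congrFun (congrFun (Matrix.nonsing_inv_mul B hBd) κ) ν
        rw [Matrix.mul_apply, Matrix.one_apply] at this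
        rw [← this]
        exact Finset.sum_congr rfl fun _ _ => mul_comm _ _
      simp only [p, Finset.smul_sum, smul_smul]
      rw [Finset.sum_comm]
      simp only [← Finset.sum_smul, h2]
      simp
    rw [SetLike.mem_coe, h1]
    exact Submodule.sum_mem _ fun γ _ => Submodule.smul_mem _ _ (Submodule.subset_span ⟨γ, rfl⟩)

/-! ### Parseval, the reproducing inequality and norm comparison for fixed degree -/

namespace IsOrthonormalBasis

variable {m n : ℕ} {Y : Set (Cn m)} {Q : Cn m → ℝ} {τ : Measure (Cn m)}
  {p : MultiIndex m n → MvPolynomial (Fin m) ℂ}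

theorem weightedL2 (h : IsOrthonormalBasis Y Q τ n p) (ν : MultiIndex m n) :
    WeightedL2 Y Q τ n (p ν) := by
  refine weightedL2_of_weightedInner_self_ne_zero ?_
  have : weightedInner Y Q τ n (p ν) (p ν) = 1 := by
    have := h.orthonormal ν ν
    rwa [if_pos rfl] at this
  rw [this]; exact one_ne_zero

theorem exists_coeff (h : IsOrthonormalBasis Y Q τ n p) (q : MvPolynomial (Fin m) ℂ)
    (hq : q.totalDegree ≤ n) : ∃ c : MultiIndex m n → ℂ, ∑ ν, c ν • p ν = q :=
  (Submodule.mem_span_range_iff_exists_fun ℂ).1 (h.span q hq)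

theorem integral_sum_smul (h : IsOrthonormalBasis Y Q τ n p) (hYc : IsClosed Y)
    (hQ : ContinuousOn Q Y) (c : MultiIndex m n → ℂ) :
    ∫ z in Y, ‖peval (∑ ν, c ν • p ν) z‖ ^ 2 * Real.exp (-(2 * n * Q z)) ∂τ = ∑ ν, ‖c ν‖ ^ 2 := by
  have h1 := weightedInner_sum_smul hYc hQ h.weightedL2 c c
  rw [weightedInner_self] at h1
  have h2 : ∀ ν γ, weightedInner Y Q τ n (p ν) (p γ) = if ν = γ then 1 else 0 := h.orthonormal
  simp only [h2, mul_ite, mul_one, mul_zero, Finset.sum_ite_eq, Finset.mem_univ, if_true,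
    Complex.mul_conj, Complex.normSq_eq_norm_sq] at h1
  exact_mod_cast h1

/-- Expansion in the basis, Cauchy–Schwarz and Parseval: the diagonal kernel bounds the squared norm
of point evaluation. -/
theorem norm_sq_le (h : IsOrthonormalBasis Y Q τ n p) (hYc : IsClosed Y)
    (hQ : ContinuousOn Q Y) (q : MvPolynomial (Fin m) ℂ) (hq : q.totalDegree ≤ n) (z : Cn m) :
    ‖peval q z‖ ^ 2 ≤
      (∫ w in Y, ‖peval q w‖ ^ 2 * Real.exp (-(2 * n * Q w)) ∂τ) * bergmanDiag p z := by
  obtain ⟨c, rfl⟩ := h.exists_coeff q hq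
  rw [h.integral_sum_smul hYc hQ, peval_sum_smul, bergmanDiag]
  refine le_trans ?_ (Finset.sum_mul_sq_le_sq_mul_sq _ _ _)
  gcongr
  refine (norm_sum_le _ _).trans (le_of_eq ?_)
  simp

/-- For fixed `n`, the `L²` norm is controlled by the weighted supremum norm. -/
theorem exists_integral_le (h : IsOrthonormalBasis Y Q τ n p) (hYc : IsClosed Y)
    (hYn : ¬ IsPluripolar Y) (hQ : ContinuousOn Q Y) :
    ∃ C : ℝ, ∀ q : MvPolynomial (Fin m) ℂ, q.totalDegree ≤ n → WeightedLeOne Y Q n q →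
      ∫ w in Y, ‖peval q w‖ ^ 2 * Real.exp (-(2 * n * Q w)) ∂τ ≤ C := by
  let T : (MultiIndex m n → ℂ) →ₗ[ℂ] (Y → ℂ) :=
    { toFun := fun c z => ∑ ν, c ν * peval (p ν) z
      map_add' := fun c d => by ext z; simp [add_mul, Finset.sum_add_distrib]
      map_smul' := fun a c => by ext z; simp [mul_assoc, Finset.mul_sum] }
  have hker : LinearMap.ker T = ⊥ := by
    rw [LinearMap.ker_eq_bot']
    intro c hc
    have h1 : ∑ ν, c ν • p ν = 0 := by
      refine eq_zero_of_peval_eq_zero_on hYn _ fun z hz => ?_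
      rw [peval_sum_smul]
      exact congrFun hc ⟨z, hz⟩
    have h2 := h.integral_sum_smul hYc hQ c
    rw [h1] at h2
    have h3 : ∑ ν, ‖c ν‖ ^ 2 = 0 := by rw [← h2]; simp [peval]
    ext ν
    have := (Finset.sum_eq_zero_iff_of_nonneg fun i _ => sq_nonneg ‖c i‖).1 h3 ν (Finset.mem_univ _)
    simpa using this
  -- An injective linear map from a finite-dimensional space is a closed embedding. The coefficients
  -- of admissible polynomials lie in the preimage of a product of discs, which is compact by
  -- Tychonoff.
  have hemb := LinearMap.isClosedEmbedding_of_injective hker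
  have hK : IsCompact (Set.univ.pi fun z : Y => Metric.closedBall (0 : ℂ) (Real.exp (n * Q z))) :=
    isCompact_univ_pi fun z => isCompact_closedBall _ _
  obtain ⟨C, hC⟩ := ((hemb.isCompact_preimage hK).image
    (f := fun c : MultiIndex m n → ℂ => ∑ ν, ‖c ν‖ ^ 2) (by fun_prop)).bddAbove
  refine ⟨C, fun q hq hqw => ?_⟩
  obtain ⟨c, rfl⟩ := h.exists_coeff q hq
  rw [h.integral_sum_smul hYc hQ]
  refine hC ⟨c, ?_, rfl⟩
  intro z _
  have h1 := hqw z z.2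
  rw [peval_sum_smul, Real.exp_neg, mul_inv_le_iff₀ (Real.exp_pos _), one_mul] at h1
  simpa [T] using h1

end IsOrthonormalBasis

end Pluripotential

/-! ### Estimates for the Bergman kernel on the diagonal -/

namespace Pluripotential

/-- The standing hypotheses on the set `Y` and the weight `Q`. -/
structure IsWeightedSet {m : ℕ} (Y : Set (Cn m)) (Q : Cn m → ℝ) : Prop where
  isClosed : IsClosed Y
  not_isBounded : ¬ Bornology.IsBounded Y
  not_isPluripolar : ¬ IsPluripolar Y
  continuousOn : ContinuousOn Q Y
  superLogarithmic : SuperLogarithmic Y Q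

/-- The standing hypotheses on the measure `τ`. -/
structure IsWeightedMeasure {m : ℕ} (Y : Set (Cn m)) (Q : Cn m → ℝ) (τ : Measure (Cn m)) :
    Prop where
  locallyFinite : IsLocallyFiniteMeasure τ
  tail : ∃ a : ℝ, 0 < a ∧ ∫⁻ z in {z ∈ Y | 1 ≤ ‖z‖}, ENNReal.ofReal (‖z‖ ^ (-a)) ∂τ < ⊤
  bernsteinMarkov : ∃ r₀ : ℝ, ∀ r : ℝ, r₀ ≤ r → WeightedBernsteinMarkov {z ∈ Y | ‖z‖ ≤ r} Q τ

/-- From some `N` on, `M_n ≤ (1 + ε) ^ n`; the finitely many earlier constants are absorbed into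
`C`. -/
theorem WeightedBernsteinMarkov.exists_le_pow {m : ℕ} {K : Set (Cn m)} {Q : Cn m → ℝ}
    {τ : Measure (Cn m)} (h : WeightedBernsteinMarkov K Q τ) {ε : ℝ} (hε : 0 < ε) :
    ∃ C : ℝ, 0 < C ∧ ∀ n : ℕ, 1 ≤ n → ∀ p : MvPolynomial (Fin m) ℂ, p.totalDegree ≤ n → ∀ z ∈ K,
      weightedNorm Q n p z ≤ C * (1 + ε) ^ n *
        Real.sqrt (∫ w in K, ‖peval p w‖ ^ 2 * Real.exp (-(2 * n * Q w)) ∂τ) := by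
  obtain ⟨M, hM, hBM⟩ := h
  have h1 : ∀ᶠ n : ℕ in atTop, (M n : ℝ≥0∞) ^ ((1 : ℝ) / n) < ENNReal.ofReal (1 + ε) := by
    refine eventually_lt_of_limsup_lt ?_
    rw [hM, ← ENNReal.ofReal_one]
    exact (ENNReal.ofReal_lt_ofReal_iff (by linarith)).2 (by linarith)
  obtain ⟨N, hN⟩ := eventually_atTop.1 h1
  have hMn : ∀ n : ℕ, 1 ≤ n → (M n : ℝ) ≤ (1 + ∑ k ∈ Finset.range N, (M k : ℝ)) * (1 + ε) ^ n := by
    intro n hn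
    have hpow : (1 : ℝ) ≤ (1 + ε) ^ n := one_le_pow₀ (by linarith)
    have hsum : 0 ≤ ∑ k ∈ Finset.range N, (M k : ℝ) := Finset.sum_nonneg fun _ _ => (M _).2
    rcases lt_or_ge n N with hnN | hnN
    · have := Finset.single_le_sum (f := fun k => (M k : ℝ)) (fun k _ => (M k).2)
        (Finset.mem_range.2 hnN)
      nlinarith
    · have h2 := (hN n hnN).le
      have h3 := ENNReal.rpow_le_rpow h2 (Nat.cast_nonneg n : (0 : ℝ) ≤ n)
      have hn0 : (n : ℝ) ≠ 0 := by positivity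
      rw [← ENNReal.rpow_mul, one_div, inv_mul_cancel₀ hn0, ENNReal.rpow_one, ENNReal.rpow_natCast,
        ← ENNReal.ofReal_pow (by linarith), ← ENNReal.ofReal_coe_nnreal,
        ENNReal.ofReal_le_ofReal_iff (by positivity)] at h3
      nlinarith
  refine ⟨1 + ∑ k ∈ Finset.range N, (M k : ℝ), ?_, fun n hn p hp z hz => ?_⟩
  · have hsum : 0 ≤ ∑ k ∈ Finset.range N, (M k : ℝ) := Finset.sum_nonneg fun _ _ => (M _).2
    linarith
  · exact (hBM n hn p hp z hz).trans
      (mul_le_mul_of_nonneg_right (hMn n hn) (Real.sqrt_nonneg _))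

namespace IsWeightedSet

variable {m : ℕ} {Y : Set (Cn m)} {Q : Cn m → ℝ}

/-- The real `sSup` of an unbounded set is `0`, so boundedness is what gives `phi` its meaning. It
comes from the Bernstein–Walsh growth. -/
theorem bddAbove_phi (h : IsWeightedSet Y Q) {n : ℕ} (hn : 1 ≤ n) (z : Cn m) :
    BddAbove {x : ℝ | ∃ g : MvPolynomial (Fin m) ℂ,
      g.totalDegree ≤ n ∧ WeightedLeOne Y Q n g ∧ x = ‖peval g z‖} := by
  obtain ⟨b, A, r, -, -, -, hd⟩ := exists_weightedNorm_decay h.isClosed h.not_isPluripolar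
    h.continuousOn h.superLogarithmic
  refine ⟨1 * (A * max 1 ‖z‖) ^ n, ?_⟩
  rintro _ ⟨g, hg, hgw, rfl⟩
  exact (hd n hn g hg 1 one_pos fun w hw _ => hgw w hw).1 z

theorem norm_le_phi (h : IsWeightedSet Y Q) {n : ℕ} (hn : 1 ≤ n) {g : MvPolynomial (Fin m) ℂ}
    (hg : g.totalDegree ≤ n) (hgw : WeightedLeOne Y Q n g) (z : Cn m) :
    ‖peval g z‖ ≤ phi Y Q n z :=
  le_csSup (h.bddAbove_phi hn z) ⟨g, hg, hgw, rfl⟩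

theorem norm_le_mul_phi (h : IsWeightedSet Y Q) {n : ℕ} (hn : 1 ≤ n) {g : MvPolynomial (Fin m) ℂ}
    (hg : g.totalDegree ≤ n) {c : ℝ} (hc : 0 < c) (hgw : ∀ z ∈ Y, weightedNorm Q n g z ≤ c)
    (z : Cn m) : ‖peval g z‖ ≤ c * phi Y Q n z := by
  have hcn : ‖((c⁻¹ : ℝ) : ℂ)‖ = c⁻¹ := by
    rw [Complex.norm_real, Real.norm_eq_abs, abs_of_pos (by positivity)]
  have h1 := h.norm_le_phi hn (g := MvPolynomial.C ((c⁻¹ : ℝ) : ℂ) * g)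
    ((totalDegree_C_mul_le _ _).trans hg) (fun w hw => by
      have h2 := weightedNorm_C_mul Q n ((c⁻¹ : ℝ) : ℂ) g w
      unfold weightedNorm at h2
      rw [h2, hcn, inv_mul_le_iff₀ hc, mul_one]
      exact hgw w hw) z
  rwa [peval_C_mul, norm_mul, hcn, inv_mul_le_iff₀ hc] at h1

theorem phi_nonneg (n : ℕ) (z : Cn m) : 0 ≤ phi Y Q n z := by
  refine Real.sSup_nonneg ?_
  rintro _ ⟨g, -, -, rfl⟩
  exact norm_nonneg _

theorem phi_le (_h : IsWeightedSet Y Q) {n : ℕ} {z : Cn m} {C : ℝ} (hC : 0 ≤ C)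
    (hle : ∀ g : MvPolynomial (Fin m) ℂ, g.totalDegree ≤ n → WeightedLeOne Y Q n g →
      ‖peval g z‖ ≤ C) : phi Y Q n z ≤ C := by
  refine Real.sSup_le ?_ hC
  rintro _ ⟨g, hg, hgw, rfl⟩
  exact hle g hg hgw

theorem exists_phi_le (h : IsWeightedSet Y Q) : ∃ A : ℝ, 1 ≤ A ∧ ∀ n : ℕ, 1 ≤ n → ∀ z,
    phi Y Q n z ≤ (A * max 1 ‖z‖) ^ n := by
  obtain ⟨b, A, r, -, hA, -, hd⟩ := exists_weightedNorm_decay h.isClosed h.not_isPluripolar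
    h.continuousOn h.superLogarithmic
  refine ⟨A, hA, fun n hn z => h.phi_le (by positivity) fun g hg hgw => ?_⟩
  simpa using (hd n hn g hg 1 one_pos fun w hw _ => hgw w hw).1 z

theorem exists_le_phi (h : IsWeightedSet Y Q) : ∃ q : ℝ, (∀ z ∈ Y, q ≤ Q z) ∧
    ∀ n : ℕ, 1 ≤ n → ∀ z, Real.exp (n * q) ≤ phi Y Q n z := by
  obtain ⟨q, hq⟩ := exists_weight_lower_bound h.isClosed h.continuousOn h.superLogarithmic
  refine ⟨q, hq, fun n hn z => ?_⟩
  have := h.norm_le_phi hn (g := MvPolynomial.C ((Real.exp (n * q) : ℝ) : ℂ))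
    (by simp) (fun w hw => ?_) z
  · refine le_trans (le_of_eq ?_) this
    simp only [peval, MvPolynomial.eval_C, Complex.norm_real, Real.norm_eq_abs, Real.abs_exp]
  · simp only [peval, MvPolynomial.eval_C, Complex.norm_real, Real.norm_eq_abs, Real.abs_exp]
    rw [← Real.exp_add, Real.exp_le_one_iff]
    have : (n : ℝ) * q ≤ n * Q w := mul_le_mul_of_nonneg_left (hq w hw) (Nat.cast_nonneg _)
    linarith

theorem phi_pos (h : IsWeightedSet Y Q) {n : ℕ} (hn : 1 ≤ n) (z : Cn m) : 0 < phi Y Q n z := by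
  obtain ⟨q, -, hq⟩ := h.exists_le_phi
  exact (Real.exp_pos _).trans_le (hq n hn z)

/-- For large `n` the weighted `L²` norm is controlled by the weighted supremum norm, uniformly
in `n`. -/
theorem exists_integral_tail_le (h : IsWeightedSet Y Q) {τ : Measure (Cn m)}
    (hτ : IsWeightedMeasure Y Q τ) :
    ∃ K : ℝ, ∃ n₀ : ℕ, 1 ≤ n₀ ∧ ∀ n : ℕ, n₀ ≤ n → ∀ p : MvPolynomial (Fin m) ℂ, p.totalDegree ≤ n →
      WeightedL2 Y Q τ n p ∧ (WeightedLeOne Y Q n p →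
        ∫ w in Y, ‖peval p w‖ ^ 2 * Real.exp (-(2 * n * Q w)) ∂τ ≤ K) := by
  obtain ⟨b, A, r, hb, -, hr, hd⟩ := exists_weightedNorm_decay h.isClosed h.not_isPluripolar
    h.continuousOn h.superLogarithmic
  obtain ⟨a, ha, hta⟩ := hτ.tail
  have := hτ.locallyFinite
  set S : Set (Cn m) := {z | 1 ≤ ‖z‖} with hS
  have hSm : MeasurableSet S := (isClosed_le continuous_const continuous_norm).measurableSet
  have hBm : MeasurableSet (Metric.closedBall (0 : Cn m) r) :=
    Metric.isClosed_closedBall.measurableSet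
  -- A dominating function independent of `n`: the indicator of a ball, integrable by local
  -- finiteness, plus the tail `‖z‖ ^ (-a)`.
  set g : Cn m → ℝ := fun z => (Metric.closedBall (0 : Cn m) r).indicator (fun _ => (1 : ℝ)) z +
    S.indicator (fun z => ‖z‖ ^ (-a)) z with hg
  have hgint : IntegrableOn g Y τ := by
    refine Integrable.add ?_ ?_
    · rw [integrable_indicator_iff hBm]
      have hfin : τ.restrict Y (Metric.closedBall (0 : Cn m) r) ≠ ⊤ :=
        ne_top_of_le_ne_top (isCompact_closedBall (0 : Cn m) r).measure_lt_top.ne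
          (Measure.restrict_apply_le _ _)
      exact integrableOn_const (hs := hfin)
    · rw [integrable_indicator_iff hSm, IntegrableOn, Measure.restrict_restrict hSm,
        Set.inter_comm]
      have hmeas : Measurable fun z : Cn m => ‖z‖ ^ (-a) := measurable_norm.pow_const _
      refine ⟨hmeas.aestronglyMeasurable, ?_⟩
      rw [hasFiniteIntegral_iff_ofReal (Eventually.of_forall fun z => by positivity)]
      exact hta
  have hbound : ∀ n : ℕ, 1 ≤ n → a ≤ 2 * n * b → ∀ p : MvPolynomial (Fin m) ℂ,
      p.totalDegree ≤ n → ∀ c : ℝ, 0 < c → (∀ z ∈ Y, ‖z‖ ≤ r → weightedNorm Q n p z ≤ c) →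
      ∀ z ∈ Y, ‖peval p z‖ ^ 2 * Real.exp (-(2 * n * Q z)) ≤ c ^ 2 * g z := by
    intro n hn hnb p hp c hc hpc z hz
    rw [← weightedNorm_sq]
    have hw0 := weightedNorm_nonneg Q n p z
    rcases le_total ‖z‖ r with hzr | hzr
    · have h1 : 1 ≤ g z := by
        have h2 : (Metric.closedBall (0 : Cn m) r).indicator (fun _ => (1 : ℝ)) z = 1 :=
          Set.indicator_of_mem (by simpa using hzr) _
        have h3 : 0 ≤ S.indicator (fun z => ‖z‖ ^ (-a)) z :=
          Set.indicator_nonneg (fun _ _ => by positivity) _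
        change 1 ≤ _ + _
        rw [h2]; linarith
      have h4 : weightedNorm Q n p z ^ 2 ≤ c ^ 2 := pow_le_pow_left₀ hw0 (hpc z hz hzr) 2
      nlinarith [sq_nonneg c]
    · have hz1 : 1 ≤ ‖z‖ := hr.trans hzr
      have hz0 : 0 < ‖z‖ := by linarith
      have h1 : ‖z‖ ^ (-a) ≤ g z := by
        have h2 : S.indicator (fun z => ‖z‖ ^ (-a)) z = ‖z‖ ^ (-a) :=
          Set.indicator_of_mem (show z ∈ S from hz1) _
        have h3 : 0 ≤ (Metric.closedBall (0 : Cn m) r).indicator (fun _ => (1 : ℝ)) z :=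
          Set.indicator_nonneg (fun _ _ => by positivity) _
        change _ ≤ _ + _
        rw [h2]; linarith
      have h4 := pow_le_pow_left₀ hw0 ((hd n hn p hp c hc hpc).2.1 z hz hzr) 2
      refine h4.trans ?_
      rw [mul_pow, ← Real.rpow_natCast (‖z‖ ^ _), ← Real.rpow_mul hz0.le]
      refine mul_le_mul_of_nonneg_left (le_trans ?_ h1) (sq_nonneg c)
      refine Real.rpow_le_rpow_of_exponent_le hz1 ?_
      push_cast; linarith
  -- The squared weighted norm decays like `‖z‖ ^ (-2 n b)`, which is below the tail `‖z‖ ^ (-a)`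
  -- once `2 n b ≥ a`.
  obtain ⟨N, hN⟩ := exists_nat_ge (a / (2 * b))
  refine ⟨∫ z in Y, g z ∂τ, max N 1, le_max_right _ _, fun n hn p hp => ?_⟩
  have hn1 : 1 ≤ n := (le_max_right _ _).trans hn
  have hnb : a ≤ 2 * n * b := by
    have h1 : (N : ℝ) ≤ n := by exact_mod_cast (le_max_left _ _).trans hn
    have h2 := hN.trans h1
    rw [div_le_iff₀ (by positivity)] at h2
    linarith
  have hL2 : WeightedL2 Y Q τ n p := by
    obtain ⟨c, hc, hpc⟩ := exists_weightedNorm_le h.isClosed h.continuousOn n p r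
    refine Integrable.mono' (hgint.const_mul (c ^ 2)) ?_ ?_
    · refine ContinuousOn.aestronglyMeasurable ?_ h.isClosed.measurableSet
      exact ((continuous_peval p).norm.pow 2).continuousOn.mul
        (Real.continuous_exp.comp_continuousOn ((continuousOn_const.mul h.continuousOn).neg))
    · filter_upwards [ae_restrict_mem h.isClosed.measurableSet] with z hz
      rw [Real.norm_eq_abs, abs_of_nonneg (by positivity)]
      exact hbound n hn1 hnb p hp c hc hpc z hz
  refine ⟨hL2, fun hpw => ?_⟩
  refine setIntegral_mono_on hL2 hgint h.isClosed.measurableSet fun z hz => ?_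
  simpa using hbound n hn1 hnb p hp 1 one_pos (fun w hw _ => hpw w hw) z hz

/-- Large `n` are covered by the tail estimate; each of the finitely many remaining degrees is
handled by finite-dimensional compactness. -/
theorem exists_integral_le (h : IsWeightedSet Y Q) {τ : Measure (Cn m)}
    (hτ : IsWeightedMeasure Y Q τ) :
    ∃ C : ℝ, 0 < C ∧ ∀ n : ℕ, ∀ p : MultiIndex m n → MvPolynomial (Fin m) ℂ,
      IsOrthonormalBasis Y Q τ n p → ∀ g : MvPolynomial (Fin m) ℂ, g.totalDegree ≤ n →
        WeightedLeOne Y Q n g →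
          ∫ w in Y, ‖peval g w‖ ^ 2 * Real.exp (-(2 * n * Q w)) ∂τ ≤ C := by
  obtain ⟨K, n₀, -, hK⟩ := h.exists_integral_tail_le hτ
  have hsmall : ∀ n : ℕ, ∃ C : ℝ, 0 ≤ C ∧ ∀ p : MultiIndex m n → MvPolynomial (Fin m) ℂ,
      IsOrthonormalBasis Y Q τ n p → ∀ g : MvPolynomial (Fin m) ℂ, g.totalDegree ≤ n →
        WeightedLeOne Y Q n g →
          ∫ w in Y, ‖peval g w‖ ^ 2 * Real.exp (-(2 * n * Q w)) ∂τ ≤ C := by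
    intro n
    by_cases hex : ∃ p : MultiIndex m n → MvPolynomial (Fin m) ℂ, IsOrthonormalBasis Y Q τ n p
    · obtain ⟨p, hp⟩ := hex
      obtain ⟨C, hC⟩ := hp.exists_integral_le h.isClosed h.not_isPluripolar h.continuousOn
      -- The bound concerns only `g`, so one basis provides the constant for all of them.
      exact ⟨max C 0, le_max_right _ _, fun _ _ g hg hgw => (hC g hg hgw).trans (le_max_left _ _)⟩
    · exact ⟨0, le_rfl, fun p hp => absurd ⟨p, hp⟩ hex⟩
  choose C hC0 hC using hsmall
  have hsum : 0 ≤ ∑ k ∈ Finset.range n₀, C k := Finset.sum_nonneg fun _ _ => hC0 _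
  have hKpos := le_max_right K 0
  refine ⟨1 + max K 0 + ∑ k ∈ Finset.range n₀, C k, by linarith, fun n p hp g hg hgw => ?_⟩
  rcases lt_or_ge n n₀ with hn | hn
  · have := Finset.single_le_sum (f := C) (fun k _ => hC0 k) (Finset.mem_range.2 hn)
    linarith [hC n p hp g hg hgw]
  · linarith [(hK n hn g hg).2 hgw, le_max_left K 0]

/-- A radius from which on the Bernstein–Markov property holds and weighted polynomials attain their
supremum on `Y` in the corresponding ball. -/
theorem exists_bernsteinMarkov_radius (h : IsWeightedSet Y Q) {τ : Measure (Cn m)}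
    (hτ : IsWeightedMeasure Y Q τ) :
    ∃ r : ℝ, WeightedBernsteinMarkov {z ∈ Y | ‖z‖ ≤ r} Q τ ∧ ∀ n : ℕ, 1 ≤ n →
      ∀ p : MvPolynomial (Fin m) ℂ, p.totalDegree ≤ n → ∀ c : ℝ, 0 < c →
        (∀ z ∈ Y, ‖z‖ ≤ r → weightedNorm Q n p z ≤ c) → ∀ z ∈ Y, weightedNorm Q n p z ≤ c := by
  obtain ⟨b, A, r, -, -, -, hd⟩ := exists_weightedNorm_decay h.isClosed h.not_isPluripolar
    h.continuousOn h.superLogarithmic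
  obtain ⟨r₀, hr₀⟩ := hτ.bernsteinMarkov
  refine ⟨max r₀ r, hr₀ _ (le_max_left _ _), fun n hn p hp c hc hpc => ?_⟩
  exact (hd n hn p hp c hc fun z hz hzr => hpc z hz (hzr.trans (le_max_right _ _))).2.2

/-- Definiteness of the inner product: a polynomial with zero `L²` norm vanishes on a large bounded
piece of `Y` by Bernstein–Markov, then on `Y` by the decay estimate, and so identically by
nonpluripolarity. -/
theorem exists_isOrthonormalBasis (h : IsWeightedSet Y Q) {τ : Measure (Cn m)}
    (hτ : IsWeightedMeasure Y Q τ) :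
    ∀ᶠ n : ℕ in atTop,
      (∀ q : MvPolynomial (Fin m) ℂ, q.totalDegree ≤ n → WeightedL2 Y Q τ n q) ∧
      ∃ p : MultiIndex m n → MvPolynomial (Fin m) ℂ, IsOrthonormalBasis Y Q τ n p := by
  obtain ⟨K, n₀, hn₀, hK⟩ := h.exists_integral_tail_le hτ
  obtain ⟨r, hBM, hr⟩ := h.exists_bernsteinMarkov_radius hτ
  obtain ⟨C, -, hBM⟩ := hBM.exists_le_pow one_pos
  filter_upwards [eventually_ge_atTop n₀] with n hn
  refine ⟨fun q hq => (hK n hn q hq).1, Pluripotential.exists_isOrthonormalBasis h.isClosed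
    h.continuousOn (fun q hq => (hK n hn q hq).1) fun q hq h0 => ?_⟩
  have hsub : ∫ w in {z ∈ Y | ‖z‖ ≤ r}, ‖peval q w‖ ^ 2 * Real.exp (-(2 * n * Q w)) ∂τ = 0 := by
    refine le_antisymm ?_ (integral_nonneg fun z => by positivity)
    rw [← h0]
    exact setIntegral_mono_set (hK n hn q hq).1 (Eventually.of_forall fun z => by positivity)
      (Eventually.of_forall fun z hz => hz.1)
  refine eq_zero_of_peval_eq_zero_on h.not_isPluripolar q fun z hz => ?_
  have hle : ∀ c : ℝ, 0 < c → weightedNorm Q n q z ≤ c := by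
    intro c hc
    refine hr n (hn₀.trans hn) q hq c hc (fun w hw hwr => ?_) z hz
    have := hBM n (hn₀.trans hn) q hq w ⟨hw, hwr⟩
    rw [hsub, Real.sqrt_zero, mul_zero] at this
    exact this.trans hc.le
  have h1 : weightedNorm Q n q z ≤ 0 := le_of_forall_pos_le_add fun c hc => by
    simpa using hle c hc
  unfold weightedNorm at h1
  have h2 : ‖peval q z‖ ≤ 0 := le_of_mul_le_mul_right (by simpa using h1) (Real.exp_pos _)
  simpa using h2

/-- Every competitor for `phi` has squared `L²` norm at most `C`; the reproducing inequality does
the rest. -/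
theorem exists_phi_sq_le (h : IsWeightedSet Y Q) {τ : Measure (Cn m)}
    (hτ : IsWeightedMeasure Y Q τ) :
    ∃ C : ℝ, 0 < C ∧ ∀ n : ℕ, ∀ p : MultiIndex m n → MvPolynomial (Fin m) ℂ,
      IsOrthonormalBasis Y Q τ n p → ∀ z, phi Y Q n z ^ 2 ≤ C * bergmanDiag p z := by
  obtain ⟨C, hC, hle⟩ := h.exists_integral_le hτ
  refine ⟨C, hC, fun n p hp z => ?_⟩
  have hS : 0 ≤ bergmanDiag p z := Finset.sum_nonneg fun _ _ => by positivity
  rw [← Real.sq_sqrt (mul_nonneg hC.le hS)]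
  refine pow_le_pow_left₀ (phi_nonneg n z) (h.phi_le (Real.sqrt_nonneg _) fun g hg hgw => ?_) 2
  refine Real.le_sqrt_of_sq_le ((hp.norm_sq_le h.isClosed h.continuousOn g hg z).trans ?_)
  exact mul_le_mul_of_nonneg_right (hle n p hp g hg hgw) hS

/-- Each basis element has unit `L²` norm, so by Bernstein–Markov it is `C (1 + ε) ^ n` times a
competitor for `phi`. Squaring and summing produces the dimension factor. -/
theorem exists_bergmanDiag_le (h : IsWeightedSet Y Q) {τ : Measure (Cn m)}
    (hτ : IsWeightedMeasure Y Q τ) {ε : ℝ} (hε : 0 < ε) :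
    ∃ C : ℝ, 0 < C ∧ ∀ n : ℕ, 1 ≤ n → ∀ p : MultiIndex m n → MvPolynomial (Fin m) ℂ,
      IsOrthonormalBasis Y Q τ n p → ∀ z, bergmanDiag p z ≤
        C * (1 + ε) ^ (2 * n) * Fintype.card (MultiIndex m n) * phi Y Q n z ^ 2 := by
  obtain ⟨r, hBM, hr⟩ := h.exists_bernsteinMarkov_radius hτ
  obtain ⟨C, hC, hBM⟩ := hBM.exists_le_pow hε
  refine ⟨C ^ 2, by positivity, fun n hn p hp z => ?_⟩
  have hpν : ∀ ν, ‖peval (p ν) z‖ ≤ C * (1 + ε) ^ n * phi Y Q n z := by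
    intro ν
    refine h.norm_le_mul_phi hn (hp.degree_le ν) (by positivity) ?_ z
    refine hr n hn (p ν) (hp.degree_le ν) _ (by positivity) fun w hw hwr => ?_
    refine (hBM n hn (p ν) (hp.degree_le ν) w ⟨hw, hwr⟩).trans
      (mul_le_of_le_one_right (by positivity) ?_)
    rw [Real.sqrt_le_one]
    have h1 : ∫ w in Y, ‖peval (p ν) w‖ ^ 2 * Real.exp (-(2 * n * Q w)) ∂τ = 1 := by
      have h2 : weightedInner Y Q τ n (p ν) (p ν) = 1 := by
        have := hp.orthonormal ν ν
        rwa [if_pos rfl] at this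
      rw [weightedInner_self] at h2
      exact_mod_cast h2
    rw [← h1]
    exact setIntegral_mono_set (hp.weightedL2 ν) (Eventually.of_forall fun z => by positivity)
      (Eventually.of_forall fun z hz => hz.1)
  calc bergmanDiag p z ≤ ∑ _ν : MultiIndex m n, (C * (1 + ε) ^ n * phi Y Q n z) ^ 2 :=
        Finset.sum_le_sum fun ν _ => pow_le_pow_left₀ (norm_nonneg _) (hpν ν) 2
    _ = _ := by
        rw [Finset.sum_const, Finset.card_univ, nsmul_eq_mul]; ring

theorem bergmanDiag_pos (h : IsWeightedSet Y Q) {τ : Measure (Cn m)}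
    (hτ : IsWeightedMeasure Y Q τ) {n : ℕ} (hn : 1 ≤ n)
    {p : MultiIndex m n → MvPolynomial (Fin m) ℂ} (hp : IsOrthonormalBasis Y Q τ n p) (z : Cn m) :
    0 < bergmanDiag p z := by
  obtain ⟨C, hC, hle⟩ := h.exists_phi_sq_le hτ
  have h1 := hle n p hp z
  have h2 := h.phi_pos hn z
  by_contra hneg
  have : C * bergmanDiag p z ≤ 0 := mul_nonpos_of_nonneg_of_nonpos hC.le (not_lt.1 hneg)
  nlinarith

theorem bergmanDiag_div_phi_sq (h : IsWeightedSet Y Q) {τ : Measure (Cn m)}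
    (hτ : IsWeightedMeasure Y Q τ) {ε : ℝ} (hε : 0 < ε) :
    ∃ C₁ C₂ : ℝ, 0 < C₁ ∧ 0 < C₂ ∧
      ∀ n : ℕ, 1 ≤ n → ∀ p : MultiIndex m n → MvPolynomial (Fin m) ℂ,
        IsOrthonormalBasis Y Q τ n p → ∀ z : Cn m,
          1 / (C₁ * (1 + ε) ^ (2 * n) * ((m + n).choose n : ℝ)) ≤
              bergmanDiag p z / phi Y Q n z ^ 2 ∧
            bergmanDiag p z / phi Y Q n z ^ 2 ≤
              C₂ * (1 + ε) ^ (2 * n) * ((m + n).choose n : ℝ) := by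
  obtain ⟨C₁, hC₁, h1⟩ := h.exists_phi_sq_le hτ
  obtain ⟨C₂, hC₂, h2⟩ := h.exists_bergmanDiag_le hτ hε
  refine ⟨C₁, C₂, hC₁, hC₂, fun n hn p hp z => ?_⟩
  have hphi : 0 < phi Y Q n z ^ 2 := by have := h.phi_pos hn z; positivity
  have hch : (1 : ℝ) ≤ ((m + n).choose n : ℝ) := by
    exact_mod_cast Nat.choose_pos (Nat.le_add_left n m)
  have hpow : (1 : ℝ) ≤ (1 + ε) ^ (2 * n) := one_le_pow₀ (by linarith)
  constructor
  · rw [div_le_div_iff₀ (by positivity) hphi, one_mul]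
    have h3 := h1 n p hp z
    have hS := (h.bergmanDiag_pos hτ hn hp z).le
    -- The comparison holds with `C₁` alone; the other two factors are at least `1` and only weaken
    -- it.
    have h4 : C₁ ≤ C₁ * (1 + ε) ^ (2 * n) * ((m + n).choose n : ℝ) := by
      rw [mul_assoc]
      exact le_mul_of_one_le_right hC₁.le (one_le_mul_of_one_le_of_one_le hpow hch)
    have := mul_le_mul_of_nonneg_right h4 hS
    linarith
  · rw [div_le_iff₀ hphi]
    refine (h2 n hn p hp z).trans ?_
    gcongr
    exact card_multiIndex_le_choose m n

/-! ### The extremal function -/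

/-- Multiplication in `EReal` has discontinuities; they are avoided by writing `r * log x` as `log
(x ^ r)`. -/
theorem continuous_mul_elog (r : ℝ) : Continuous fun x => (r : EReal) * elog x := by
  simp only [elog, ← ENNReal.log_rpow]
  exact ENNReal.continuous_log.comp
    ((ENNReal.continuous_rpow_const).comp ENNReal.continuous_ofReal)

theorem coe_mul_elog_of_pos {r x : ℝ} (hx : 0 < x) :
    (r : EReal) * elog x = ((r * Real.log x : ℝ) : EReal) := by
  rw [elog_of_pos hx, EReal.coe_mul]

theorem mul_elog_le_coe {n : ℕ} (hn : 1 ≤ n) {x c : ℝ} (hx : 0 ≤ x) :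
    (((1 : ℝ) / n : ℝ) : EReal) * elog x ≤ c ↔ x ≤ Real.exp (n * c) := by
  have hn0 : (0 : ℝ) < n := by exact_mod_cast hn
  rcases hx.eq_or_lt with rfl | hx
  · rw [elog_zero, EReal.coe_mul_bot_of_pos (by positivity)]
    simp [(Real.exp_pos _).le]
  · rw [coe_mul_elog_of_pos hx, EReal.coe_le_coe_iff, one_div_mul_eq_div, div_le_iff₀ hn0,
      Real.log_le_iff_le_exp hx, mul_comm]

/-- For `m = 0` the space is a point and `Y` would be bounded. A coordinate is needed to construct
polynomials of prescribed degree. -/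
theorem nonempty_fin (h : IsWeightedSet Y Q) : Nonempty (Fin m) := by
  by_contra hne
  rw [not_nonempty_iff] at hne
  exact h.not_isBounded (Set.Subsingleton.finite fun x _ y _ => by
    ext i; exact hne.elim i).isBounded

/-- The extremal function normalizes by the exact degree, while `phi` allows any degree up to `n`. A
small multiple of `X i ^ n` makes the degree equal to `n`; after rescaling, the perturbation tends
to `0`. -/
theorem mul_elog_le_extremalFunction (h : IsWeightedSet Y Q) {n : ℕ} (hn : 1 ≤ n)
    {g : MvPolynomial (Fin m) ℂ} (hg : g.totalDegree ≤ n) (hgw : WeightedLeOne Y Q n g)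
    (z : Cn m) : (((1 : ℝ) / n : ℝ) : EReal) * elog ‖peval g z‖ ≤ extremalFunction Y Q z := by
  obtain ⟨i⟩ := h.nonempty_fin
  set f : MvPolynomial (Fin m) ℂ := MvPolynomial.X i ^ n with hf
  have hfd : f.totalDegree ≤ n := by simp [hf]
  obtain ⟨c, hc, hfc⟩ : ∃ c : ℝ, 0 < c ∧ ∀ z ∈ Y, weightedNorm Q n f z ≤ c := by
    obtain ⟨b, A, r, -, -, -, hd⟩ := exists_weightedNorm_decay h.isClosed h.not_isPluripolar
      h.continuousOn h.superLogarithmic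
    obtain ⟨c, hc, hfc⟩ := exists_weightedNorm_le h.isClosed h.continuousOn n f r
    exact ⟨c, hc, (hd n hn f hfd c hc hfc).2.2⟩
  let δ : ℕ → ℝ := fun k => 1 / ((k : ℝ) + 1)
  have hδ0 : ∀ k, 0 < δ k := fun k => by simp only [δ]; positivity
  have hδ : Tendsto δ atTop (𝓝 0) := tendsto_one_div_add_atTop_nhds_zero_nat
  -- As `X i ^ n` has weighted norm at most `c`, dividing by `1 + δ_k c` restores the normalization.
  let G : ℕ → MvPolynomial (Fin m) ℂ := fun k =>
    MvPolynomial.C (((1 + δ k * c)⁻¹ : ℝ) : ℂ) * (g + MvPolynomial.C ((δ k : ℝ) : ℂ) * f)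
  have hGw : ∀ k, WeightedLeOne Y Q n (G k) := by
    intro k w hw
    have hpos : 0 < 1 + δ k * c := by have := hδ0 k; positivity
    have h1 := hgw w hw
    have h2 := hfc w hw
    unfold weightedNorm at h2
    have h3 : ‖peval (G k) w‖ ≤ (1 + δ k * c)⁻¹ * (‖peval g w‖ + δ k * ‖peval f w‖) := by
      simp only [G]
      rw [peval_C_mul, peval_add, peval_C_mul, norm_mul, Complex.norm_real, Real.norm_eq_abs,
        abs_of_pos (inv_pos.2 hpos)]
      refine mul_le_mul_of_nonneg_left ((norm_add_le _ _).trans (le_of_eq ?_)) (inv_pos.2 hpos).le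
      rw [norm_mul, Complex.norm_real, Real.norm_eq_abs, abs_of_pos (hδ0 k)]
    refine (mul_le_mul_of_nonneg_right h3 (Real.exp_pos _).le).trans ?_
    rw [mul_assoc, inv_mul_le_iff₀ hpos, mul_one, add_mul, mul_assoc]
    exact add_le_add h1 (mul_le_mul_of_nonneg_left h2 (hδ0 k).le)
  have hGd : ∀ᶠ k in atTop, (G k).totalDegree = n := by
    set d : Fin m →₀ ℕ := Finsupp.single i n with hd
    -- If `g` has no such coefficient, `δ_k` itself is nonzero; otherwise a small `δ_k` cannot
    -- cancel it.
    have hev : ∀ᶠ k in atTop, g.coeff d + ((δ k : ℝ) : ℂ) ≠ 0 := by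
      by_cases h0 : g.coeff d = 0
      · refine Eventually.of_forall fun k => ?_
        rw [h0, zero_add]
        exact_mod_cast (hδ0 k).ne'
      · have h1 : Tendsto (fun k => g.coeff d + ((δ k : ℝ) : ℂ)) atTop (𝓝 (g.coeff d + 0)) := by
          refine tendsto_const_nhds.add ?_
          have := (Complex.continuous_ofReal.tendsto 0).comp hδ
          simpa [Function.comp_def] using this
        rw [add_zero] at h1
        exact h1.eventually_ne h0
    filter_upwards [hev] with k hk
    refine le_antisymm ?_ ?_
    · refine (totalDegree_C_mul_le _ _).trans ((MvPolynomial.totalDegree_add _ _).trans ?_)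
      exact max_le hg ((totalDegree_C_mul_le _ _).trans hfd)
    · have hcoef : (G k).coeff d = (((1 + δ k * c)⁻¹ : ℝ) : ℂ) * (g.coeff d + ((δ k : ℝ) : ℂ)) := by
        simp only [G, hf]
        rw [MvPolynomial.coeff_C_mul, MvPolynomial.coeff_add, MvPolynomial.coeff_C_mul,
          MvPolynomial.coeff_X_pow, if_pos rfl, mul_one]
      have hne : (G k).coeff d ≠ 0 := by
        rw [hcoef]
        refine mul_ne_zero ?_ hk
        have : 0 < 1 + δ k * c := by have := hδ0 k; positivity
        exact_mod_cast (inv_pos.2 this).ne'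
      have := MvPolynomial.le_totalDegree (MvPolynomial.mem_support_iff.2 hne)
      rwa [hd, Finsupp.sum_single_index rfl] at this
  have hlim : Tendsto (fun k => ‖peval (G k) z‖) atTop (𝓝 ‖peval g z‖) := by
    have h1 : Tendsto (fun k => (((1 + δ k * c)⁻¹ : ℝ) : ℂ) * (peval g z + ((δ k : ℝ) : ℂ) * peval f z))
        atTop (𝓝 ((((1 + 0 * c)⁻¹ : ℝ) : ℂ) * (peval g z + ((0 : ℝ) : ℂ) * peval f z))) := by
      have h2 := (Complex.continuous_ofReal.tendsto 0).comp hδ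
      refine Tendsto.mul ?_ (tendsto_const_nhds.add (h2.mul_const _))
      refine (Complex.continuous_ofReal.tendsto _).comp (Tendsto.inv₀ ?_ (by norm_num))
      exact tendsto_const_nhds.add (hδ.mul_const c)
    simp only [zero_mul, add_zero, inv_one, Complex.ofReal_one, one_mul, Complex.ofReal_zero] at h1
    refine h1.norm.congr fun k => ?_
    simp only [G]
    rw [peval_C_mul, peval_add, peval_C_mul]
  have hlim2 := ((continuous_mul_elog ((1 : ℝ) / n)).tendsto _).comp hlim
  refine le_of_tendsto hlim2 ?_
  filter_upwards [hGd] with k hk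
  have h1 : 0 < (G k).totalDegree := by rw [hk]; exact hn
  have h2 : WeightedLeOne Y Q (G k).totalDegree (G k) := by rw [hk]; exact hGw k
  have h3 : (((1 : ℝ) / (G k).totalDegree : ℝ) : EReal) * elog ‖peval (G k) z‖ ≤
      extremalFunction Y Q z := le_iSup₂_of_le (G k) h1 (le_iSup_of_le h2 le_rfl)
  rwa [hk] at h3

theorem exists_extremalFunction_le (h : IsWeightedSet Y Q) : ∃ A : ℝ, 1 ≤ A ∧ ∀ z,
    extremalFunction Y Q z ≤ (Real.log (A * max 1 ‖z‖) : ℝ) := by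
  obtain ⟨A, hA, hle⟩ := h.exists_phi_le
  refine ⟨A, hA, fun z => iSup₂_le fun p hp => iSup_le fun hpw => ?_⟩
  have hpos : 0 < A * max 1 ‖z‖ := by positivity
  rw [mul_elog_le_coe hp (norm_nonneg _), Real.exp_nat_mul, Real.exp_log hpos]
  exact (h.norm_le_phi hp le_rfl hpw z).trans (hle _ hp z)

theorem exists_le_extremalFunction (h : IsWeightedSet Y Q) : ∃ q : ℝ, ∀ z,
    (q : EReal) ≤ extremalFunction Y Q z := by
  obtain ⟨q, hq⟩ := exists_weight_lower_bound h.isClosed h.continuousOn h.superLogarithmic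
  refine ⟨q, fun z => ?_⟩
  have h1 := h.mul_elog_le_extremalFunction (n := 1) le_rfl
    (g := MvPolynomial.C ((Real.exp q : ℝ) : ℂ)) (by simp) (fun w hw => ?_) z
  · simpa [peval, elog_of_pos (Real.exp_pos q), Complex.norm_real, Real.abs_exp] using h1
  · simp only [peval, MvPolynomial.eval_C, Complex.norm_real, Real.norm_eq_abs, Real.abs_exp]
    rw [← Real.exp_add, Real.exp_le_one_iff]
    have := hq w hw
    push_cast; linarith

theorem coe_toReal_extremalFunction (h : IsWeightedSet Y Q) (z : Cn m) :
    ((extremalFunction Y Q z).toReal : EReal) = extremalFunction Y Q z := by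
  obtain ⟨A, -, hA⟩ := h.exists_extremalFunction_le
  obtain ⟨q, hq⟩ := h.exists_le_extremalFunction
  exact EReal.coe_toReal (ne_top_of_le_ne_top (EReal.coe_ne_top _) (hA z))
    (ne_bot_of_le_ne_bot (EReal.coe_ne_bot _) (hq z))

theorem log_phi_le (h : IsWeightedSet Y Q) {n : ℕ} (hn : 1 ≤ n) (z : Cn m) :
    1 / n * Real.log (phi Y Q n z) ≤ (extremalFunction Y Q z).toReal := by
  have hn0 : (0 : ℝ) < n := by exact_mod_cast hn
  rw [one_div_mul_eq_div, div_le_iff₀ hn0, Real.log_le_iff_le_exp (h.phi_pos hn z)]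
  refine h.phi_le (Real.exp_pos _).le fun g hg hgw => ?_
  rw [mul_comm, ← mul_elog_le_coe hn (norm_nonneg _), h.coe_toReal_extremalFunction]
  exact h.mul_elog_le_extremalFunction hn hg hgw z

/-- The upper bound holds for every `n`. From below, a near-optimal polynomial for `V` at `z` is
raised to powers to fill up the degree `n`. -/
theorem tendsto_log_phi (h : IsWeightedSet Y Q) (z : Cn m) :
    Tendsto (fun n : ℕ => 1 / (n : ℝ) * Real.log (phi Y Q n z)) atTop
      (𝓝 (extremalFunction Y Q z).toReal) := by
  obtain ⟨q, hq⟩ := exists_weight_lower_bound h.isClosed h.continuousOn h.superLogarithmic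
  refine tendsto_order.2 ⟨fun x hx => ?_, fun x hx => ?_⟩
  · have h1 : (x : EReal) < extremalFunction Y Q z := by
      rw [← h.coe_toReal_extremalFunction]; exact_mod_cast hx
    unfold extremalFunction at h1
    simp only [lt_iSup_iff] at h1
    obtain ⟨p, hd, hpw, hlt⟩ := h1
    set d := p.totalDegree with hdd
    have hd0 : (0 : ℝ) < d := by exact_mod_cast hd
    have hpz : 0 < ‖peval p z‖ := by
      rcases (norm_nonneg (peval p z)).eq_or_lt with h0 | h0
      · rw [← h0, elog_zero, EReal.coe_mul_bot_of_pos (by positivity)] at hlt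
        simp at hlt
      · exact h0
    set y := Real.log ‖peval p z‖ with hy
    rw [coe_mul_elog_of_pos hpz, EReal.coe_lt_coe_iff, one_div_mul_eq_div] at hlt
    have hlim : Tendsto (fun n : ℕ => y / d - (|y| + d * |q|) / (n : ℝ)) atTop (𝓝 (y / d - 0)) :=
      tendsto_const_nhds.sub (tendsto_const_div_atTop_nhds_zero_nat _)
    rw [sub_zero] at hlim
    filter_upwards [hlim.eventually_const_lt hlt, eventually_ge_atTop 1] with n hn hn1
    refine hn.trans_le ?_
    have hn0 : (0 : ℝ) < n := by exact_mod_cast hn1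
    set k := n / d with hk
    set s := n % d with hs
    have hnks : (n : ℝ) = k * d + s := by
      have := Nat.div_add_mod' n d
      exact_mod_cast this.symm
    have hsd : (s : ℝ) ≤ d := by exact_mod_cast (Nat.mod_lt n hd).le
    have hs0 : (0 : ℝ) ≤ s := Nat.cast_nonneg _
    -- With `n = k d + s`, the power `p ^ k` uses the weight `k d Q`, and the constant `exp (s q)`
    -- compensates for the remaining `s Q`. Its cost is bounded and disappears after division by
    -- `n`.
    have hle := h.norm_le_phi hn1 (g := MvPolynomial.C ((Real.exp (s * q) : ℝ) : ℂ) * p ^ k)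
      ((totalDegree_C_mul_le _ _).trans ((MvPolynomial.totalDegree_pow _ _).trans
        (by rw [hk, ← hdd]; exact Nat.div_mul_le_self n d))) (fun w hw => by
          have h1 := hpw w hw
          have h2 : 0 ≤ ‖peval p w‖ * Real.exp (-(d * Q w)) := by positivity
          have h3 := pow_le_one₀ h2 h1 (n := k)
          have h4 : Real.exp (s * q) * Real.exp (-(s * Q w)) ≤ 1 := by
            rw [← Real.exp_add, Real.exp_le_one_iff]
            have := mul_le_mul_of_nonneg_left (hq w hw) hs0
            linarith
          have h5 := mul_le_one₀ h3 (by positivity) h4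
          refine le_trans (le_of_eq ?_) h5
          rw [peval_C_mul, norm_mul, Complex.norm_real, Real.norm_eq_abs, Real.abs_exp, mul_pow,
            ← Real.exp_nat_mul]
          have h6 : peval (p ^ k) w = peval p w ^ k := by simp [peval]
          have h7 : -((n : ℝ) * Q w) = k * (-(d * Q w)) + -(s * Q w) := by rw [hnks]; ring
          rw [h6, h7, Real.exp_add, norm_pow]
          ring) z
    have h6 : peval (p ^ k) z = peval p z ^ k := by simp [peval]
    rw [peval_C_mul, norm_mul, Complex.norm_real, Real.norm_eq_abs, Real.abs_exp, h6, norm_pow]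
      at hle
    have hlog := Real.log_le_log (by positivity) hle
    rw [Real.log_mul (Real.exp_pos _).ne' (by positivity), Real.log_exp, Real.log_pow, ← hy] at hlog
    rw [one_div_mul_eq_div]
    have h8 : y / d - (|y| + d * |q|) / n ≤ (s * q + k * y) / n := by
      rw [le_div_iff₀ hn0, sub_mul, div_mul_cancel₀ _ hn0.ne']
      have e1 : y / d * n = k * y + s / d * y := by rw [hnks]; field_simp
      have e2 : s / d * y ≤ |y| := by
        have : (s : ℝ) / d ≤ 1 := by rw [div_le_one hd0]; exact hsd
        calc (s : ℝ) / d * y ≤ s / d * |y| :=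
              mul_le_mul_of_nonneg_left (le_abs_self y) (by positivity)
          _ ≤ 1 * |y| := mul_le_mul_of_nonneg_right this (abs_nonneg y)
          _ = |y| := one_mul _
      have e3 : -(d * |q|) ≤ s * q := by
        have e4 : s * |q| ≤ d * |q| := mul_le_mul_of_nonneg_right hsd (abs_nonneg q)
        have e5 : -(s * |q|) ≤ s * q := by
          rw [← mul_neg]
          exact mul_le_mul_of_nonneg_left (neg_abs_le q) hs0
        linarith
      rw [e1]; linarith
    refine h8.trans (div_le_div_of_nonneg_right hlog hn0.le)
  · filter_upwards [eventually_ge_atTop 1] with n hn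
    exact (h.log_phi_le hn z).trans_lt hx

/-! ### Logarithmic asymptotics of the Bergman kernel -/

theorem tendsto_log_natCast_succ_div : Tendsto (fun n : ℕ => Real.log (n + 1) / n) atTop (𝓝 0) := by
  have h1 : Tendsto (fun n : ℕ => Real.log ((n : ℝ) + 1) / ((n : ℝ) + 1)) atTop (𝓝 0) := by
    have h0 : Tendsto (fun x : ℝ => Real.log x / x) atTop (𝓝 0) := by
      have := Real.isLittleO_log_id_atTop.tendsto_div_nhds_zero
      simpa using this
    exact h0.comp (tendsto_atTop_add_const_right _ _ tendsto_natCast_atTop_atTop)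
  have h2 : Tendsto (fun n : ℕ => ((n : ℝ) + 1) / n) atTop (𝓝 1) := by
    have : Tendsto (fun n : ℕ => 1 + 1 / (n : ℝ)) atTop (𝓝 (1 + 0)) :=
      tendsto_const_nhds.add (tendsto_const_div_atTop_nhds_zero_nat 1)
    rw [add_zero] at this
    refine this.congr' ?_
    filter_upwards [eventually_ge_atTop 1] with n hn
    have : (n : ℝ) ≠ 0 := by positivity
    field_simp
  have h3 := h1.mul h2
  rw [zero_mul] at h3
  refine h3.congr' ?_
  filter_upwards [eventually_ge_atTop 1] with n hn
  have : (n : ℝ) ≠ 0 := by positivity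
  field_simp

/-- Two-sided comparison of `(2n)⁻¹ log S_n` with `n⁻¹ log φ_n`. -/
theorem exists_log_bergmanDiag_bounds (h : IsWeightedSet Y Q) {τ : Measure (Cn m)}
    (hτ : IsWeightedMeasure Y Q τ) {ε : ℝ} (hε : 0 < ε) :
    ∃ C : ℝ, ∀ n : ℕ, 1 ≤ n → ∀ p : MultiIndex m n → MvPolynomial (Fin m) ℂ,
      IsOrthonormalBasis Y Q τ n p → ∀ z,
        1 / (n : ℝ) * Real.log (phi Y Q n z) - C / n ≤
            1 / (2 * (n : ℝ)) * Real.log (bergmanDiag p z) ∧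
          1 / (2 * (n : ℝ)) * Real.log (bergmanDiag p z) ≤
            1 / (n : ℝ) * Real.log (phi Y Q n z) + C / n + m * (Real.log (n + 1) / n) +
              Real.log (1 + ε) := by
  obtain ⟨C₁, hC₁, h1⟩ := h.exists_phi_sq_le hτ
  obtain ⟨C₂, hC₂, h2⟩ := h.exists_bergmanDiag_le hτ hε
  refine ⟨max (|Real.log C₁|) (|Real.log C₂|), fun n hn p hp z => ?_⟩
  have hn0 : (0 : ℝ) < n := by exact_mod_cast hn
  have hphi := h.phi_pos hn z
  have hS := h.bergmanDiag_pos hτ hn hp z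
  have e1 := Real.log_le_log (by positivity) (h1 n p hp z)
  rw [Real.log_pow, Real.log_mul hC₁.ne' hS.ne'] at e1
  have hcard : (Fintype.card (MultiIndex m n) : ℝ) ≤ ((n : ℝ) + 1) ^ m := by
    exact_mod_cast card_multiIndex_le_pow m n
  have e2 : bergmanDiag p z ≤ C₂ * (1 + ε) ^ (2 * n) * ((n : ℝ) + 1) ^ m * phi Y Q n z ^ 2 := by
    refine (h2 n hn p hp z).trans ?_
    gcongr
  have e3 := Real.log_le_log hS e2
  rw [Real.log_mul (by positivity) (by positivity), Real.log_mul (by positivity) (by positivity),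
    Real.log_mul (by positivity) (by positivity), Real.log_pow, Real.log_pow, Real.log_pow] at e3
  push_cast at e1 e3
  have a1 := le_max_left (|Real.log C₁|) (|Real.log C₂|)
  have a2 := le_max_right (|Real.log C₁|) (|Real.log C₂|)
  set C := max (|Real.log C₁|) (|Real.log C₂|)
  have b1 := le_abs_self (Real.log C₁)
  have b2 := le_abs_self (Real.log C₂)
  have b0 : 0 ≤ C := (abs_nonneg _).trans a1
  have hlog0 : 0 ≤ (m : ℝ) * Real.log (n + 1) := by
    have : 0 ≤ Real.log ((n : ℝ) + 1) := Real.log_nonneg (by linarith)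
    positivity
  have f1 : 1 / (2 * (n : ℝ)) * Real.log (bergmanDiag p z) = Real.log (bergmanDiag p z) / 2 / n := by
    field_simp
  rw [f1, one_div_mul_eq_div]
  constructor
  · rw [← sub_div]
    refine div_le_div_of_nonneg_right ?_ hn0.le
    linarith
  · have f2 : Real.log (phi Y Q n z) / n + C / n + m * (Real.log (n + 1) / n) + Real.log (1 + ε) =
        (Real.log (phi Y Q n z) + C + m * Real.log (n + 1) + n * Real.log (1 + ε)) / n := by
      field_simp
    rw [f2]
    refine div_le_div_of_nonneg_right ?_ hn0.le
    linarith

theorem tendsto_log_bergmanDiag (h : IsWeightedSet Y Q) {τ : Measure (Cn m)}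
    (hτ : IsWeightedMeasure Y Q τ) (p : (n : ℕ) → MultiIndex m n → MvPolynomial (Fin m) ℂ)
    (hp : ∀ᶠ n in atTop, IsOrthonormalBasis Y Q τ n (p n)) (z : Cn m) :
    Tendsto (fun n : ℕ => 1 / (2 * (n : ℝ)) * Real.log (bergmanDiag (p n) z)) atTop
      (𝓝 (extremalFunction Y Q z).toReal) := by
  have hphi := h.tendsto_log_phi z
  refine tendsto_order.2 ⟨fun x hx => ?_, fun x hx => ?_⟩
  · obtain ⟨C, hC⟩ := h.exists_log_bergmanDiag_bounds hτ one_pos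
    have hlim := hphi.sub (tendsto_const_div_atTop_nhds_zero_nat C)
    rw [sub_zero] at hlim
    filter_upwards [hlim.eventually_const_lt hx, hp, eventually_ge_atTop 1] with n hn hpn hn1
    exact hn.trans_le (hC n hn1 (p n) hpn z).1
  · set η := x - (extremalFunction Y Q z).toReal with hη
    have hη0 : 0 < η := sub_pos.2 hx
    -- This value of `ε` makes the Bernstein–Markov loss `log (1 + ε)` equal to `η / 2`.
    have hε : 0 < Real.exp (η / 2) - 1 := by
      have := Real.add_one_lt_exp (x := η / 2) (by positivity)
      linarith
    obtain ⟨C, hC⟩ := h.exists_log_bergmanDiag_bounds hτ hε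
    have hlim := ((hphi.add (tendsto_const_div_atTop_nhds_zero_nat C)).add
      (tendsto_log_natCast_succ_div.const_mul (m : ℝ))).add_const
        (Real.log (1 + (Real.exp (η / 2) - 1)))
    have hlt : (extremalFunction Y Q z).toReal + 0 + m * 0 +
        Real.log (1 + (Real.exp (η / 2) - 1)) < x := by
      rw [add_sub_cancel, Real.log_exp]; linarith
    filter_upwards [hlim.eventually_lt_const hlt, hp, eventually_ge_atTop 1] with n hn hpn hn1
    exact (hC n hn1 (p n) hpn z).2.trans_lt hn

/-- A locally uniform bound, used as the majorant for dominated convergence and for local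
integrability. -/
theorem exists_abs_log_bergmanDiag_le (h : IsWeightedSet Y Q) {τ : Measure (Cn m)}
    (hτ : IsWeightedMeasure Y Q τ) (R : ℝ) :
    ∃ B : ℝ, ∀ n : ℕ, 1 ≤ n → ∀ p : MultiIndex m n → MvPolynomial (Fin m) ℂ,
      IsOrthonormalBasis Y Q τ n p → ∀ z : Cn m, ‖z‖ ≤ R →
        |1 / (2 * (n : ℝ)) * Real.log (bergmanDiag p z)| ≤ B := by
  obtain ⟨C, hC⟩ := h.exists_log_bergmanDiag_bounds hτ one_pos
  obtain ⟨A, hA, hphi⟩ := h.exists_phi_le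
  obtain ⟨q, -, hq⟩ := h.exists_le_phi
  have hAR : 1 ≤ A * max 1 R := one_le_mul_of_one_le_of_one_le hA (le_max_left _ _)
  refine ⟨|q| + |C| + Real.log (A * max 1 R) + m + 1, fun n hn p hp z hz => ?_⟩
  have hn0 : (0 : ℝ) < n := by exact_mod_cast hn
  have hn1 : (1 : ℝ) ≤ n := by exact_mod_cast hn
  obtain ⟨h1, h2⟩ := hC n hn p hp z
  have hlow : q ≤ 1 / n * Real.log (phi Y Q n z) := by
    rw [one_div_mul_eq_div, le_div_iff₀ hn0, Real.le_log_iff_exp_le (h.phi_pos hn z), mul_comm]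
    exact hq n hn z
  have hup : 1 / n * Real.log (phi Y Q n z) ≤ Real.log (A * max 1 R) := by
    rw [one_div_mul_eq_div, div_le_iff₀ hn0, Real.log_le_iff_le_exp (h.phi_pos hn z), mul_comm,
      Real.exp_nat_mul, Real.exp_log (by linarith)]
    refine (hphi n hn z).trans ?_
    gcongr
  have hCn : |C / n| ≤ |C| := by
    rw [abs_div, abs_of_pos hn0]
    exact div_le_self (abs_nonneg _) hn1
  have hlogn : Real.log (n + 1) / n ≤ 1 := by
    rw [div_le_one hn0]
    have := Real.log_le_sub_one_of_pos (x := (n : ℝ) + 1) (by positivity)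
    linarith
  have hlog2 : Real.log (1 + 1) ≤ 1 := by
    have := Real.log_le_sub_one_of_pos (x := (1 : ℝ) + 1) (by positivity)
    linarith
  have hm : (m : ℝ) * (Real.log (n + 1) / n) ≤ m :=
    mul_le_of_le_one_right (Nat.cast_nonneg _) hlogn
  have hlogAR := Real.log_nonneg hAR
  obtain ⟨g1, g1'⟩ := abs_le.1 hCn
  have g2 := neg_abs_le q
  have g3 := abs_nonneg q
  have g4 := abs_nonneg C
  have g5 : (0 : ℝ) ≤ m := Nat.cast_nonneg _
  rw [abs_le]
  constructor
  · linarith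
  · have h3 := h2.trans (add_le_add (add_le_add (add_le_add hup g1') hm) hlog2)
    linarith

end IsWeightedSet

end Pluripotential

/-! ### The upper semicontinuous regularization of the extremal function -/

namespace Pluripotential

theorem le_uscReg {m : ℕ} (f : Cn m → EReal) (z : Cn m) : f z ≤ uscReg f z :=
  by
  refine le_limsup_of_frequently_le fun hcon => ?_
  exact hcon.self_of_nhds le_rfl

theorem uscReg_mono {m : ℕ} {f g : Cn m → EReal} (h : ∀ z, f z ≤ g z) (z : Cn m) :
    uscReg f z ≤ uscReg g z :=
  limsup_le_limsup (Eventually.of_forall h)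

/-- If `f ≥ g` on a dense set and `g` is lower semicontinuous, then `f^* ≥ g^*`. -/
theorem uscReg_le_uscReg_of_dense {m : ℕ} {f g : Cn m → EReal} (hg : LowerSemicontinuous g)
    {D : Set (Cn m)} (hD : Dense D) (h : ∀ z ∈ D, g z ≤ f z) (z : Cn m) :
    uscReg g z ≤ uscReg f z := by
  refine le_of_forall_lt fun y hy => ?_
  obtain ⟨y', hyy', hy'⟩ := exists_between hy
  refine hyy'.trans_le (le_limsup_of_frequently_le ?_)
  have h1 : ∃ᶠ w in 𝓝 z, y' < g w := frequently_lt_of_lt_limsup (by isBoundedDefault) hy'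
  rw [frequently_iff] at h1 ⊢
  intro U hU
  obtain ⟨O, hOU, hO, hzO⟩ := mem_nhds_iff.1 hU
  obtain ⟨w, hw, hwy⟩ := h1 (hO.mem_nhds hzO)
  -- Lower semicontinuity makes `{g > y'}` open, so a point found there can be moved into the dense
  -- set.
  have hopen : IsOpen (O ∩ g ⁻¹' Set.Ioi y') := hO.inter (hg.isOpen_preimage y')
  obtain ⟨d, hd, hdD⟩ := hD.inter_open_nonempty _ hopen ⟨w, hw, hwy⟩
  exact ⟨d, hOU hd.1, (le_of_lt hd.2).trans (h d hdD)⟩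

theorem logDefect_mono {M x y : ℝ} (h : x ≤ y) : logDefect M y ≤ logDefect M x :=
  EReal.toENNReal_le_toENNReal (EReal.sub_le_sub le_rfl (elog_mono h))

namespace IsWeightedSet

variable {m : ℕ} {Y : Set (Cn m)} {Q : Cn m → ℝ}

theorem lowerSemicontinuous_extremalFunction (Y : Set (Cn m)) (Q : Cn m → ℝ) :
    LowerSemicontinuous (extremalFunction Y Q) :=
  lowerSemicontinuous_iSup fun p => lowerSemicontinuous_iSup fun _ =>
    lowerSemicontinuous_iSup fun _ =>
      ((continuous_mul_elog _).comp (continuous_peval p).norm).lowerSemicontinuous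

theorem measurable_toReal_extremalFunction (Y : Set (Cn m)) (Q : Cn m → ℝ) :
    Measurable fun z => (extremalFunction Y Q z).toReal :=
  (lowerSemicontinuous_extremalFunction Y Q).measurable.ereal_toReal

theorem exists_abs_extremalFunction_le (h : IsWeightedSet Y Q) (R : ℝ) :
    ∃ B : ℝ, ∀ z : Cn m, ‖z‖ ≤ R → |(extremalFunction Y Q z).toReal| ≤ B := by
  obtain ⟨A, hA1, hA⟩ := h.exists_extremalFunction_le
  obtain ⟨q, hq⟩ := h.exists_le_extremalFunction
  refine ⟨max |q| (Real.log (A * max 1 R)), fun z hz => ?_⟩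
  have h1 := hA z
  have h2 := hq z
  rw [← h.coe_toReal_extremalFunction, EReal.coe_le_coe_iff] at h1 h2
  have h3 : Real.log (A * max 1 ‖z‖) ≤ Real.log (A * max 1 R) := by
    refine Real.log_le_log (by positivity) ?_
    gcongr
  rw [abs_le]
  constructor
  · linarith [neg_abs_le q, le_max_left |q| (Real.log (A * max 1 R))]
  · linarith [le_max_right |q| (Real.log (A * max 1 R))]

theorem integrableOn_extremalFunction (h : IsWeightedSet Y Q) {K : Set (Cn m)}
    (hK : Bornology.IsBounded K) :
    IntegrableOn (fun z => (extremalFunction Y Q z).toReal) K := by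
  obtain ⟨R, hR⟩ := hK.subset_closedBall 0
  obtain ⟨B, hB⟩ := h.exists_abs_extremalFunction_le R
  refine IntegrableOn.mono_set ?_ hR
  refine Measure.integrableOn_of_bounded (M := B)
    (isCompact_closedBall (0 : Cn m) R).measure_lt_top.ne
    (measurable_toReal_extremalFunction Y Q).aestronglyMeasurable ?_
  filter_upwards [ae_restrict_mem Metric.isClosed_closedBall.measurableSet] with z hz
  exact hB z (by simpa using hz)

theorem locallyIntegrable_extremalFunction (h : IsWeightedSet Y Q) :
    LocallyIntegrable fun z => (extremalFunction Y Q z).toReal :=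
  locallyIntegrable_iff.2 fun _ hK => h.integrableOn_extremalFunction hK.isBounded

/-- The extremal function satisfies the mean value inequality on balls. -/
theorem extremalFunction_le_average (h : IsWeightedSet Y Q) (z : Cn m) {r : ℝ} (hr : 0 < r) :
    (extremalFunction Y Q z).toReal ≤
      ⨍ w in Metric.closedBall z r, (extremalFunction Y Q w).toReal := by
  set v : Cn m → ℝ := fun w => (extremalFunction Y Q w).toReal with hv
  set B := Metric.closedBall z r with hBdef
  have hint : IntegrableOn v B := h.integrableOn_extremalFunction Metric.isBounded_closedBall
  have hvolfin : volume B ≠ ⊤ := (isCompact_closedBall z r).measure_lt_top.ne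
  have hvolpos : 0 < volume.real B :=
    ENNReal.toReal_pos (Metric.measure_closedBall_pos volume z hr).ne' hvolfin
  obtain ⟨M, hM⟩ := h.exists_abs_extremalFunction_le (‖z‖ + r)
  have hMB : ∀ w ∈ B, v w ≤ M := by
    intro w hw
    refine (le_abs_self _).trans (hM w ?_)
    rw [hBdef, Metric.mem_closedBall, dist_eq_norm] at hw
    have := norm_le_norm_add_norm_sub' w z
    linarith
  suffices hsup : extremalFunction Y Q z ≤ ((⨍ w in B, v w : ℝ) : EReal) by
    rw [← h.coe_toReal_extremalFunction, EReal.coe_le_coe_iff] at hsup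
    exact hsup
  refine iSup₂_le fun p hp => iSup_le fun hpw => ?_
  set d := p.totalDegree with hd
  have hd0 : (0 : ℝ) < d := by exact_mod_cast hp
  -- Each competitor lies below `V`, hence the integral of `d (M - V)` is at most that of its
  -- defect. The mean value inequality for polynomials therefore bounds every competitor at `z` by
  -- the average of `V`.
  have hpv : ∀ w, ‖peval p w‖ ≤ Real.exp (d * v w) := by
    intro w
    rw [← mul_elog_le_coe hp (norm_nonneg _), h.coe_toReal_extremalFunction]
    exact h.mul_elog_le_extremalFunction hp le_rfl hpw w
  rcases (norm_nonneg (peval p z)).eq_or_lt with h0 | hpz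
  · rw [← h0, elog_zero, EReal.coe_mul_bot_of_pos (by positivity)]
    exact bot_le
  rw [coe_mul_elog_of_pos hpz, EReal.coe_le_coe_iff, one_div_mul_eq_div, div_le_iff₀ hd0]
  have h1 := lintegral_closedBall_logDefect_le p z r (d * M) (fun w hw => (hpv w).trans (by
    have := hMB w hw
    gcongr))
  have h2 : ∫⁻ w in B, ENNReal.ofReal (d * M - d * v w) ≤
      ∫⁻ w in B, logDefect (d * M) ‖peval p w‖ := by
    refine lintegral_mono fun w => ?_
    refine le_trans (le_of_eq ?_) (logDefect_mono (hpv w))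
    rw [logDefect_of_pos (Real.exp_pos _), Real.log_exp]
  have h3 : volume (Metric.closedBall (0 : Cn m) r) = volume B := by
    rw [hBdef, Measure.addHaar_closedBall_center volume z r]
  have hint2 : IntegrableOn (fun w => d * M - d * v w) B :=
    Integrable.sub (integrableOn_const (hs := hvolfin)) (hint.const_mul _)
  have h4 := h2.trans h1
  rw [h3, logDefect_of_pos hpz, ← ofReal_integral_eq_lintegral_ofReal hint2
    (by
      filter_upwards [ae_restrict_mem Metric.isClosed_closedBall.measurableSet] with w hw
      have := mul_le_mul_of_nonneg_left (hMB w hw) hd0.le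
      simpa using this), ← ENNReal.ofReal_toReal hvolfin, ← ENNReal.ofReal_mul (by positivity),
    ENNReal.ofReal_le_ofReal_iff'] at h4
  change _ ≤ volume.real B * _ ∨ _ at h4
  have hI : ∫ w in B, (d * M - d * v w) = volume.real B * (d * M) - d * ∫ w in B, v w := by
    have hc : IntegrableOn (fun _ : Cn m => d * M) B := integrableOn_const (hs := hvolfin)
    rw [integral_sub hc (hint.const_mul _), setIntegral_const, smul_eq_mul, integral_const_mul]
  rw [hI] at h4
  have hlogle : Real.log ‖peval p z‖ ≤ d * M := by
    rw [Real.log_le_iff_le_exp hpz]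
    refine (hpv z).trans ?_
    have := hMB z (Metric.mem_closedBall_self hr.le)
    gcongr
  have h5 : volume.real B * (d * M) - d * ∫ w in B, v w ≤
      volume.real B * (d * M - Real.log ‖peval p z‖) := by
    rcases h4 with h4 | h4
    · exact h4
    · exact h4.trans (mul_nonneg hvolpos.le (sub_nonneg.2 hlogle))
  rw [setAverage_eq, smul_eq_mul]
  have h6 : volume.real B * Real.log ‖peval p z‖ ≤ d * ∫ w in B, v w := by linarith
  rw [inv_mul_eq_div, div_mul_eq_mul_div, le_div_iff₀ hvolpos]
  linarith

/-- `V^* = V` almost everywhere. -/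
theorem uscReg_extremalFunction_ae_eq (h : IsWeightedSet Y Q) :
    uscReg (extremalFunction Y Q) =ᵐ[volume] extremalFunction Y Q := by
  filter_upwards [IsUnifLocDoublingMeasure.ae_tendsto_average volume
    h.locallyIntegrable_extremalFunction 1] with x hx
  refine le_antisymm ?_ (le_uscReg _ _)
  rw [← h.coe_toReal_extremalFunction x]
  refine EReal.le_of_forall_lt_iff_le.1 fun y hy => ?_
  rw [EReal.coe_lt_coe_iff] at hy
  -- Differentiation is applied to the balls centred at `w` with radius `‖w - x‖`, which touch `x`.
  -- Their averages tend to `V x` and dominate `V w`, so the upper limit at `x` does not exceed `V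
  -- x`.
  have hδ : Tendsto (fun w : Cn m => ‖w - x‖) (𝓝[≠] x) (𝓝[>] 0) :=
    tendsto_nhdsWithin_iff.2 ⟨by
      have : Tendsto (fun w : Cn m => ‖w - x‖) (𝓝 x) (𝓝 ‖x - x‖) :=
        (continuous_id.sub continuous_const).norm.tendsto x
      rw [sub_self, norm_zero] at this
      exact this.mono_left nhdsWithin_le_nhds, by
      filter_upwards [self_mem_nhdsWithin] with w hw
      exact norm_pos_iff.2 (sub_ne_zero.2 hw)⟩
  have hlim := hx (l := 𝓝[≠] x) (fun w => w) (fun w => ‖w - x‖) hδ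
    (Eventually.of_forall fun w => by
      rw [one_mul, Metric.mem_closedBall, dist_comm, dist_eq_norm])
  refine limsup_le_of_le (by isBoundedDefault) ?_
  have hev := hlim.eventually_lt_const hy
  rw [eventually_nhdsWithin_iff] at hev
  filter_upwards [hev] with w hw
  rw [← h.coe_toReal_extremalFunction, EReal.coe_le_coe_iff]
  by_cases hwx : w = x
  · rw [hwx]; exact hy.le
  · exact (h.extremalFunction_le_average w (norm_pos_iff.2 (sub_ne_zero.2 hwx))).trans (hw hwx).le

theorem isL1Loc_uscReg_extremalFunction (h : IsWeightedSet Y Q) :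
    IsL1Loc (uscReg (extremalFunction Y Q)) := by
  have hae := h.uscReg_extremalFunction_ae_eq
  refine ⟨?_, ?_⟩
  · filter_upwards [hae] with z hz
    rw [hz, ← h.coe_toReal_extremalFunction]
    exact ⟨EReal.coe_ne_top _, EReal.coe_ne_bot _⟩
  · refine locallyIntegrable_iff.2 fun K hK => ?_
    refine (h.integrableOn_extremalFunction hK.isBounded).congr ?_
    filter_upwards [ae_restrict_of_ae hae] with z hz
    rw [hz]

/-! ### Convergence in `L¹_loc` -/

theorem continuous_bergmanDiag {n : ℕ} (p : MultiIndex m n → MvPolynomial (Fin m) ℂ) :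
    Continuous (bergmanDiag p) :=
  continuous_finsetSum _ fun ν _ => (continuous_peval (p ν)).norm.pow 2

theorem tendsto_lintegral_log_bergmanDiag (h : IsWeightedSet Y Q) {τ : Measure (Cn m)}
    (hτ : IsWeightedMeasure Y Q τ) (p : (n : ℕ) → MultiIndex m n → MvPolynomial (Fin m) ℂ)
    (hp : ∀ᶠ n in atTop, IsOrthonormalBasis Y Q τ n (p n)) {K : Set (Cn m)} (hK : IsCompact K) :
    Tendsto (fun n : ℕ => ∫⁻ z in K,
      ‖1 / (2 * (n : ℝ)) * Real.log (bergmanDiag (p n) z) - (extremalFunction Y Q z).toReal‖ₑ)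
      atTop (𝓝 0) := by
  obtain ⟨R, hR⟩ := hK.isBounded.subset_closedBall 0
  obtain ⟨B₁, hB₁⟩ := h.exists_abs_log_bergmanDiag_le hτ R
  obtain ⟨B₂, hB₂⟩ := h.exists_abs_extremalFunction_le R
  have hmeas : ∀ n : ℕ, Measurable fun z =>
      1 / (2 * (n : ℝ)) * Real.log (bergmanDiag (p n) z) - (extremalFunction Y Q z).toReal :=
    fun n => (((continuous_bergmanDiag (p n)).measurable.log).const_mul _).sub
      (measurable_toReal_extremalFunction Y Q)
  have h0 : ∫⁻ _ in K, (0 : ℝ≥0∞) = 0 := by simp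
  rw [← h0]
  refine tendsto_lintegral_filter_of_dominated_convergence (fun _ => ENNReal.ofReal (B₁ + B₂))
    (Eventually.of_forall fun n => (hmeas n).enorm) ?_ ?_ ?_
  · filter_upwards [hp, eventually_ge_atTop 1] with n hpn hn
    filter_upwards [ae_restrict_mem hK.measurableSet] with z hz
    have hzR : ‖z‖ ≤ R := by simpa using hR hz
    rw [← ofReal_norm, Real.norm_eq_abs]
    exact ENNReal.ofReal_le_ofReal ((abs_sub _ _).trans
      (add_le_add (hB₁ n hn (p n) hpn z hzR) (hB₂ z hzR)))
  · rw [setLIntegral_const]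
    exact ENNReal.mul_ne_top ENNReal.ofReal_ne_top hK.measure_lt_top.ne
  · refine Eventually.of_forall fun z => ?_
    have h1 := (h.tendsto_log_bergmanDiag hτ p hp z).sub_const (extremalFunction Y Q z).toReal
    rw [sub_self] at h1
    have := (continuous_enorm.tendsto (0 : ℝ)).comp h1
    rw [enorm_zero] at this
    exact this

theorem lintegral_enorm_le_sq {K : Set (Cn m)} {f : Cn m → ℝ} (hf : Measurable f) :
    ∫⁻ z in K, ‖f z‖ₑ ≤
      (∫⁻ z in K, ENNReal.ofReal (f z ^ 2)) ^ (1 / 2 : ℝ) * volume K ^ (1 / 2 : ℝ) := by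
  have h1 := ENNReal.lintegral_mul_le_Lp_mul_Lq (volume.restrict K) Real.HolderConjugate.two_two
    (f := fun z => ‖f z‖ₑ) (g := fun _ => 1) hf.enorm.aemeasurable aemeasurable_const
  have h2 : ∀ z, ‖f z‖ₑ ^ (2 : ℝ) = ENNReal.ofReal (f z ^ 2) := by
    intro z
    rw [← ofReal_norm, ENNReal.ofReal_rpow_of_nonneg (norm_nonneg _) (by norm_num)]
    congr 1
    rw [Real.norm_eq_abs, Real.rpow_two, sq_abs]
  simpa [h2] using h1

theorem tendsto_lintegral_enorm_of_sq {K : Set (Cn m)} (hK : volume K ≠ ⊤) {f : ℕ → Cn m → ℝ}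
    (hf : ∀ n, Measurable (f n))
    (h : Tendsto (fun n => ∫⁻ z in K, ENNReal.ofReal (f n z ^ 2)) atTop (𝓝 0)) :
    Tendsto (fun n => ∫⁻ z in K, ‖f n z‖ₑ) atTop (𝓝 0) := by
  have hlim : Tendsto (fun n => (∫⁻ z in K, ENNReal.ofReal (f n z ^ 2)) ^ (1 / 2 : ℝ) *
      volume K ^ (1 / 2 : ℝ)) atTop (𝓝 (0 * volume K ^ (1 / 2 : ℝ))) := by
    refine ENNReal.Tendsto.mul_const ?_ (Or.inr (ENNReal.rpow_ne_top_of_nonneg (by norm_num) hK))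
    have := (ENNReal.continuous_rpow_const (y := (1 / 2 : ℝ))).tendsto 0 |>.comp h
    rwa [ENNReal.zero_rpow_of_pos (by norm_num)] at this
  rw [zero_mul] at hlim
  exact tendsto_of_tendsto_of_tendsto_of_le_of_le tendsto_const_nhds hlim (fun _ => zero_le)
    fun n => lintegral_enorm_le_sq (hf n)

/-- A criterion for convergence to `V^*` in `L¹_loc`. -/
theorem tendstoL1Loc_of_sq (h : IsWeightedSet Y Q) {τ : Measure (Cn m)}
    (hτ : IsWeightedMeasure Y Q τ) (p : (n : ℕ) → MultiIndex m n → MvPolynomial (Fin m) ℂ)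
    (hp : ∀ᶠ n in atTop, IsOrthonormalBasis Y Q τ n (p n)) (u : ℕ → Cn m → EReal)
    (hu : ∀ n, Measurable (u n)) (hfin : ∀ᶠ n in atTop, ∀ᵐ z, u n z ≠ ⊤ ∧ u n z ≠ ⊥)
    (hsqfin : ∀ᶠ n : ℕ in atTop, ∀ R : ℕ, ∫⁻ z in Metric.closedBall (0 : Cn m) R,
      ENNReal.ofReal (((u n z).toReal - 1 / (2 * (n : ℝ)) * Real.log (bergmanDiag (p n) z)) ^ 2)
        ≠ ⊤)
    (hsq : ∀ R : ℕ, Tendsto (fun n : ℕ => ∫⁻ z in Metric.closedBall (0 : Cn m) R,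
      ENNReal.ofReal (((u n z).toReal - 1 / (2 * (n : ℝ)) * Real.log (bergmanDiag (p n) z)) ^ 2))
      atTop (𝓝 0)) :
    TendstoL1Loc u (uscReg (extremalFunction Y Q)) := by
  set s : ℕ → Cn m → ℝ := fun n z => 1 / (2 * (n : ℝ)) * Real.log (bergmanDiag (p n) z) with hs
  have hsm : ∀ n, Measurable (s n) := fun n =>
    ((continuous_bergmanDiag (p n)).measurable.log).const_mul _
  have hum : ∀ n, Measurable fun z => (u n z).toReal := fun n => (hu n).ereal_toReal
  have hL1 : ∀ K : Set (Cn m), IsCompact K →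
      Tendsto (fun n => ∫⁻ z in K, ‖(u n z).toReal - (uscReg (extremalFunction Y Q) z).toReal‖ₑ)
        atTop (𝓝 0) := by
    intro K hK
    obtain ⟨R, hR⟩ := hK.isBounded.subset_closedBall 0
    obtain ⟨R', hR'⟩ := exists_nat_ge R
    have hKR : K ⊆ Metric.closedBall 0 R' := hR.trans (Metric.closedBall_subset_closedBall hR')
    -- The hypothesis is in `L²` relative to `s_n`; Cauchy–Schwarz on a ball turns it into `L¹`, and
    -- the triangle inequality replaces `s_n` by its limit `V`, equal to `V^*` almost everywhere.
    have h1 : Tendsto (fun n => ∫⁻ z in K, ‖(u n z).toReal - s n z‖ₑ) atTop (𝓝 0) :=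
      tendsto_of_tendsto_of_tendsto_of_le_of_le tendsto_const_nhds
        (tendsto_lintegral_enorm_of_sq (isCompact_closedBall (0 : Cn m) R').measure_lt_top.ne
          (fun n => (hum n).sub (hsm n)) (hsq R')) (fun _ => zero_le)
        (fun n => lintegral_mono_set hKR)
    have h2 := h1.add (h.tendsto_lintegral_log_bergmanDiag hτ p hp hK)
    rw [add_zero] at h2
    refine tendsto_of_tendsto_of_tendsto_of_le_of_le tendsto_const_nhds h2 (fun _ => zero_le)
      fun n => ?_
    dsimp only
    have hm : Measurable fun z => ‖(u n z).toReal - s n z‖ₑ := ((hum n).sub (hsm n)).enorm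
    rw [← lintegral_add_left hm]
    refine lintegral_mono_ae ?_
    filter_upwards [ae_restrict_of_ae h.uscReg_extremalFunction_ae_eq] with z hz
    rw [hz]
    refine le_trans (le_of_eq ?_) (enorm_add_le _ _)
    congr 1; simp only [hs]; ring
  refine ⟨h.isL1Loc_uscReg_extremalFunction, ?_, hL1⟩
  filter_upwards [hfin, hsqfin, hp, eventually_ge_atTop 1] with n hn1 hn2 hpn hn
  refine ⟨hn1, locallyIntegrable_iff.2 fun K hK => ?_⟩
  obtain ⟨R, hR⟩ := hK.isBounded.subset_closedBall 0
  obtain ⟨R', hR'⟩ := exists_nat_ge R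
  have hKR : K ⊆ Metric.closedBall 0 R' := hR.trans (Metric.closedBall_subset_closedBall hR')
  refine IntegrableOn.mono_set ?_ hKR
  have hvol : volume (Metric.closedBall (0 : Cn m) R') ≠ ⊤ :=
    (isCompact_closedBall (0 : Cn m) (R' : ℝ)).measure_lt_top.ne
  have hs1 : IntegrableOn (s n) (Metric.closedBall 0 R') := by
    obtain ⟨B, hB⟩ := h.exists_abs_log_bergmanDiag_le hτ R'
    refine Measure.integrableOn_of_bounded (M := B) hvol (hsm n).aestronglyMeasurable ?_
    filter_upwards [ae_restrict_mem Metric.isClosed_closedBall.measurableSet] with z hz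
    exact hB n hn (p n) hpn z (by simpa using hz)
  have hs2 : IntegrableOn (fun z => (u n z).toReal - s n z) (Metric.closedBall 0 R') := by
    refine ⟨((hum n).sub (hsm n)).aestronglyMeasurable, ?_⟩
    refine (lintegral_enorm_le_sq ((hum n).sub (hsm n))).trans_lt ?_
    exact ENNReal.mul_lt_top (ENNReal.rpow_lt_top_of_nonneg (by norm_num) (hn2 R'))
      (ENNReal.rpow_lt_top_of_nonneg (by norm_num) hvol)
  refine (hs2.add hs1).congr (Eventually.of_forall fun z => ?_)
  simp

end IsWeightedSet

end Pluripotential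

/-! ### Concentration and tails of random sums -/

namespace Pluripotential

/-- One linear bound serves both kinds of law: a real density gives mass at most `2 T ρ`, a planar
density at most `π T ρ²`, which is at most linear for `ρ ≤ 1`. Larger radii are trivial. -/
theorem IsAdmissibleLaw.exists_closedBall_le {μ : Measure ℂ} (h : IsAdmissibleLaw μ) :
    ∃ C : ℝ, 0 < C ∧ ∀ (x : ℂ) (ρ : ℝ), 0 ≤ ρ → μ (Metric.closedBall x ρ) ≤ ENNReal.ofReal (C * ρ) := by
  obtain ⟨hprob, T, hT, hdens, -⟩ := h
  rcases hdens with ⟨φ, -, hφ, rfl⟩ | ⟨φ, -, hφ, rfl⟩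
  · refine ⟨T * Real.pi + 1, by positivity, fun x ρ hρ => ?_⟩
    rcases le_total ρ 1 with h1 | h1
    · rw [withDensity_apply _ Metric.isClosed_closedBall.measurableSet]
      calc ∫⁻ z in Metric.closedBall x ρ, ENNReal.ofReal (φ z)
          ≤ ∫⁻ _ in Metric.closedBall x ρ, ENNReal.ofReal T :=
            lintegral_mono fun z => ENNReal.ofReal_le_ofReal (hφ z).2
        _ = ENNReal.ofReal (T * (ρ ^ 2 * Real.pi)) := by
            rw [setLIntegral_const, Complex.volume_closedBall, ENNReal.ofReal_mul hT.le,
              ENNReal.ofReal_mul (by positivity), ENNReal.ofReal_pow hρ]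
            congr 2
            rw [← ENNReal.ofReal_coe_nnreal, NNReal.coe_real_pi]
        _ ≤ _ := by
            refine ENNReal.ofReal_le_ofReal ?_
            have : T * (ρ ^ 2 * Real.pi) ≤ T * (ρ * Real.pi) := by
              gcongr; nlinarith
            nlinarith
    · refine prob_le_one.trans ?_
      rw [← ENNReal.ofReal_one]
      refine ENNReal.ofReal_le_ofReal ?_
      have : 0 ≤ T * Real.pi * ρ := by positivity
      nlinarith
  · refine ⟨T * 2, by positivity, fun x ρ hρ => ?_⟩
    rw [Measure.map_apply Complex.measurable_ofReal Metric.isClosed_closedBall.measurableSet,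
      withDensity_apply _ (Complex.measurable_ofReal Metric.isClosed_closedBall.measurableSet)]
    have hsub : (fun t : ℝ => (t : ℂ)) ⁻¹' Metric.closedBall x ρ ⊆ Metric.closedBall x.re ρ := by
      intro t ht
      rw [Set.mem_preimage, Metric.mem_closedBall, dist_eq_norm] at ht
      rw [Metric.mem_closedBall, Real.dist_eq]
      refine le_trans ?_ ht
      simpa using Complex.abs_re_le_norm ((t : ℂ) - x)
    calc ∫⁻ t in (fun t : ℝ => (t : ℂ)) ⁻¹' Metric.closedBall x ρ, ENNReal.ofReal (φ t)
        ≤ ∫⁻ t in Metric.closedBall x.re ρ, ENNReal.ofReal (φ t) := lintegral_mono_set hsub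
      _ ≤ ∫⁻ _ in Metric.closedBall x.re ρ, ENNReal.ofReal T :=
            lintegral_mono fun z => ENNReal.ofReal_le_ofReal (hφ z).2
      _ = _ := by
          rw [setLIntegral_const, Real.volume_closedBall, ← ENNReal.ofReal_mul hT.le, mul_assoc]

theorem IsAdmissibleLaw.exists_tail_le {μ : Measure ℂ} (h : IsAdmissibleLaw μ) :
    ∃ T : ℝ, 0 < T ∧ ∀ R : ℝ, 0 < R → μ {z : ℂ | R ≤ ‖z‖} ≤ ENNReal.ofReal (T / R ^ 2) := by
  obtain ⟨hprob, T, hT, -, htail⟩ := h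
  obtain ⟨R₀, hR₀⟩ := eventually_atTop.1 htail
  refine ⟨T + R₀ ^ 2, by positivity, fun R hR => ?_⟩
  rcases le_total R₀ R with h1 | h1
  · refine (hR₀ R h1).trans (ENNReal.ofReal_le_ofReal ?_)
    gcongr
    nlinarith [sq_nonneg R₀]
  · refine prob_le_one.trans ?_
    rw [← ENNReal.ofReal_one]
    refine ENNReal.ofReal_le_ofReal ?_
    rw [le_div_iff₀ (by positivity), one_mul]
    nlinarith

section RandomSums

variable {Ω : Type*} [MeasurableSpace Ω] {P : Measure Ω}

/-- A random linear combination does not concentrate near `0`. -/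
theorem measure_norm_sum_le [IsProbabilityMeasure P] {ι : Type*} [Fintype ι] {a : ι → Ω → ℂ} (ha : ∀ i, Measurable (a i))
    (hind : iIndepFun a P) {μ : Measure ℂ} (hlaw : ∀ i, P.map (a i) = μ) {C : ℝ}
    (hC : ∀ (x : ℂ) (ρ : ℝ), 0 ≤ ρ → μ (Metric.closedBall x ρ) ≤ ENNReal.ofReal (C * ρ))
    (c : ι → ℂ) (i₀ : ι) (hc : c i₀ ≠ 0) {δ : ℝ} (hδ : 0 ≤ δ) :
    P {ω | ‖∑ i, a i ω * c i‖ ≤ δ} ≤ ENNReal.ofReal (C * (δ / ‖c i₀‖)) := by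
  classical
  have hcpos : 0 < ‖c i₀‖ := norm_pos_iff.2 hc
  set Z : ι → Ω → ℂ := fun i ω => a i ω * c i with hZ
  have hZm : ∀ i, Measurable (Z i) := fun i => (ha i).mul_const _
  have hZind : iIndepFun Z P :=
    hind.comp (fun i x => x * c i) fun i => measurable_id.mul_const _
  set S : Ω → ℂ := ∑ i ∈ Finset.univ.erase i₀, Z i with hS
  have hSm : Measurable S := by
    have := Finset.measurable_sum (Finset.univ.erase i₀) fun i _ => hZm i
    convert this using 1
    ext ω; simp [hS]
  -- Conditioning on all other summands `s`, the remaining coefficient must lie in a disc of radius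
  -- `δ / ‖c i₀‖` about `-s / c i₀`.
  have hI : IndepFun S (Z i₀) P :=
    hZind.indepFun_finsetSum_of_notMem hZm (Finset.notMem_erase i₀ _)
  have hprod := (indepFun_iff_map_prod_eq_prod_map_map hSm.aemeasurable
    (hZm i₀).aemeasurable).1 hI
  have hset : MeasurableSet {q : ℂ × ℂ | ‖q.1 + q.2‖ ≤ δ} :=
    (isClosed_le (by fun_prop) continuous_const).measurableSet
  have hsum : ∀ ω, ∑ i, a i ω * c i = S ω + Z i₀ ω := by
    intro ω
    rw [hS, Finset.sum_apply, Finset.sum_erase_add _ _ (Finset.mem_univ i₀)]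
  have h1 : P {ω | ‖∑ i, a i ω * c i‖ ≤ δ} =
      ((P.map S).prod (P.map (Z i₀))) {q : ℂ × ℂ | ‖q.1 + q.2‖ ≤ δ} := by
    rw [← hprod, Measure.map_apply (hSm.prodMk (hZm i₀)) hset]
    congr 1
    ext ω
    simp [hsum]
  have : IsProbabilityMeasure (P.map S) := Measure.isProbabilityMeasure_map hSm.aemeasurable
  have : IsProbabilityMeasure (P.map (Z i₀)) :=
    Measure.isProbabilityMeasure_map (hZm i₀).aemeasurable
  rw [h1, Measure.prod_apply hset]
  calc ∫⁻ s, P.map (Z i₀) (Prod.mk s ⁻¹' {q : ℂ × ℂ | ‖q.1 + q.2‖ ≤ δ}) ∂P.map S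
      ≤ ∫⁻ _, ENNReal.ofReal (C * (δ / ‖c i₀‖)) ∂P.map S := by
        refine lintegral_mono fun s => ?_
        rw [Measure.map_apply (hZm i₀) (measurable_prodMk_left hset)]
        refine le_trans ?_ (hC (-s / c i₀) (δ / ‖c i₀‖) (by positivity))
        rw [← hlaw i₀, Measure.map_apply (ha i₀) Metric.isClosed_closedBall.measurableSet]
        refine measure_mono fun ω hω => ?_
        simp only [Set.mem_preimage, Set.mem_ofPred_eq, hZ] at hω ⊢
        rw [Metric.mem_closedBall, dist_eq_norm, le_div_iff₀ hcpos, ← norm_mul, sub_mul,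
          div_mul_cancel₀ _ hc]
        rwa [sub_neg_eq_add, add_comm]
    _ = _ := by simp

/-- The first `⌊x⌋ + 1` odd numbers add up to `(⌊x⌋ + 1)²`, which is at least `x²`. -/
theorem sq_le_tsum_indicator (x : ℝ) (hx : 0 ≤ x) :
    ENNReal.ofReal (x ^ 2) ≤
      ∑' k : ℕ, ENNReal.ofReal (2 * k + 1) * (if (k : ℝ) ≤ x then 1 else 0) := by
  set N := ⌊x⌋₊ with hN
  have h1 : x ^ 2 ≤ ∑ k ∈ Finset.range (N + 1), (2 * (k : ℝ) + 1) := by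
    have h2 : ∀ n : ℕ, ∑ k ∈ Finset.range n, (2 * (k : ℝ) + 1) = (n : ℝ) ^ 2 := by
      intro n
      induction n with
      | zero => simp
      | succ n ih => rw [Finset.sum_range_succ, ih]; push_cast; ring
    rw [h2]
    have := (Nat.lt_floor_add_one x).le
    push_cast
    exact pow_le_pow_left₀ hx this 2
  refine (ENNReal.ofReal_le_ofReal h1).trans ?_
  rw [ENNReal.ofReal_sum_of_nonneg fun k _ => by positivity]
  refine le_trans (Finset.sum_le_sum fun k hk => ?_) (ENNReal.sum_le_tsum (Finset.range (N + 1)))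
  have hkx : (k : ℝ) ≤ x :=
    (Nat.le_floor_iff hx).1 (Nat.lt_succ_iff.1 (Finset.mem_range.1 hk))
  rw [if_pos hkx, mul_one]

theorem summable_two_mul_add_one_mul_exp :
    Summable fun k : ℕ => (2 * (k : ℝ) + 1) * Real.exp (-k) := by
  have h1 := (Real.summable_pow_mul_exp_neg_nat_mul 1 one_pos).mul_left 2
  have h2 := Real.summable_pow_mul_exp_neg_nat_mul 0 one_pos
  refine (h1.add h2).congr fun k => ?_
  simp only [pow_one, pow_zero, one_mul, neg_mul]
  ring

/-- Second moments from exponential tails. -/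
theorem lintegral_sq_le_of_tail {Z : Ω → ℝ} (hZ : Measurable Z) (hZ0 : ∀ ω, 0 ≤ Z ω) {C : ℝ}
    (hC : 0 ≤ C) (htail : ∀ k : ℕ, P {ω | (k : ℝ) ≤ Z ω} ≤ ENNReal.ofReal (C * Real.exp (-k))) :
    ∫⁻ ω, ENNReal.ofReal (Z ω ^ 2) ∂P ≤
      ENNReal.ofReal (C * ∑' k : ℕ, (2 * (k : ℝ) + 1) * Real.exp (-k)) := by
  have hm : ∀ k : ℕ, MeasurableSet {ω | (k : ℝ) ≤ Z ω} := fun k =>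
    measurableSet_le measurable_const hZ
  calc ∫⁻ ω, ENNReal.ofReal (Z ω ^ 2) ∂P
      ≤ ∫⁻ ω, ∑' k : ℕ, ENNReal.ofReal (2 * k + 1) * {ω | (k : ℝ) ≤ Z ω}.indicator 1 ω ∂P := by
        refine lintegral_mono fun ω => (sq_le_tsum_indicator (Z ω) (hZ0 ω)).trans (le_of_eq ?_)
        refine tsum_congr fun k => ?_
        simp [Set.indicator_apply]
    _ = ∑' k : ℕ, ENNReal.ofReal (2 * k + 1) * P {ω | (k : ℝ) ≤ Z ω} := by
        have hm2 : ∀ k : ℕ, Measurable fun ω =>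
            ENNReal.ofReal (2 * k + 1) * {ω | (k : ℝ) ≤ Z ω}.indicator 1 ω := fun k =>
          (measurable_one.indicator (hm k)).const_mul _
        rw [lintegral_tsum fun k => (hm2 k).aemeasurable]
        refine tsum_congr fun k => ?_
        rw [lintegral_const_mul _ (measurable_one.indicator (hm k)), lintegral_indicator_one (hm k)]
    _ ≤ ∑' k : ℕ, ENNReal.ofReal (C * ((2 * (k : ℝ) + 1) * Real.exp (-k))) := by
        refine ENNReal.tsum_le_tsum fun k => ?_
        refine (mul_le_mul_right (htail k) _).trans (le_of_eq ?_)
        rw [← ENNReal.ofReal_mul (by positivity)]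
        congr 1; ring
    _ = _ := by
        rw [← ENNReal.ofReal_tsum_of_nonneg (fun k => by positivity)
          (summable_two_mul_add_one_mul_exp.mul_left C), tsum_mul_left]

/-- The Euclidean length of the vector of random linear combinations `∑_ν a_{jν} c_ν`. -/
noncomputable def randomLength {k : ℕ} {ι : Type*} [Fintype ι] (a : Fin k → ι → ℂ) (c : ι → ℂ) : ℝ :=
  Real.sqrt (∑ j, ‖∑ i, a j i * c i‖ ^ 2)

theorem randomLength_le {k : ℕ} {ι : Type*} [Fintype ι] (a : Fin k → ι → ℂ) (c : ι → ℂ) {A : ℝ}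
    (hA : 0 ≤ A) (ha : ∀ j i, ‖a j i‖ ≤ A) :
    randomLength a c ≤ A * Real.sqrt (k * Fintype.card ι) * Real.sqrt (∑ i, ‖c i‖ ^ 2) := by
  unfold randomLength
  refine Real.sqrt_le_iff.2 ⟨by positivity, ?_⟩
  rw [mul_pow, mul_pow, Real.sq_sqrt (by positivity), Real.sq_sqrt (by positivity)]
  have hj : ∀ j, ‖∑ i, a j i * c i‖ ^ 2 ≤ (A ^ 2 * Fintype.card ι) * ∑ i, ‖c i‖ ^ 2 := by
    intro j
    have h1 : ‖∑ i, a j i * c i‖ ≤ ∑ i, ‖a j i‖ * ‖c i‖ :=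
      (norm_sum_le _ _).trans (le_of_eq (by simp))
    refine (pow_le_pow_left₀ (norm_nonneg _) h1 2).trans
      ((Finset.sum_mul_sq_le_sq_mul_sq _ _ _).trans ?_)
    refine mul_le_mul_of_nonneg_right ?_ (by positivity)
    refine (Finset.sum_le_sum fun i _ => pow_le_pow_left₀ (norm_nonneg _) (ha j i) 2).trans ?_
    rw [Finset.sum_const, Finset.card_univ, nsmul_eq_mul, mul_comm]
  refine (Finset.sum_le_sum fun j _ => hj j).trans (le_of_eq ?_)
  rw [Finset.sum_const, Finset.card_univ, nsmul_eq_mul, Fintype.card_fin]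
  ring

theorem norm_sum_le_randomLength {k : ℕ} {ι : Type*} [Fintype ι] (a : Fin k → ι → ℂ) (c : ι → ℂ)
    (j : Fin k) : ‖∑ i, a j i * c i‖ ≤ randomLength a c := by
  refine Real.le_sqrt_of_sq_le ?_
  exact Finset.single_le_sum (f := fun j => ‖∑ i, a j i * c i‖ ^ 2) (fun _ _ => sq_nonneg _)
    (Finset.mem_univ j)

theorem measurable_randomLength {k : ℕ} {ι : Type*} [Fintype ι] {a : Fin k → ι → Ω → ℂ}
    (ha : ∀ j i, Measurable (a j i)) (c : ι → ℂ) :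
    Measurable fun ω => randomLength (fun j i => a j i ω) c := by
  unfold randomLength
  refine Measurable.sqrt (Finset.measurable_sum _ fun j _ => ?_)
  exact (Finset.measurable_sum _ fun i _ => (ha j i).mul_const _).norm.pow_const 2

variable {k : ℕ} {ι : Type*} [Fintype ι] {a : Fin k → ι → Ω → ℂ} {μ : Measure ℂ} {C T : ℝ}

/-- One component already suffices. Some `‖c i₀‖²` is at least the mean of the squares, and
non-concentration is applied to that coefficient. -/
theorem measure_randomLength_le [IsProbabilityMeasure P] (hk : 0 < k) (ha : ∀ j i, Measurable (a j i))
    (hind : iIndepFun (fun q : Fin k × ι => a q.1 q.2) P) (hlaw : ∀ j i, P.map (a j i) = μ)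
    (hC0 : 0 < C)
    (hC : ∀ (x : ℂ) (ρ : ℝ), 0 ≤ ρ → μ (Metric.closedBall x ρ) ≤ ENNReal.ofReal (C * ρ))
    (c : ι → ℂ) (hc : 0 < ∑ i, ‖c i‖ ^ 2) {δ : ℝ} (hδ : 0 ≤ δ) :
    P {ω | randomLength (fun j i => a j i ω) c ≤ δ * Real.sqrt (∑ i, ‖c i‖ ^ 2)} ≤
      ENNReal.ofReal (C * (Fintype.card ι * δ)) := by
  classical
  set S := ∑ i, ‖c i‖ ^ 2 with hS
  set N : ℝ := (Fintype.card ι : ℝ) with hN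
  have hne : Nonempty ι := by
    by_contra hne
    rw [not_nonempty_iff] at hne
    simp [hS] at hc
  have hN1 : 1 ≤ N := by
    rw [hN]; exact_mod_cast Fintype.card_pos
  obtain ⟨i₀, hi₀⟩ : ∃ i, S ≤ N * ‖c i‖ ^ 2 := by
    by_contra hcon
    push Not at hcon
    have h1 : ∑ i, N * ‖c i‖ ^ 2 < ∑ _i : ι, S :=
      Finset.sum_lt_sum_of_nonempty Finset.univ_nonempty fun i _ => hcon i
    rw [← Finset.mul_sum, Finset.sum_const, Finset.card_univ, nsmul_eq_mul] at h1
    exact lt_irrefl _ h1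
  have hci : 0 < ‖c i₀‖ := by
    rcases (norm_nonneg (c i₀)).eq_or_lt with h0 | h0
    · rw [← h0] at hi₀; simp at hi₀; linarith
    · exact h0
  have hsub : {ω | randomLength (fun j i => a j i ω) c ≤ δ * Real.sqrt S} ⊆
      {ω | ‖∑ i, a ⟨0, hk⟩ i ω * c i‖ ≤ δ * Real.sqrt S} := fun ω hω =>
    (norm_sum_le_randomLength (fun j i => a j i ω) c ⟨0, hk⟩).trans hω
  have hind' : iIndepFun (fun i => a ⟨0, hk⟩ i) P :=
    hind.precomp (g := fun i => ((⟨0, hk⟩ : Fin k), i)) fun i i' h => (Prod.mk.inj h).2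
  refine (measure_mono hsub).trans ((measure_norm_sum_le (ha _) hind' (hlaw _) hC c i₀
    (norm_pos_iff.1 hci) (by positivity)).trans (ENNReal.ofReal_le_ofReal ?_))
  refine mul_le_mul_of_nonneg_left ?_ hC0.le
  rw [div_le_iff₀ hci]
  have h1 : Real.sqrt S ≤ N * ‖c i₀‖ := by
    refine Real.sqrt_le_iff.2 ⟨by positivity, hi₀.trans ?_⟩
    rw [mul_pow]
    gcongr
    nlinarith
  calc δ * Real.sqrt S ≤ δ * (N * ‖c i₀‖) := by gcongr
    _ = N * δ * ‖c i₀‖ := by ring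

/-- A union bound over `k * card ι` coefficients; the factor under the square root cancels their
number. -/
theorem measure_exists_norm_ge (ha : ∀ j i, Measurable (a j i)) (hlaw : ∀ j i, P.map (a j i) = μ)
    (hT : ∀ R : ℝ, 0 < R → μ {z : ℂ | R ≤ ‖z‖} ≤ ENNReal.ofReal (T / R ^ 2))
    {R : ℝ} (hR : 0 < R) (hk : 0 < k) (hι : Nonempty ι) :
    P {ω | ∃ j i, R * Real.sqrt (k * Fintype.card ι) ≤ ‖a j i ω‖} ≤
      ENNReal.ofReal (T / R ^ 2) := by
  have hcard : (0 : ℝ) < Fintype.card ι := by exact_mod_cast Fintype.card_pos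
  have hk0 : (0 : ℝ) < k := by exact_mod_cast hk
  set ρ := R * Real.sqrt (k * Fintype.card ι) with hρ
  have hρ0 : 0 < ρ := by positivity
  have hset : {ω | ∃ j i, ρ ≤ ‖a j i ω‖} = ⋃ q : Fin k × ι, {ω | ρ ≤ ‖a q.1 q.2 ω‖} := by
    ext ω; simp
  rw [hset]
  refine (measure_iUnion_fintype_le _ _).trans ?_
  have h1 : ∀ q : Fin k × ι, P {ω | ρ ≤ ‖a q.1 q.2 ω‖} ≤ ENNReal.ofReal (T / ρ ^ 2) := by
    intro q
    refine le_trans (le_of_eq ?_) (hT ρ hρ0)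
    rw [← hlaw q.1 q.2, Measure.map_apply (ha _ _)
      (isClosed_le continuous_const continuous_norm).measurableSet]
    rfl
  refine (Finset.sum_le_sum fun q _ => h1 q).trans (le_of_eq ?_)
  rw [Finset.sum_const, Finset.card_univ, nsmul_eq_mul, ← ENNReal.ofReal_natCast,
    ← ENNReal.ofReal_mul (by positivity)]
  congr 1
  rw [hρ, mul_pow, Real.sq_sqrt (by positivity), Fintype.card_prod, Fintype.card_fin]
  push_cast
  field_simp

/-- The second moment of the logarithm of the normalized length. -/
theorem lintegral_log_randomLength_sq_le [IsProbabilityMeasure P] (hk : 0 < k) (ha : ∀ j i, Measurable (a j i))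
    (hind : iIndepFun (fun q : Fin k × ι => a q.1 q.2) P) (hlaw : ∀ j i, P.map (a j i) = μ)
    (hC0 : 0 < C)
    (hC : ∀ (x : ℂ) (ρ : ℝ), 0 ≤ ρ → μ (Metric.closedBall x ρ) ≤ ENNReal.ofReal (C * ρ))
    (hT0 : 0 < T) (hT : ∀ R : ℝ, 0 < R → μ {z : ℂ | R ≤ ‖z‖} ≤ ENNReal.ofReal (T / R ^ 2))
    (c : ι → ℂ) (hc : 0 < ∑ i, ‖c i‖ ^ 2) :
    ∫⁻ ω, ENNReal.ofReal (Real.log (randomLength (fun j i => a j i ω) c /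
        Real.sqrt (∑ i, ‖c i‖ ^ 2)) ^ 2) ∂P ≤
      ENNReal.ofReal (2 * Real.log (k * Fintype.card ι) ^ 2 +
        2 * ((C + T + 1) * ∑' l : ℕ, (2 * (l : ℝ) + 1) * Real.exp (-l))) := by
  set S := ∑ i, ‖c i‖ ^ 2 with hS
  have hne : Nonempty ι := by
    by_contra hne
    rw [not_nonempty_iff] at hne
    simp [hS] at hc
  have hcard : (1 : ℝ) ≤ Fintype.card ι := by exact_mod_cast Fintype.card_pos
  have hk1 : (1 : ℝ) ≤ k := by exact_mod_cast hk
  have hkN : 1 ≤ (k : ℝ) * Fintype.card ι := one_le_mul_of_one_le_of_one_le hk1 hcard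
  have hkN0 : 0 < (k : ℝ) * Fintype.card ι := by linarith
  have hsS : 0 < Real.sqrt S := Real.sqrt_pos.2 hc
  set L := Real.log (k * Fintype.card ι) with hL
  have hL0 : 0 ≤ L := Real.log_nonneg hkN
  set W : Ω → ℝ := fun ω => randomLength (fun j i => a j i ω) c / Real.sqrt S with hW
  have hW0 : ∀ ω, 0 ≤ W ω := fun ω => div_nonneg (Real.sqrt_nonneg _) hsS.le
  have hWm : Measurable W := (measurable_randomLength ha c).div_const _
  -- The excess of `|log W|` over `L`: dimension enters only through `L`, so the tail of `Z` is
  -- exponential with constants independent of the dimension.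
  set Z : Ω → ℝ := fun ω => max (|Real.log (W ω)| - L) 0 with hZ
  have hZm : Measurable Z := ((hWm.log.abs).sub_const L).max measurable_const
  have hexp : ∀ l : ℕ, Real.exp (-(L + l)) * (k * Fintype.card ι) = Real.exp (-l) := by
    intro l
    rw [neg_add, Real.exp_add, Real.exp_neg, hL, Real.exp_log hkN0]
    field_simp
  have htail : ∀ l : ℕ, P {ω | (l : ℝ) ≤ Z ω} ≤ ENNReal.ofReal ((C + T + 1) * Real.exp (-l)) := by
    intro l
    rcases Nat.eq_zero_or_pos l with rfl | hl
    · refine prob_le_one.trans ?_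
      rw [← ENNReal.ofReal_one]
      refine ENNReal.ofReal_le_ofReal ?_
      simp only [Nat.cast_zero, neg_zero, Real.exp_zero]
      linarith
    -- Small `W` is a concentration event. If all coefficients were below `exp (l / 2) * √(k N)`,
    -- with `N = card ι`, then `W ≤ exp (l / 2 + L)`. The exponent `l / 2` turns the tail `T / R²`
    -- into `T exp (-l)`.
    have hsub : {ω | (l : ℝ) ≤ Z ω} ⊆
        {ω | randomLength (fun j i => a j i ω) c ≤ Real.exp (-(L + l)) * Real.sqrt S} ∪
        {ω | ∃ j i, Real.exp (l / 2) * Real.sqrt (k * Fintype.card ι) ≤ ‖a j i ω‖} := by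
      intro ω hω
      have hl0 : (0 : ℝ) < l := by exact_mod_cast hl
      have h1 : L + l ≤ |Real.log (W ω)| := by
        rcases le_max_iff.1 (show (l : ℝ) ≤ max (|Real.log (W ω)| - L) 0 from hω) with h | h
        · linarith
        · linarith
      rcases le_abs.1 h1 with h2 | h2
      · right
        by_contra hcon
        simp only [Set.mem_ofPred_eq, not_exists, not_le] at hcon
        have h3 := randomLength_le (fun j i => a j i ω) c
          (A := Real.exp (l / 2) * Real.sqrt (k * Fintype.card ι)) (by positivity)
          (fun j i => (hcon j i).le)
        rw [mul_assoc (Real.exp _), Real.mul_self_sqrt hkN0.le] at h3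
        have h4 : W ω ≤ Real.exp (l / 2 + L) := by
          rw [Real.exp_add, hL, Real.exp_log hkN0]
          exact (div_le_iff₀ hsS).2 h3
        -- Here `Real.log 0 = 0` helps: `W ω = 0` would contradict `L + l ≤ log (W ω)` with `l > 0`.
        have h5 : 0 < W ω := by
          rcases (hW0 ω).eq_or_lt with h0 | h0
          · rw [← h0, Real.log_zero] at h2; linarith
          · exact h0
        rw [← Real.log_le_iff_le_exp h5] at h4
        linarith
      · left
        have h3 : W ω ≤ Real.exp (-(L + l)) := by
          rcases (hW0 ω).eq_or_lt with h0 | h0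
          · rw [← h0]; positivity
          · rw [← Real.log_le_iff_le_exp h0]; linarith
        exact (div_le_iff₀ hsS).1 h3
    refine (measure_mono hsub).trans ((measure_union_le _ _).trans ?_)
    have hCT : C * Real.exp (-l) + T * Real.exp (-l) ≤ (C + T + 1) * Real.exp (-l) := by
      rw [← add_mul]
      exact mul_le_mul_of_nonneg_right (by linarith) (Real.exp_pos _).le
    refine le_trans ?_ (ENNReal.ofReal_le_ofReal hCT)
    rw [ENNReal.ofReal_add (by positivity) (by positivity)]
    refine add_le_add ?_ ?_
    · refine (measure_randomLength_le hk ha hind hlaw hC0 hC c hc (Real.exp_pos _).le).trans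
        (ENNReal.ofReal_le_ofReal ?_)
      gcongr
      rw [← hexp l, mul_comm]
      gcongr
      nlinarith
    · refine (measure_exists_norm_ge ha hlaw hT (Real.exp_pos _) hk hne).trans
        (ENNReal.ofReal_le_ofReal ?_)
      rw [div_eq_mul_inv, ← Real.exp_nat_mul, ← Real.exp_neg]
      gcongr
      push_cast
      linarith
  have hZ2 := lintegral_sq_le_of_tail (P := P) hZm (fun ω => le_max_right _ _) (by positivity) htail
  have hpt : ∀ ω, ENNReal.ofReal (Real.log (W ω) ^ 2) ≤
      ENNReal.ofReal (2 * L ^ 2) + 2 * ENNReal.ofReal (Z ω ^ 2) := by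
    intro ω
    have h2 : (2 : ℝ≥0∞) = ENNReal.ofReal 2 := by simp
    rw [h2, ← ENNReal.ofReal_mul (by norm_num), ← ENNReal.ofReal_add (by positivity) (by positivity)]
    refine ENNReal.ofReal_le_ofReal ?_
    have h3 : |Real.log (W ω)| ≤ L + Z ω := by
      have := le_max_left (|Real.log (W ω)| - L) 0
      simp only [hZ]; linarith
    have h4 := pow_le_pow_left₀ (abs_nonneg _) h3 2
    rw [sq_abs] at h4
    nlinarith [sq_nonneg (L - Z ω)]
  refine (lintegral_mono hpt).trans ?_
  rw [lintegral_add_left measurable_const, lintegral_const, measure_univ, mul_one,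
    lintegral_const_mul _ (hZm.pow_const 2).ennreal_ofReal]
  have h2 : (2 : ℝ≥0∞) = ENNReal.ofReal 2 := by simp
  have h5 : 0 ≤ ∑' l : ℕ, (2 * (l : ℝ) + 1) * Real.exp (-l) := tsum_nonneg fun l => by positivity
  rw [ENNReal.ofReal_add (by positivity) (by positivity), ENNReal.ofReal_mul (p := 2) (by norm_num),
    ENNReal.ofReal_mul (p := 2) (by norm_num), ← h2]
  gcongr

end RandomSums

end Pluripotential

/-! ### Random polynomial mappings -/

namespace Pluripotential

theorem potentialMap_eq {m n k : ℕ} (p : MultiIndex m n → MvPolynomial (Fin m) ℂ)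
    (c : Fin k → MultiIndex m n → ℂ) (z : Cn m) :
    potentialMap p c z =
      (((1 : ℝ) / n : ℝ) : EReal) * elog (randomLength c fun ν => peval (p ν) z) := rfl

theorem randomLength_nonneg {k : ℕ} {ι : Type*} [Fintype ι] (a : Fin k → ι → ℂ) (c : ι → ℂ) :
    0 ≤ randomLength a c := Real.sqrt_nonneg _

theorem toReal_mul_elog {n : ℕ} (hn : 1 ≤ n) {x : ℝ} (hx : 0 ≤ x) :
    ((((1 : ℝ) / n : ℝ) : EReal) * elog x).toReal = 1 / n * Real.log x := by
  have hn0 : (0 : ℝ) < n := by exact_mod_cast hn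
  rcases hx.eq_or_lt with rfl | hx
  · rw [elog_zero, EReal.coe_mul_bot_of_pos (by positivity)]; simp
  · rw [IsWeightedSet.coe_mul_elog_of_pos hx, EReal.toReal_coe]

theorem mul_elog_ne_top {n : ℕ} (hn : 1 ≤ n) {x : ℝ} (hx : 0 ≤ x) :
    (((1 : ℝ) / n : ℝ) : EReal) * elog x ≠ ⊤ := by
  have hn0 : (0 : ℝ) < n := by exact_mod_cast hn
  rcases hx.eq_or_lt with rfl | hx
  · rw [elog_zero, EReal.coe_mul_bot_of_pos (by positivity)]; simp
  · rw [IsWeightedSet.coe_mul_elog_of_pos hx]; exact EReal.coe_ne_top _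

theorem mul_elog_ne_bot {n : ℕ} {x : ℝ} (hx : 0 < x) :
    (((1 : ℝ) / n : ℝ) : EReal) * elog x ≠ ⊥ := by
  rw [IsWeightedSet.coe_mul_elog_of_pos hx]; exact EReal.coe_ne_bot _

theorem measurable_randomLength_peval {m n k : ℕ} {Ω : Type*} [MeasurableSpace Ω]
    (p : MultiIndex m n → MvPolynomial (Fin m) ℂ) {a : Fin k → MultiIndex m n → Ω → ℂ}
    (ha : ∀ j ν, Measurable (a j ν)) :
    Measurable fun q : Ω × Cn m =>
      randomLength (fun j ν => a j ν q.1) fun ν => peval (p ν) q.2 := by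
  unfold randomLength
  refine Measurable.sqrt (Finset.measurable_sum _ fun j _ => ?_)
  refine (Finset.measurable_sum _ fun ν _ => ?_).norm.pow_const 2
  exact ((ha j ν).comp measurable_fst).mul ((continuous_peval (p ν)).measurable.comp measurable_snd)

theorem continuous_potentialMap {m n k : ℕ} (p : MultiIndex m n → MvPolynomial (Fin m) ℂ)
    (c : Fin k → MultiIndex m n → ℂ) : Continuous (potentialMap p c) := by
  refine (IsWeightedSet.continuous_mul_elog ((1 : ℝ) / n)).comp (Real.continuous_sqrt.comp
    (continuous_finsetSum _ fun j _ => Continuous.pow (Continuous.norm ?_) 2))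
  exact continuous_finsetSum _ fun ν _ => continuous_const.mul (continuous_peval (p ν))

theorem measurable_potentialMap {m n k : ℕ} {Ω : Type*} [MeasurableSpace Ω]
    (p : MultiIndex m n → MvPolynomial (Fin m) ℂ) {a : Fin k → MultiIndex m n → Ω → ℂ}
    (ha : ∀ j ν, Measurable (a j ν)) :
    Measurable fun q : Ω × Cn m => potentialMap p (fun j ν => a j ν q.1) q.2 :=
  (IsWeightedSet.continuous_mul_elog ((1 : ℝ) / n)).measurable.comp
    (measurable_randomLength_peval p ha)

/-- The exponent `1 / 4` is chosen so that the square contributes `n ^ (1 / 2)`, which leaves the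
summable `n ^ (-3 / 2)` after division by `n²`. -/
theorem log_card_le {m n : ℕ} (hn : 1 ≤ n) :
    Real.log (Fintype.card (MultiIndex m n)) ≤ 8 * m * (n : ℝ) ^ (1 / 4 : ℝ) := by
  have hn1 : (1 : ℝ) ≤ n := by exact_mod_cast hn
  have h1 : (Fintype.card (MultiIndex m n) : ℝ) ≤ ((n : ℝ) + 1) ^ m := by
    exact_mod_cast card_multiIndex_le_pow m n
  have hcard : (0 : ℝ) < Fintype.card (MultiIndex m n) := by
    have : 0 < Fintype.card (MultiIndex m n) := Fintype.card_pos_iff.2 ⟨⟨fun _ => 0, by simp⟩⟩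
    exact_mod_cast this
  have h2 := Real.log_le_log hcard h1
  rw [Real.log_pow] at h2
  have h3 := Real.log_le_rpow_div (x := (n : ℝ) + 1) (by positivity) (show (0 : ℝ) < 1 / 4 by norm_num)
  have h4 : ((n : ℝ) + 1) ^ (1 / 4 : ℝ) ≤ 2 * (n : ℝ) ^ (1 / 4 : ℝ) := by
    calc ((n : ℝ) + 1) ^ (1 / 4 : ℝ) ≤ (2 * (n : ℝ)) ^ (1 / 4 : ℝ) :=
          Real.rpow_le_rpow (by positivity) (by linarith) (by norm_num)
      _ = (2 : ℝ) ^ (1 / 4 : ℝ) * (n : ℝ) ^ (1 / 4 : ℝ) :=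
          Real.mul_rpow (by norm_num) (by positivity)
      _ ≤ 2 * (n : ℝ) ^ (1 / 4 : ℝ) := by
          refine mul_le_mul_of_nonneg_right ?_ (by positivity)
          calc (2 : ℝ) ^ (1 / 4 : ℝ) ≤ (2 : ℝ) ^ (1 : ℝ) :=
                Real.rpow_le_rpow_of_exponent_le (by norm_num) (by norm_num)
            _ = 2 := Real.rpow_one 2
  have h5 : Real.log ((n : ℝ) + 1) ≤ 8 * (n : ℝ) ^ (1 / 4 : ℝ) := by
    refine h3.trans ?_
    rw [div_le_iff₀ (by norm_num)]
    linarith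
  calc Real.log (Fintype.card (MultiIndex m n)) ≤ m * Real.log ((n : ℝ) + 1) := h2
    _ ≤ m * (8 * (n : ℝ) ^ (1 / 4 : ℝ)) := by gcongr
    _ = _ := by ring

theorem nonempty_multiIndex (m n : ℕ) : Nonempty (MultiIndex m n) := ⟨⟨fun _ => 0, by simp⟩⟩

section Random

variable {m k : ℕ} {Ω : Type*} [MeasurableSpace Ω] {P : Measure Ω}
  {a : (n : ℕ) → Fin k → MultiIndex m n → Ω → ℂ}

theorem IsIIDAdmissible.measurable_coeff
    (h : IsIIDAdmissible P fun i : (Σ n : ℕ, Fin k × MultiIndex m n) => a i.1 i.2.1 i.2.2)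
    (n : ℕ) (j : Fin k) (ν : MultiIndex m n) : Measurable (a n j ν) := h.1 ⟨n, j, ν⟩

theorem IsIIDAdmissible.iIndepFun_coeff
    (h : IsIIDAdmissible P fun i : (Σ n : ℕ, Fin k × MultiIndex m n) => a i.1 i.2.1 i.2.2)
    (n : ℕ) : iIndepFun (fun q : Fin k × MultiIndex m n => a n q.1 q.2) P :=
  h.2.1.precomp (g := fun q => (⟨n, q⟩ : Σ n : ℕ, Fin k × MultiIndex m n))
    fun q q' hq => by simpa using hq

/-- Zeros of random mappings at a given point have probability zero. -/
theorem IsIIDAdmissible.ae_randomLength_ne_zero [IsProbabilityMeasure P]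
    (h : IsIIDAdmissible P fun i : (Σ n : ℕ, Fin k × MultiIndex m n) => a i.1 i.2.1 i.2.2)
    (hk : 0 < k) {n : ℕ} (p : MultiIndex m n → MvPolynomial (Fin m) ℂ) (z : Cn m)
    (hS : 0 < bergmanDiag p z) :
    ∀ᵐ ω ∂P, 0 < randomLength (fun j ν => a n j ν ω) fun ν => peval (p ν) z := by
  have hm := h.measurable_coeff
  have hi := h.iIndepFun_coeff n
  obtain ⟨-, -, μ, hμ, hlaw⟩ := h
  obtain ⟨C, hC0, hC⟩ := hμ.exists_closedBall_le
  have h1 := measure_randomLength_le hk (hm n) hi (fun j ν => hlaw ⟨n, j, ν⟩) hC0 hC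
    (fun ν => peval (p ν) z) hS (le_refl (0 : ℝ))
  rw [mul_zero, mul_zero, ENNReal.ofReal_zero] at h1
  have h2 : P {ω | ¬ 0 < randomLength (fun j ν => a n j ν ω) fun ν => peval (p ν) z} = 0 := by
    refine measure_mono_null (fun ω hω => ?_) (nonpos_iff_eq_zero.1 h1)
    rw [Set.mem_ofPred_eq, zero_mul]
    exact not_lt.1 hω
  exact h2

/-- The difference is `1 / n` times the logarithm of the normalized length, almost surely. The
constant `D` depends neither on `z` nor on the basis, which permits integration in `z`. -/
theorem IsIIDAdmissible.exists_lintegral_sq_le [IsProbabilityMeasure P]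
    (h : IsIIDAdmissible P fun i : (Σ n : ℕ, Fin k × MultiIndex m n) => a i.1 i.2.1 i.2.2)
    (hk : 0 < k) :
    ∃ D : ℝ, 0 ≤ D ∧ ∀ n : ℕ, 1 ≤ n → ∀ p : MultiIndex m n → MvPolynomial (Fin m) ℂ, ∀ z,
      0 < bergmanDiag p z →
        ∫⁻ ω, ENNReal.ofReal (((potentialMap p (fun j ν => a n j ν ω) z).toReal -
          1 / (2 * (n : ℝ)) * Real.log (bergmanDiag p z)) ^ 2) ∂P ≤
            ENNReal.ofReal (D * (1 / (n : ℝ) ^ (3 / 2 : ℝ))) := by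
  have hm := h.measurable_coeff
  have hi := h.iIndepFun_coeff
  have hne := fun (n : ℕ) (p : MultiIndex m n → MvPolynomial (Fin m) ℂ) z =>
    h.ae_randomLength_ne_zero hk p z
  obtain ⟨-, -, μ, hμ, hlaw⟩ := h
  obtain ⟨C, hC0, hC⟩ := hμ.exists_closedBall_le
  obtain ⟨T, hT0, hT⟩ := hμ.exists_tail_le
  set E := (C + T + 1) * ∑' l : ℕ, (2 * (l : ℝ) + 1) * Real.exp (-l) with hE
  have hE0 : 0 ≤ E := mul_nonneg (by positivity) (tsum_nonneg fun l => by positivity)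
  refine ⟨2 * (Real.log k + 8 * m) ^ 2 + 2 * E, by positivity, fun n hn p z hS => ?_⟩
  have hn0 : (0 : ℝ) < n := by exact_mod_cast hn
  have hn1 : (1 : ℝ) ≤ n := by exact_mod_cast hn
  have hk1 : (1 : ℝ) ≤ k := by exact_mod_cast hk
  have hmom := lintegral_log_randomLength_sq_le hk (hm n) (hi n) (fun j ν => hlaw ⟨n, j, ν⟩) hC0 hC
    hT0 hT (fun ν => peval (p ν) z) hS
  change _ ≤ ENNReal.ofReal (2 * Real.log (k * Fintype.card (MultiIndex m n)) ^ 2 + 2 * E) at hmom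
  have hsS : 0 < Real.sqrt (bergmanDiag p z) := Real.sqrt_pos.2 hS
  have hae : ∀ᵐ ω ∂P, ENNReal.ofReal (((potentialMap p (fun j ν => a n j ν ω) z).toReal -
      1 / (2 * (n : ℝ)) * Real.log (bergmanDiag p z)) ^ 2) =
      ENNReal.ofReal (1 / (n : ℝ) ^ 2) * ENNReal.ofReal (Real.log
        (randomLength (fun j ν => a n j ν ω) (fun ν => peval (p ν) z) /
          Real.sqrt (∑ ν, ‖peval (p ν) z‖ ^ 2)) ^ 2) := by
    filter_upwards [hne n p z hS] with ω hω
    rw [← ENNReal.ofReal_mul (by positivity), potentialMap_eq, toReal_mul_elog hn hω.le]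
    change _ = ENNReal.ofReal (1 / (n : ℝ) ^ 2 * Real.log (_ / Real.sqrt (bergmanDiag p z)) ^ 2)
    rw [Real.log_div hω.ne' hsS.ne', Real.log_sqrt hS.le]
    congr 1
    field_simp
  have hcard : (1 : ℝ) ≤ Fintype.card (MultiIndex m n) := by
    have := nonempty_multiIndex m n
    exact_mod_cast Fintype.card_pos
  have hlog : Real.log (k * Fintype.card (MultiIndex m n)) ≤
      (Real.log k + 8 * m) * (n : ℝ) ^ (1 / 4 : ℝ) := by
    rw [Real.log_mul (by positivity) (by positivity), add_mul]
    refine add_le_add ?_ (log_card_le hn)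
    exact le_mul_of_one_le_right (Real.log_nonneg hk1) (Real.one_le_rpow hn1 (by norm_num))
  have hlog0 : 0 ≤ Real.log (k * Fintype.card (MultiIndex m n)) :=
    Real.log_nonneg (one_le_mul_of_one_le_of_one_le hk1 hcard)
  have hsq : Real.log (k * Fintype.card (MultiIndex m n)) ^ 2 ≤
      (Real.log k + 8 * m) ^ 2 * (n : ℝ) ^ (1 / 2 : ℝ) := by
    refine (pow_le_pow_left₀ hlog0 hlog 2).trans (le_of_eq ?_)
    rw [mul_pow, ← Real.rpow_natCast ((n : ℝ) ^ (1 / 4 : ℝ)), ← Real.rpow_mul hn0.le]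
    norm_num
  rw [lintegral_congr_ae hae, lintegral_const_mul' _ _ ENNReal.ofReal_ne_top]
  refine (mul_le_mul_right hmom _).trans ?_
  rw [← ENNReal.ofReal_mul (by positivity)]
  refine ENNReal.ofReal_le_ofReal ?_
  have hr1 : 1 ≤ (n : ℝ) ^ (1 / 2 : ℝ) := Real.one_le_rpow hn1 (by norm_num)
  have hr2 : (n : ℝ) ^ 2 = (n : ℝ) ^ (3 / 2 : ℝ) * (n : ℝ) ^ (1 / 2 : ℝ) := by
    rw [← Real.rpow_add hn0]; norm_num
  have hr3 : 0 < (n : ℝ) ^ (3 / 2 : ℝ) := by positivity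
  have hr4 : 0 < (n : ℝ) ^ (1 / 2 : ℝ) := by positivity
  have hbd : 2 * Real.log (k * Fintype.card (MultiIndex m n)) ^ 2 + 2 * E ≤
      (2 * (Real.log k + 8 * m) ^ 2 + 2 * E) * (n : ℝ) ^ (1 / 2 : ℝ) := by
    have := le_mul_of_one_le_right hE0 hr1
    linarith
  refine (mul_le_mul_of_nonneg_left hbd (by positivity)).trans (le_of_eq ?_)
  rw [hr2]
  field_simp

theorem tsum_rpow_ne_top (D : ℝ) (hD : 0 ≤ D) (n₀ : ℕ) :
    ∑' n : ℕ, ENNReal.ofReal (D * (1 / ((n + n₀ : ℕ) : ℝ) ^ (3 / 2 : ℝ))) ≠ ⊤ := by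
  have h1 : Summable fun n : ℕ => D * (1 / (n : ℝ) ^ (3 / 2 : ℝ)) :=
    (Real.summable_one_div_nat_rpow.2 (by norm_num)).mul_left D
  have h2 := (summable_nat_add_iff n₀).2 h1
  rw [← ENNReal.ofReal_tsum_of_nonneg (fun n => by positivity) h2]
  exact ENNReal.ofReal_ne_top

/-! ### Almost sure convergence of the random potentials -/

namespace IsWeightedSet

variable {Y : Set (Cn m)} {Q : Cn m → ℝ} {τ : Measure (Cn m)}
  {p : (n : ℕ) → MultiIndex m n → MvPolynomial (Fin m) ℂ}

/-- The expected squared `L²` distances on a ball are summable in `n`, so almost surely their series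
converges and its terms tend to `0`. Countably many balls exhaust the space. -/
theorem ae_tendstoL1Loc [IsProbabilityMeasure P] (h : IsWeightedSet Y Q)
    (hτ : IsWeightedMeasure Y Q τ) (hp : ∀ᶠ n in atTop, IsOrthonormalBasis Y Q τ n (p n))
    (hk : 0 < k)
    (ha : IsIIDAdmissible P fun i : (Σ n : ℕ, Fin k × MultiIndex m n) => a i.1 i.2.1 i.2.2) :
    ∀ᵐ ω ∂P, TendstoL1Loc (fun n => potentialMap (p n) (fun j ν => a n j ν ω))
      (uscReg (extremalFunction Y Q)) := by
  obtain ⟨n₀, hn₀⟩ := eventually_atTop.1 (hp.and (eventually_ge_atTop 1))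
  obtain ⟨D, hD, hmom⟩ := ha.exists_lintegral_sq_le hk
  have hS : ∀ n, n₀ ≤ n → ∀ z, 0 < bergmanDiag (p n) z := fun n hn z =>
    h.bergmanDiag_pos hτ (hn₀ n hn).2 (hn₀ n hn).1 z
  have hpm : ∀ n, Measurable fun q : Ω × Cn m => potentialMap (p n) (fun j ν => a n j ν q.1) q.2 :=
    fun n => measurable_potentialMap (p n) (ha.measurable_coeff n)
  let f : ℕ → Ω → Cn m → ℝ≥0∞ := fun n ω z =>
    ENNReal.ofReal (((potentialMap (p n) (fun j ν => a n j ν ω) z).toReal -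
      1 / (2 * (n : ℝ)) * Real.log (bergmanDiag (p n) z)) ^ 2)
  have hfm : ∀ n, Measurable (Function.uncurry (f n)) := by
    intro n
    refine ENNReal.measurable_ofReal.comp (Measurable.pow_const (Measurable.sub ?_ ?_) 2)
    · exact (hpm n).ereal_toReal
    · exact (((continuous_bergmanDiag (p n)).measurable.comp measurable_snd).log).const_mul _
  have hfin : ∀ᵐ ω ∂P, ∀ n, n₀ ≤ n → ∀ᵐ z,
      potentialMap (p n) (fun j ν => a n j ν ω) z ≠ ⊤ ∧
        potentialMap (p n) (fun j ν => a n j ν ω) z ≠ ⊥ := by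
    rw [ae_all_iff]
    intro n
    by_cases hn : n₀ ≤ n
    -- Each point is almost surely not a zero; by Fubini, almost surely almost every point is not a
    -- zero.
    · have := (Measure.ae_ae_comm (μ := P) (ν := (volume : Measure (Cn m)))
        (p := fun ω z => potentialMap (p n) (fun j ν => a n j ν ω) z ≠ ⊤ ∧
          potentialMap (p n) (fun j ν => a n j ν ω) z ≠ ⊥)
        (((hpm n) (measurableSet_singleton ⊤).compl).inter
          ((hpm n) (measurableSet_singleton ⊥).compl))).2
        (Eventually.of_forall fun z => by
          filter_upwards [ha.ae_randomLength_ne_zero hk (p n) z (hS n hn z)] with ω hω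
          exact ⟨mul_elog_ne_top (hn₀ n hn).2 hω.le, mul_elog_ne_bot hω⟩)
      filter_upwards [this] with ω hω _ using hω
    · exact Eventually.of_forall fun ω hn' => absurd hn' hn
  have hsum : ∀ᵐ ω ∂P, ∀ R : ℕ,
      ∑' n, ∫⁻ z in Metric.closedBall (0 : Cn m) R, f (n + n₀) ω z ≠ ⊤ := by
    rw [ae_all_iff]
    intro R
    have hm1 : ∀ n, Measurable fun ω => ∫⁻ z in Metric.closedBall (0 : Cn m) R, f (n + n₀) ω z :=
      fun n => (hfm (n + n₀)).lintegral_prod_right'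
    have hle : ∫⁻ ω, ∑' n, (∫⁻ z in Metric.closedBall (0 : Cn m) R, f (n + n₀) ω z) ∂P ≠ ⊤ := by
      rw [lintegral_tsum fun n => (hm1 n).aemeasurable]
      have hn : ∀ n, ∫⁻ ω, (∫⁻ z in Metric.closedBall (0 : Cn m) R, f (n + n₀) ω z) ∂P ≤
          ENNReal.ofReal (D * (1 / ((n + n₀ : ℕ) : ℝ) ^ (3 / 2 : ℝ))) *
            volume (Metric.closedBall (0 : Cn m) R) := by
        intro n
        rw [lintegral_lintegral_swap (hfm (n + n₀)).aemeasurable, ← setLIntegral_const]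
        refine lintegral_mono fun z => ?_
        exact hmom (n + n₀) (hn₀ _ (Nat.le_add_left _ _)).2 (p (n + n₀)) z
          (hS _ (Nat.le_add_left _ _) z)
      refine ne_top_of_le_ne_top ?_ (ENNReal.tsum_le_tsum hn)
      rw [ENNReal.tsum_mul_right]
      exact ENNReal.mul_ne_top (tsum_rpow_ne_top D hD n₀)
        (isCompact_closedBall (0 : Cn m) (R : ℝ)).measure_lt_top.ne
    filter_upwards [ae_lt_top (Measurable.tsum fun n => hm1 n) hle] with ω hω
    exact hω.ne
  filter_upwards [hfin, hsum] with ω hω1 hω2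
  refine h.tendstoL1Loc_of_sq hτ p hp (fun n => potentialMap (p n) (fun j ν => a n j ν ω))
    (fun n => ?_) ?_ ?_ ?_
  · exact (continuous_potentialMap (p n) fun j ν => a n j ν ω).measurable
  · filter_upwards [eventually_ge_atTop n₀] with n hn using hω1 n hn
  · filter_upwards [eventually_ge_atTop n₀] with n hn R
    have h1 := ENNReal.ne_top_of_tsum_ne_top (hω2 R) (n - n₀)
    rw [Nat.sub_add_cancel hn] at h1
    exact h1
  · intro R
    have := ENNReal.tendsto_cofinite_zero_of_tsum_ne_top (hω2 R)
    rw [Nat.cofinite_eq_atTop] at this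
    exact (tendsto_add_atTop_iff_nat
      (f := fun n => ∫⁻ z in Metric.closedBall (0 : Cn m) R, f n ω z) n₀).1 this

/-- At a given point the potentials converge almost surely. -/
theorem ae_tendsto_potentialMap [IsProbabilityMeasure P] (h : IsWeightedSet Y Q)
    (hτ : IsWeightedMeasure Y Q τ) (hp : ∀ᶠ n in atTop, IsOrthonormalBasis Y Q τ n (p n))
    (hk : 0 < k)
    (ha : IsIIDAdmissible P fun i : (Σ n : ℕ, Fin k × MultiIndex m n) => a i.1 i.2.1 i.2.2)
    (z : Cn m) :
    ∀ᵐ ω ∂P, Tendsto (fun n => potentialMap (p n) (fun j ν => a n j ν ω) z) atTop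
      (𝓝 (extremalFunction Y Q z)) := by
  obtain ⟨n₀, hn₀⟩ := eventually_atTop.1 (hp.and (eventually_ge_atTop 1))
  obtain ⟨D, hD, hmom⟩ := ha.exists_lintegral_sq_le hk
  have hS : ∀ n, n₀ ≤ n → 0 < bergmanDiag (p n) z := fun n hn =>
    h.bergmanDiag_pos hτ (hn₀ n hn).2 (hn₀ n hn).1 z
  let g : ℕ → Ω → ℝ := fun n ω => (potentialMap (p n) (fun j ν => a n j ν ω) z).toReal -
      1 / (2 * (n : ℝ)) * Real.log (bergmanDiag (p n) z)
  have hgm : ∀ n, Measurable (g n) := fun n =>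
    (((measurable_potentialMap (p n) (ha.measurable_coeff n)).comp
      measurable_prodMk_right).ereal_toReal).sub_const _
  -- The moments see only `toReal`, which sends `⊥` to `0`; excluding zeros at `z` lets the limit be
  -- transferred back to `EReal`.
  have hfin : ∀ᵐ ω ∂P, ∀ n, n₀ ≤ n →
      0 < randomLength (fun j ν => a n j ν ω) fun ν => peval (p n ν) z := by
    rw [ae_all_iff]
    intro n
    by_cases hn : n₀ ≤ n
    · filter_upwards [ha.ae_randomLength_ne_zero hk (p n) z (hS n hn)] with ω hω _ using hω
    · exact Eventually.of_forall fun ω hn' => absurd hn' hn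
  have hm1 : ∀ n, Measurable fun ω => ENNReal.ofReal (g (n + n₀) ω ^ 2) := fun n =>
    ENNReal.measurable_ofReal.comp ((hgm _).pow_const 2)
  have hle : ∫⁻ ω, ∑' n, ENNReal.ofReal (g (n + n₀) ω ^ 2) ∂P ≠ ⊤ := by
    rw [lintegral_tsum fun n => (hm1 n).aemeasurable]
    exact ne_top_of_le_ne_top (tsum_rpow_ne_top D hD n₀) (ENNReal.tsum_le_tsum fun n =>
      hmom (n + n₀) (hn₀ _ (Nat.le_add_left _ _)).2 (p (n + n₀)) z (hS _ (Nat.le_add_left _ _)))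
  filter_upwards [hfin, ae_lt_top (Measurable.tsum fun n => hm1 n) hle] with ω hω1 hω2
  have h1 := ENNReal.tendsto_cofinite_zero_of_tsum_ne_top hω2.ne
  rw [Nat.cofinite_eq_atTop] at h1
  have h2 : Tendsto (fun n => ENNReal.ofReal (g n ω ^ 2)) atTop (𝓝 0) :=
    (tendsto_add_atTop_iff_nat (f := fun n => ENNReal.ofReal (g n ω ^ 2)) n₀).1 h1
  have h3 : Tendsto (fun n => g n ω ^ 2) atTop (𝓝 0) := by
    have := (ENNReal.tendsto_toReal ENNReal.zero_ne_top).comp h2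
    rw [ENNReal.toReal_zero] at this
    refine this.congr fun n => ?_
    exact ENNReal.toReal_ofReal (sq_nonneg _)
  have h4 : Tendsto (fun n => g n ω) atTop (𝓝 0) := by
    have := (Real.continuous_sqrt.tendsto 0).comp h3
    rw [Real.sqrt_zero] at this
    refine (tendsto_zero_iff_abs_tendsto_zero _).2 (this.congr fun n => ?_)
    exact Real.sqrt_sq_eq_abs _
  have h5 := h4.add (h.tendsto_log_bergmanDiag hτ p hp z)
  rw [zero_add] at h5
  rw [← h.coe_toReal_extremalFunction]
  have h6 := (continuous_coe_real_ereal.tendsto _).comp h5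
  refine h6.congr' ?_
  filter_upwards [eventually_ge_atTop n₀] with n hn
  simp only [Function.comp_apply, g, sub_add_cancel]
  exact EReal.coe_toReal (mul_elog_ne_top (hn₀ n hn).2 (hω1 n hn).le) (mul_elog_ne_bot (hω1 n hn))

/-- Almost surely, the upper limit of the potentials is nowhere larger than `V`. -/
theorem ae_limsup_potentialMap_le [IsProbabilityMeasure P] (h : IsWeightedSet Y Q)
    (hτ : IsWeightedMeasure Y Q τ) (hp : ∀ᶠ n in atTop, IsOrthonormalBasis Y Q τ n (p n))
    (hk : 0 < k)
    (ha : IsIIDAdmissible P fun i : (Σ n : ℕ, Fin k × MultiIndex m n) => a i.1 i.2.1 i.2.2) :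
    ∀ᵐ ω ∂P, ∀ z, limsup (fun n => potentialMap (p n) (fun j ν => a n j ν ω) z) atTop ≤
      extremalFunction Y Q z := by
  have hm := ha.measurable_coeff
  obtain ⟨-, -, μ, hμ, hlaw⟩ := ha
  obtain ⟨T, hT0, hT⟩ := hμ.exists_tail_le
  -- Borel–Cantelli with threshold factor `n + 1`, whose probabilities `T / (n + 1)²` are summable.
  -- These events do not involve `z`, so the resulting bound holds at all points at once.
  have hBC : ∑' n : ℕ, P {ω | ∃ j ν, ((n : ℝ) + 1) *
      Real.sqrt (k * Fintype.card (MultiIndex m (n + 1))) ≤ ‖a (n + 1) j ν ω‖} ≠ ⊤ := by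
    have hle : ∀ n : ℕ, P {ω | ∃ j ν, ((n : ℝ) + 1) *
        Real.sqrt (k * Fintype.card (MultiIndex m (n + 1))) ≤ ‖a (n + 1) j ν ω‖} ≤
        ENNReal.ofReal (T * (1 / ((n + 1 : ℕ) : ℝ) ^ 2)) := by
      intro n
      refine (measure_exists_norm_ge (hm _) (fun j ν => hlaw ⟨n + 1, j, ν⟩) hT (by positivity) hk
        (nonempty_multiIndex _ _)).trans (le_of_eq ?_)
      rw [mul_one_div]; push_cast; rfl
    refine ne_top_of_le_ne_top ?_ (ENNReal.tsum_le_tsum hle)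
    have h1 : Summable fun n : ℕ => T * (1 / (n : ℝ) ^ 2) :=
      (Real.summable_one_div_nat_pow.2 one_lt_two).mul_left T
    rw [← ENNReal.ofReal_tsum_of_nonneg (fun n => by positivity) ((summable_nat_add_iff 1).2 h1)]
    exact ENNReal.ofReal_ne_top
  filter_upwards [ae_eventually_notMem hBC] with ω hω z
  have hev : ∀ᶠ n : ℕ in atTop, ∀ j ν,
      ‖a n j ν ω‖ ≤ n * Real.sqrt (k * Fintype.card (MultiIndex m n)) := by
    obtain ⟨N, hN⟩ := eventually_atTop.1 hω
    filter_upwards [eventually_ge_atTop (N + 1)] with n hn j ν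
    obtain ⟨n, rfl⟩ : ∃ n', n = n' + 1 := ⟨n - 1, by omega⟩
    have := hN n (by omega)
    simp only [not_exists, not_le] at this
    push_cast
    exact (this j ν).le
  have hlim : Tendsto (fun n : ℕ => 1 / (2 * (n : ℝ)) * Real.log (bergmanDiag (p n) z) +
      (Real.log (n + 1) / n + (Real.log k / n + m * (Real.log (n + 1) / n)))) atTop
      (𝓝 ((extremalFunction Y Q z).toReal + (0 + (0 + m * 0)))) :=
    (h.tendsto_log_bergmanDiag hτ p hp z).add (tendsto_log_natCast_succ_div.add
      ((tendsto_const_div_atTop_nhds_zero_nat _).add (tendsto_log_natCast_succ_div.const_mul _)))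
  rw [mul_zero, add_zero, add_zero, add_zero] at hlim
  rw [← h.coe_toReal_extremalFunction, ← ((continuous_coe_real_ereal.tendsto _).comp hlim).limsup_eq]
  refine limsup_le_limsup ?_
  filter_upwards [hev, hp, eventually_ge_atTop 1] with n hn hpn hn1
  have hn0 : (0 : ℝ) < n := by exact_mod_cast hn1
  have hk0 : (0 : ℝ) < k := by exact_mod_cast hk
  have hS := h.bergmanDiag_pos hτ hn1 hpn z
  have hcard : (0 : ℝ) < Fintype.card (MultiIndex m n) := by
    have := nonempty_multiIndex m n
    exact_mod_cast Fintype.card_pos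
  have hcard' : (Fintype.card (MultiIndex m n) : ℝ) ≤ ((n : ℝ) + 1) ^ m := by
    exact_mod_cast card_multiIndex_le_pow m n
  have h1 := randomLength_le (fun j ν => a n j ν ω) (fun ν => peval (p n ν) z) (by positivity) hn
  rw [mul_assoc (n : ℝ), Real.mul_self_sqrt (by positivity)] at h1
  change _ ≤ (n : ℝ) * (k * Fintype.card (MultiIndex m n)) * Real.sqrt (bergmanDiag (p n) z) at h1
  rw [potentialMap_eq, Function.comp_apply, mul_elog_le_coe hn1 (randomLength_nonneg _ _)]
  refine h1.trans ?_
  have hsS : 0 < Real.sqrt (bergmanDiag (p n) z) := Real.sqrt_pos.2 hS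
  rw [← Real.log_le_iff_le_exp (by positivity), Real.log_mul (by positivity) hsS.ne',
    Real.log_mul hn0.ne' (by positivity), Real.log_mul hk0.ne' hcard.ne', Real.log_sqrt hS.le]
  have h2 := Real.log_le_log hcard hcard'
  rw [Real.log_pow] at h2
  have h3 : Real.log n ≤ Real.log (n + 1) := Real.log_le_log hn0 (by linarith)
  have h4 : (n : ℝ) * (1 / (2 * (n : ℝ)) * Real.log (bergmanDiag (p n) z) +
      (Real.log (n + 1) / n + (Real.log k / n + m * (Real.log (n + 1) / n)))) =
      Real.log (bergmanDiag (p n) z) / 2 + (Real.log (n + 1) + (Real.log k + m * Real.log (n + 1))) := by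
    field_simp
  rw [h4]
  linarith

/-- Pointwise convergence is available only for countably many points. A dense set suffices from
below since `V` is lower semicontinuous, and the bound from above holds everywhere. -/
theorem ae_uscReg_limsup_potentialMap [IsProbabilityMeasure P] (h : IsWeightedSet Y Q)
    (hτ : IsWeightedMeasure Y Q τ) (hp : ∀ᶠ n in atTop, IsOrthonormalBasis Y Q τ n (p n))
    (hk : 0 < k)
    (ha : IsIIDAdmissible P fun i : (Σ n : ℕ, Fin k × MultiIndex m n) => a i.1 i.2.1 i.2.2) :
    ∀ᵐ ω ∂P, ∀ z, uscReg (fun w =>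
      limsup (fun n => potentialMap (p n) (fun j ν => a n j ν ω) w) atTop) z =
        uscReg (extremalFunction Y Q) z := by
  obtain ⟨D, hDc, hD⟩ := TopologicalSpace.exists_countable_dense (Cn m)
  have hae : ∀ᵐ ω ∂P, ∀ z ∈ D, Tendsto (fun n => potentialMap (p n) (fun j ν => a n j ν ω) z) atTop
      (𝓝 (extremalFunction Y Q z)) :=
    (ae_ball_iff hDc).2 fun z _ => h.ae_tendsto_potentialMap hτ hp hk ha z
  filter_upwards [hae, h.ae_limsup_potentialMap_le hτ hp hk ha] with ω hω1 hω2 z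
  refine le_antisymm (uscReg_mono hω2 z) ?_
  exact uscReg_le_uscReg_of_dense (lowerSemicontinuous_extremalFunction Y Q) hD
    (fun w hw => (hω1 w hw).limsup_eq.ge) z

end IsWeightedSet

end Random

end Pluripotential

/-! ### Positivity of `dd^c` -/

namespace Pluripotential

variable {m : ℕ}

/-- Four times the complex Hessian of `f` in the direction `ξ`, that is, the Laplacian of
`λ ↦ f (z + λ ξ)` at `0`. -/
noncomputable def lineLaplacian (f : Cn m → ℝ) (ξ z : Cn m) : ℝ :=
  fderiv ℝ (fun y => fderiv ℝ f y ξ) z ξ +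
    fderiv ℝ (fun y => fderiv ℝ f y (Complex.I • ξ)) z (Complex.I • ξ)

/-- The part of a real bilinear form which is complex linear in the first and conjugate linear
in the second variable (up to the factor `4`). -/
noncomputable def sesqPart (B : Cn m →L[ℝ] Cn m →L[ℝ] ℂ) (v w : Cn m) : ℂ :=
  B v w + Complex.I * B v (Complex.I • w) - Complex.I * B (Complex.I • v) w +
    B (Complex.I • v) (Complex.I • w)

theorem complex_smul_eq (c : ℂ) (v : Cn m) : c • v = c.re • v + c.im • (Complex.I • v) := by
  conv_lhs => rw [← Complex.re_add_im c, add_smul, mul_smul]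
  rfl

theorem I_smul_complex_smul (c : ℂ) (v : Cn m) :
    Complex.I • c • v = c.re • (Complex.I • v) + (-c.im) • v := by
  rw [smul_smul, complex_smul_eq, add_comm]; simp

theorem sesqPart_smul_left (B : Cn m →L[ℝ] Cn m →L[ℝ] ℂ) (c : ℂ) (v w : Cn m) :
    sesqPart B (c • v) w = c * sesqPart B v w := by
  have hI : Complex.I * Complex.I = -1 := Complex.I_mul_I
  unfold sesqPart
  rw [I_smul_complex_smul, complex_smul_eq c v]
  simp only [map_add, map_smul, add_apply, smul_apply,
    Complex.real_smul]
  conv_rhs => rw [← Complex.re_add_im c]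
  push_cast
  linear_combination (-(c.im : ℂ) * B v (Complex.I • w) + c.im * B (Complex.I • v) w) * hI

theorem sesqPart_smul_right (B : Cn m →L[ℝ] Cn m →L[ℝ] ℂ) (c : ℂ) (v w : Cn m) :
    sesqPart B v (c • w) = conj c * sesqPart B v w := by
  have hI : Complex.I * Complex.I = -1 := Complex.I_mul_I
  have hc : conj c = c.re - c.im * Complex.I := by
    apply Complex.ext <;> simp
  unfold sesqPart
  rw [I_smul_complex_smul, complex_smul_eq c w, hc]
  simp only [map_add, map_smul, Complex.real_smul]
  push_cast
  linear_combination ((c.im : ℂ) * B v (Complex.I • w) - c.im * B (Complex.I • v) w) * hI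

theorem sesqPart_sum_left (B : Cn m →L[ℝ] Cn m →L[ℝ] ℂ) {ι : Type*} (s : Finset ι)
    (f : ι → Cn m) (w : Cn m) : sesqPart B (∑ i ∈ s, f i) w = ∑ i ∈ s, sesqPart B (f i) w := by
  simp only [sesqPart, Finset.smul_sum, map_sum, sum_apply,
    Finset.sum_add_distrib, Finset.sum_sub_distrib, Finset.mul_sum]

theorem sesqPart_sum_right (B : Cn m →L[ℝ] Cn m →L[ℝ] ℂ) {ι : Type*} (s : Finset ι)
    (f : ι → Cn m) (v : Cn m) : sesqPart B v (∑ i ∈ s, f i) = ∑ i ∈ s, sesqPart B v (f i) := by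
  simp only [sesqPart, Finset.smul_sum, map_sum,
    Finset.sum_add_distrib, Finset.sum_sub_distrib, Finset.mul_sum]

theorem sesqPart_self {B : Cn m →L[ℝ] Cn m →L[ℝ] ℂ} (hB : ∀ v w, B v w = B w v) (ξ : Cn m) :
    sesqPart B ξ ξ = B ξ ξ + B (Complex.I • ξ) (Complex.I • ξ) := by
  unfold sesqPart
  rw [hB ξ (Complex.I • ξ)]; ring

theorem fderiv_fderiv_apply {F : Type*} [NormedAddCommGroup F] [NormedSpace ℝ F] {f : Cn m → F}
    (hf : ContDiff ℝ 2 f) (z v w : Cn m) :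
    fderiv ℝ (fun y => fderiv ℝ f y w) z v = fderiv ℝ (fderiv ℝ f) z v w := by
  have h : DifferentiableAt ℝ (fderiv ℝ f) z :=
    (hf.fderiv_right (m := 1) (by norm_num)).differentiable (by norm_num) z
  rw [fderiv_clm_apply h (differentiableAt_const w)]
  simp

theorem contDiff_fderiv_apply {F : Type*} [NormedAddCommGroup F] [NormedSpace ℝ F] {f : Cn m → F}
    (hf : ContDiff ℝ 2 f) (w : Cn m) : ContDiff ℝ 1 fun y => fderiv ℝ f y w :=
  (hf.fderiv_right (m := 1) (by norm_num)).clm_apply contDiff_const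

theorem contDiff_dzbar {f : Cn m → ℂ} (hf : ContDiff ℝ 2 f) (k : Fin m) :
    ContDiff ℝ 1 (dzbar k f) :=
  ((contDiff_fderiv_apply hf _).add (contDiff_const.mul (contDiff_fderiv_apply hf _))).div_const 2

/-- The expansion of `(∂_x - i ∂_y)(∂_x + i ∂_y) / 4`, expressed through the second derivative. -/
theorem dz_dzbar {f : Cn m → ℂ} (hf : ContDiff ℝ 2 f) (j k : Fin m) (z : Cn m) :
    dz j (dzbar k f) z = sesqPart (fderiv ℝ (fderiv ℝ f) z) (stdVec j) (stdVec k) / 4 := by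
  have hd : ∀ v, fderiv ℝ (dzbar k f) z v = (fderiv ℝ (fderiv ℝ f) z v (stdVec k) +
      Complex.I * fderiv ℝ (fderiv ℝ f) z v (Complex.I • stdVec k)) / 2 := by
    intro v
    have h1 : ∀ w, HasFDerivAt (fun y => fderiv ℝ f y w)
        (fderiv ℝ (fun y => fderiv ℝ f y w) z) z := fun w =>
      ((contDiff_fderiv_apply hf w).differentiable (by norm_num) z).hasFDerivAt
    have h2 := ((h1 (stdVec k)).add ((h1 (Complex.I • stdVec k)).const_mul Complex.I)).mul_const
      (2 : ℂ)⁻¹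
    have h3 : HasFDerivAt (dzbar k f) _ z := h2
    rw [h3.fderiv, ← fderiv_fderiv_apply hf, ← fderiv_fderiv_apply hf]
    simp [div_eq_mul_inv]
    ring
  unfold dz sesqPart
  rw [hd, hd]
  linear_combination (-(1 / 4 : ℂ) * fderiv ℝ (fderiv ℝ f) z (Complex.I • stdVec j)
    (Complex.I • stdVec k)) * Complex.I_mul_I

/-- Sesquilinearity collapses the double sum to the diagonal value at `∑ ξ_j e_j`, and symmetry of
the second derivative cancels the mixed terms there. -/
theorem sum_dz_dzbar {χ : Cn m → ℝ} (hχ : ContDiff ℝ 2 χ) (ξ : Fin m → ℂ) (z : Cn m) :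
    ∑ j, ∑ k, dz j (dzbar k fun y => ξ j * conj (ξ k) * (χ y : ℂ)) z =
      ((1 / 4 * lineLaplacian χ (∑ j, ξ j • stdVec j) z : ℝ) : ℂ) := by
  set X : Cn m → ℂ := fun y => (χ y : ℂ) with hX
  have hXc : ContDiff ℝ 2 X := Complex.ofRealCLM.contDiff.comp hχ
  have h1 : ∀ j k, dz j (dzbar k fun y => ξ j * conj (ξ k) * (χ y : ℂ)) z =
      ξ j * conj (ξ k) * (sesqPart (fderiv ℝ (fderiv ℝ X) z) (stdVec j) (stdVec k) / 4) := by
    intro j k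
    rw [← dz_dzbar hXc]
    have hb : dzbar k (fun y => ξ j * conj (ξ k) * (χ y : ℂ)) =
        fun y => ξ j * conj (ξ k) * dzbar k X y := by
      funext y
      unfold dzbar
      rw [fderiv_const_mul (hXc.differentiable (by norm_num) y)]
      simp [hX]; ring
    rw [hb]
    unfold dz
    rw [fderiv_const_mul ((contDiff_dzbar hXc k).differentiable (by norm_num) z)]
    simp; ring
  have h2 : ∀ w, (fun y => fderiv ℝ X y w) = fun y => ((fderiv ℝ χ y w : ℝ) : ℂ) := by
    intro w; funext y
    have := (Complex.ofRealCLM.hasFDerivAt (x := χ y)).comp y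
      (hχ.differentiable (by norm_num) y).hasFDerivAt
    rw [show X = Complex.ofRealCLM ∘ χ from rfl, this.fderiv]; rfl
  have h3 : ∀ v, fderiv ℝ (fderiv ℝ X) z v v =
      ((fderiv ℝ (fun y => fderiv ℝ χ y v) z v : ℝ) : ℂ) := by
    intro v
    rw [← fderiv_fderiv_apply hXc, h2]
    have := (Complex.ofRealCLM.hasFDerivAt (x := fderiv ℝ χ z v)).comp z
      ((contDiff_fderiv_apply hχ v).differentiable (by norm_num) z).hasFDerivAt
    rw [show (fun y => ((fderiv ℝ χ y v : ℝ) : ℂ)) = Complex.ofRealCLM ∘ fun y => fderiv ℝ χ y v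
      from rfl, this.fderiv]; rfl
  have hsymm : ∀ v w, fderiv ℝ (fderiv ℝ X) z v w = fderiv ℝ (fderiv ℝ X) z w v :=
    hXc.contDiffAt.isSymmSndFDerivAt (by simp)
  have h4 := sesqPart_self hsymm (∑ j, ξ j • stdVec j)
  rw [sesqPart_sum_left] at h4
  simp only [sesqPart_sum_right, sesqPart_smul_left, sesqPart_smul_right] at h4
  rw [h3, h3] at h4
  simp only [h1]
  unfold lineLaplacian
  push_cast
  rw [← h4, Finset.mul_sum]
  refine Finset.sum_congr rfl fun j _ => ?_
  rw [Finset.mul_sum]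
  refine Finset.sum_congr rfl fun k _ => ?_
  ring

end Pluripotential

namespace Pluripotential

/-! ### The regularized potentials `log (‖F‖² + ε)` -/

variable {m : ℕ}

theorem contDiff_peval (p : MvPolynomial (Fin m) ℂ) : ContDiff ℝ 2 (peval p) := by
  induction p using MvPolynomial.induction_on with
  | C a =>
    have : peval (MvPolynomial.C a : MvPolynomial (Fin m) ℂ) = fun _ => a := by
      funext z; simp [peval]
    rw [this]; exact contDiff_const
  | add p q hp hq =>
    have : peval (p + q) = fun z => peval p z + peval q z := by funext z; simp [peval]
    rw [this]; exact hp.add hq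
  | mul_X p i hp =>
    have : peval (p * MvPolynomial.X i) = fun z => peval p z * z i := by funext z; simp [peval]
    rw [this]; exact hp.mul (by fun_prop)

/-- `log (‖F‖² + ε)` for a polynomial mapping `F`. -/
noncomputable def logNormSqAdd {k : ℕ} (F : Fin k → MvPolynomial (Fin m) ℂ) (ε : ℝ) (z : Cn m) :
    ℝ :=
  Real.log (∑ j, ‖peval (F j) z‖ ^ 2 + ε)

theorem contDiff_logNormSqAdd {k : ℕ} (F : Fin k → MvPolynomial (Fin m) ℂ) {ε : ℝ} (hε : 0 < ε) :
    ContDiff ℝ 2 (logNormSqAdd F ε) := by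
  refine ContDiff.log ?_ fun z => ?_
  · exact (ContDiff.sum fun j _ => (contDiff_peval (F j)).norm_sq ℝ).add contDiff_const
  · exact (add_pos_of_nonneg_of_pos (Finset.sum_nonneg fun j _ => by positivity) hε).ne'

/-- Second derivative of a `C²` function along a real line. -/
theorem fderiv_fderiv_eq_of_hasDerivAt {f : Cn m → ℝ} (hf : ContDiff ℝ 2 f) {z v : Cn m}
    {g : ℝ → ℝ} {g' : ℝ} (hg : ∀ t : ℝ, HasDerivAt (fun s : ℝ => f (z + s • v)) (g t) t)
    (hg' : HasDerivAt g g' 0) : fderiv ℝ (fun y => fderiv ℝ f y v) z v = g' := by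
  have hline : ∀ t : ℝ, HasDerivAt (fun s : ℝ => z + s • v) v t := fun t => by
    simpa using ((hasDerivAt_id t).smul_const v).const_add z
  have hcomp : ∀ {h : Cn m → ℝ}, Differentiable ℝ h → ∀ t : ℝ,
      HasDerivAt (fun s : ℝ => h (z + s • v)) (fderiv ℝ h (z + t • v) v) t := fun hh t =>
    (hh (z + t • v)).hasFDerivAt.comp_hasDerivAt t (hline t)
  have h1 : g = fun t : ℝ => fderiv ℝ f (z + t • v) v := by
    funext t
    exact (hg t).unique (hcomp (hf.differentiable (by norm_num)) t)
  have h2 := hcomp ((contDiff_fderiv_apply hf v).differentiable (by norm_num)) 0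
  rw [zero_smul, add_zero, ← h1] at h2
  exact h2.unique hg'

/-- First and second derivatives of `log (∑ |P_j|² + ε)` along the real line in direction `w`. -/
theorem hasDerivAt_log_sum_norm_sq {k : ℕ} (q : Fin k → Polynomial ℂ) {ε : ℝ} (hε : 0 < ε)
    (w : ℂ) (t : ℝ) :
    HasDerivAt (fun s : ℝ => Real.log (∑ j, ‖(q j).eval (s * w)‖ ^ 2 + ε))
      ((∑ j, 2 * inner ℝ ((q j).eval (t * w)) (w * (q j).derivative.eval (t * w))) /
        (∑ j, ‖(q j).eval (t * w)‖ ^ 2 + ε)) t ∧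
    HasDerivAt (fun s : ℝ => (∑ j, 2 * inner ℝ ((q j).eval (s * w))
        (w * (q j).derivative.eval (s * w))) / (∑ j, ‖(q j).eval (s * w)‖ ^ 2 + ε))
      (((∑ j, 2 * (inner ℝ ((q j).eval (t * w)) (w * (w * (q j).derivative.derivative.eval (t * w)))
          + ‖w * (q j).derivative.eval (t * w)‖ ^ 2)) * (∑ j, ‖(q j).eval (t * w)‖ ^ 2 + ε) -
        (∑ j, 2 * inner ℝ ((q j).eval (t * w)) (w * (q j).derivative.eval (t * w))) ^ 2) /
        (∑ j, ‖(q j).eval (t * w)‖ ^ 2 + ε) ^ 2) t := by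
  have hpos : ∀ s : ℝ, 0 < ∑ j, ‖(q j).eval (s * w)‖ ^ 2 + ε := fun s =>
    add_pos_of_nonneg_of_pos (Finset.sum_nonneg fun j _ => by positivity) hε
  have hq : ∀ (r : Polynomial ℂ), HasDerivAt (fun s : ℝ => r.eval (s * w))
      (w * r.derivative.eval (t * w)) t := by
    intro r
    have h1 : HasDerivAt (fun s : ℝ => (s : ℂ) * w) w t := by
      simpa using (Complex.ofRealCLM.hasDerivAt (x := t)).mul_const w
    have := (r.hasDerivAt ((t : ℂ) * w)).comp t h1
    rwa [mul_comm] at this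
  have hS : HasDerivAt (fun s : ℝ => ∑ j, ‖(q j).eval (s * w)‖ ^ 2 + ε)
      (∑ j, 2 * inner ℝ ((q j).eval (t * w)) (w * (q j).derivative.eval (t * w))) t :=
    (HasDerivAt.fun_sum fun j _ => (hq (q j)).norm_sq).add_const ε
  refine ⟨hS.log (hpos t).ne', ?_⟩
  have hN : HasDerivAt (fun s : ℝ => ∑ j, 2 * inner ℝ ((q j).eval (s * w))
      (w * (q j).derivative.eval (s * w)))
      (∑ j, 2 * (inner ℝ ((q j).eval (t * w)) (w * (w * (q j).derivative.derivative.eval (t * w)))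
          + ‖w * (q j).derivative.eval (t * w)‖ ^ 2)) t := by
    refine HasDerivAt.fun_sum fun j _ => ?_
    have := ((hq (q j)).inner ℝ ((hq (q j).derivative).const_mul w)).const_mul (2 : ℝ)
    rwa [real_inner_self_eq_norm_sq] at this
  have := hN.div hS (hpos t).ne'
  rwa [← sq] at this

/-- On the line, let `f` and `g` be the values and first derivatives at `0`. The terms with second
derivatives cancel between the directions `1` and `i`, leaving `4 (S ‖g‖² - |⟨f, g⟩|²) / S²` with `S
= ‖f‖² + ε`; this is nonnegative by Cauchy–Schwarz. -/
theorem lineLaplacian_logNormSqAdd_nonneg {k : ℕ} (F : Fin k → MvPolynomial (Fin m) ℂ) {ε : ℝ}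
    (hε : 0 < ε) (ξ z : Cn m) : 0 ≤ lineLaplacian (logNormSqAdd F ε) ξ z := by
  set q : Fin k → Polynomial ℂ := fun j => lineRestrict (F j) z ξ with hq
  have hval : ∀ w : ℂ, (fun s : ℝ => logNormSqAdd F ε (z + s • (w • ξ))) =
      fun s : ℝ => Real.log (∑ j, ‖(q j).eval (s * w)‖ ^ 2 + ε) := by
    intro w; funext s
    simp only [hq, eval_lineRestrict, logNormSqAdd, mul_smul]
    rfl
  have key : ∀ w : ℂ, _ := fun w => fderiv_fderiv_eq_of_hasDerivAt (contDiff_logNormSqAdd F hε)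
    (z := z) (v := w • ξ) (fun t => by
      rw [hval]; exact (hasDerivAt_log_sum_norm_sq q hε w t).1)
    (hasDerivAt_log_sum_norm_sq q hε w 0).2
  have k1 := key 1
  have k2 := key Complex.I
  rw [one_smul] at k1
  unfold lineLaplacian
  rw [k1, k2]
  simp only [Complex.ofReal_zero, zero_mul]
  set f : Fin k → ℂ := fun j => (q j).eval 0
  set g : Fin k → ℂ := fun j => (q j).derivative.eval 0
  set h : Fin k → ℂ := fun j => (q j).derivative.derivative.eval 0
  change 0 ≤ ((∑ j, 2 * (inner ℝ (f j) (1 * (1 * h j)) + ‖1 * g j‖ ^ 2)) * (∑ j, ‖f j‖ ^ 2 + ε) -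
    (∑ j, 2 * inner ℝ (f j) (1 * g j)) ^ 2) / (∑ j, ‖f j‖ ^ 2 + ε) ^ 2 +
    ((∑ j, 2 * (inner ℝ (f j) (Complex.I * (Complex.I * h j)) + ‖Complex.I * g j‖ ^ 2)) *
      (∑ j, ‖f j‖ ^ 2 + ε) - (∑ j, 2 * inner ℝ (f j) (Complex.I * g j)) ^ 2) /
      (∑ j, ‖f j‖ ^ 2 + ε) ^ 2
  set S := ∑ j, ‖f j‖ ^ 2 + ε with hS
  have hS0 : 0 ≤ ∑ j, ‖f j‖ ^ 2 := Finset.sum_nonneg fun j _ => by positivity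
  set G := ∑ j, ‖g j‖ ^ 2 with hG
  have hG0 : 0 ≤ G := Finset.sum_nonneg fun j _ => by positivity
  set A : ℂ := ∑ j, conj (f j) * g j with hA
  have hA1 : ∑ j, 2 * inner ℝ (f j) (1 * g j) = 2 * A.re := by
    rw [hA, Complex.re_sum, Finset.mul_sum]
    refine Finset.sum_congr rfl fun j _ => ?_
    rw [one_mul, Complex.inner, mul_comm (g j)]
  have hA2 : ∑ j, 2 * inner ℝ (f j) (Complex.I * g j) = -(2 * A.im) := by
    rw [hA, Complex.im_sum, Finset.mul_sum, ← Finset.sum_neg_distrib]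
    refine Finset.sum_congr rfl fun j _ => ?_
    rw [Complex.inner, mul_assoc, Complex.I_mul_re, mul_comm (g j)]; ring
  have hH : ∑ j, 2 * (inner ℝ (f j) (1 * (1 * h j)) + ‖1 * g j‖ ^ 2) +
      ∑ j, 2 * (inner ℝ (f j) (Complex.I * (Complex.I * h j)) + ‖Complex.I * g j‖ ^ 2) = 4 * G := by
    rw [← Finset.sum_add_distrib, hG, Finset.mul_sum]
    refine Finset.sum_congr rfl fun j _ => ?_
    rw [← mul_assoc Complex.I, Complex.I_mul_I, neg_one_mul, inner_neg_right,
      norm_mul Complex.I, Complex.norm_I, one_mul, one_mul, one_mul, one_mul]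
    ring
  have hCS : A.re ^ 2 + A.im ^ 2 ≤ (∑ j, ‖f j‖ ^ 2) * G := by
    have h1 : A.re ^ 2 + A.im ^ 2 = ‖A‖ ^ 2 := by
      rw [← Complex.normSq_eq_norm_sq, Complex.normSq_apply]; ring
    have h2 : ‖A‖ ≤ ∑ j, ‖f j‖ * ‖g j‖ := by
      refine (norm_sum_le _ _).trans (le_of_eq (Finset.sum_congr rfl fun j _ => ?_))
      rw [norm_mul, RCLike.norm_conj]
    rw [h1]
    exact (pow_le_pow_left₀ (norm_nonneg _) h2 2).trans (Finset.sum_mul_sq_le_sq_mul_sq _ _ _)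
  rw [hA1, hA2, ← add_div]
  refine div_nonneg ?_ (sq_nonneg _)
  have : (∑ j, ‖f j‖ ^ 2) * G ≤ S * G := by
    rw [hS]; nlinarith
  nlinarith [congrArg (· * S) hH]

theorem continuous_lineLaplacian {f : Cn m → ℝ} (hf : ContDiff ℝ 2 f) (ξ : Cn m) :
    Continuous (lineLaplacian f ξ) :=
  (((contDiff_fderiv_apply hf ξ).continuous_fderiv (by norm_num)).clm_apply
    continuous_const).add (((contDiff_fderiv_apply hf _).continuous_fderiv (by norm_num)).clm_apply
    continuous_const)

theorem hasCompactSupport_lineLaplacian {f : Cn m → ℝ} (hf : HasCompactSupport f) (ξ : Cn m) :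
    HasCompactSupport (lineLaplacian f ξ) :=
  HasCompactSupport.add ((hf.fderiv_apply ℝ ξ).fderiv_apply ℝ ξ)
    ((hf.fderiv_apply ℝ _).fderiv_apply ℝ _)

theorem integral_mul_fderiv_fderiv {u χ : Cn m → ℝ} (hu : ContDiff ℝ 2 u) (hχ : ContDiff ℝ 2 χ)
    (hc : HasCompactSupport χ) (v : Cn m) :
    ∫ z, u z * fderiv ℝ (fun y => fderiv ℝ χ y v) z v =
      ∫ z, fderiv ℝ (fun y => fderiv ℝ u y v) z v * χ z := by
  have hu1 := contDiff_fderiv_apply hu v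
  have hχ1 := contDiff_fderiv_apply hχ v
  have hc1 : HasCompactSupport fun y => fderiv ℝ χ y v := hc.fderiv_apply ℝ v
  have hu2 : Continuous fun z => fderiv ℝ (fun y => fderiv ℝ u y v) z v :=
    (hu1.continuous_fderiv (by norm_num)).clm_apply continuous_const
  have hχ2 : Continuous fun z => fderiv ℝ (fun y => fderiv ℝ χ y v) z v :=
    (hχ1.continuous_fderiv (by norm_num)).clm_apply continuous_const
  have hc2 : HasCompactSupport fun z => fderiv ℝ (fun y => fderiv ℝ χ y v) z v :=
    hc1.fderiv_apply ℝ v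
  have hint : ∀ {f g : Cn m → ℝ}, Continuous f → Continuous g → HasCompactSupport g →
      Integrable fun z => f z * g z := fun hf hg hgc =>
    (hf.mul hg).integrable_of_hasCompactSupport hgc.mul_left
  rw [integral_mul_fderiv_eq_neg_fderiv_mul_of_integrable
      (hint hu1.continuous hχ1.continuous hc1) (hint hu.continuous hχ2 hc2)
      (hint hu.continuous hχ1.continuous hc1)
      (fun x _ => hu.differentiable (by norm_num) x) (fun x _ => hχ1.differentiable (by norm_num) x),
    integral_mul_fderiv_eq_neg_fderiv_mul_of_integrable
      (hint hu2 hχ.continuous hc) (hint hu1.continuous hχ1.continuous hc1)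
      (hint hu1.continuous hχ.continuous hc)
      (fun x _ => hu1.differentiable (by norm_num) x) (fun x _ => hχ.differentiable (by norm_num) x),
    neg_neg]

theorem integral_mul_lineLaplacian_nonneg {u χ : Cn m → ℝ} (hu : ContDiff ℝ 2 u)
    (hχ : ContDiff ℝ 2 χ) (hc : HasCompactSupport χ) (h0 : ∀ z, 0 ≤ χ z) (ξ : Cn m)
    (hL : ∀ z, 0 ≤ lineLaplacian u ξ z) : 0 ≤ ∫ z, u z * lineLaplacian χ ξ z := by
  have hint : ∀ v, Integrable fun z => u z * fderiv ℝ (fun y => fderiv ℝ χ y v) z v := fun v =>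
    (hu.continuous.mul (((contDiff_fderiv_apply hχ v).continuous_fderiv (by norm_num)).clm_apply
      continuous_const)).integrable_of_hasCompactSupport
      ((hc.fderiv_apply ℝ v).fderiv_apply ℝ v).mul_left
  have hint' : ∀ v, Integrable fun z => fderiv ℝ (fun y => fderiv ℝ u y v) z v * χ z := fun v =>
    ((((contDiff_fderiv_apply hu v).continuous_fderiv (by norm_num)).clm_apply
      continuous_const).mul hχ.continuous).integrable_of_hasCompactSupport hc.mul_left
  have h1 : ∫ z, u z * lineLaplacian χ ξ z = ∫ z, lineLaplacian u ξ z * χ z := by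
    simp only [lineLaplacian, mul_add, add_mul]
    rw [integral_add (hint _) (hint _), integral_add (hint' _) (hint' _),
      integral_mul_fderiv_fderiv hu hχ hc, integral_mul_fderiv_fderiv hu hχ hc]
  rw [h1]
  exact integral_nonneg fun z => mul_nonneg (hL z) (h0 z)

/-- A majorant uniform in `ε ≤ 1`, integrable against test functions whenever `log x` is. -/
theorem abs_log_add_le {x ε : ℝ} (hx : 0 < x) (hε : 0 < ε) (hε1 : ε ≤ 1) :
    |Real.log (x + ε)| ≤ |Real.log x| + Real.log (x + 1) := by
  have h1 : Real.log x ≤ Real.log (x + ε) := Real.log_le_log hx (by linarith)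
  have h2 : Real.log (x + ε) ≤ Real.log (x + 1) := Real.log_le_log (by linarith) (by linarith)
  have h3 : 0 ≤ Real.log (x + 1) := Real.log_nonneg (by linarith)
  rw [abs_le]
  exact ⟨by linarith [neg_abs_le (Real.log x)], by linarith [abs_nonneg (Real.log x)]⟩

/-- Potentials of polynomial mappings have nonnegative distributional line Laplacians. -/
theorem integral_log_sum_mul_lineLaplacian_nonneg {k : ℕ} (F : Fin k → MvPolynomial (Fin m) ℂ)
    (hpos : ∀ᵐ z : Cn m, 0 < ∑ j, ‖peval (F j) z‖ ^ 2)
    (hint : LocallyIntegrable fun z : Cn m => Real.log (∑ j, ‖peval (F j) z‖ ^ 2))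
    {χ : Cn m → ℝ} (hχ : ContDiff ℝ 2 χ) (hc : HasCompactSupport χ) (h0 : ∀ z, 0 ≤ χ z)
    (ξ : Cn m) :
    0 ≤ ∫ z, Real.log (∑ j, ‖peval (F j) z‖ ^ 2) * lineLaplacian χ ξ z := by
  have hLc := continuous_lineLaplacian hχ ξ
  have hLs := hasCompactSupport_lineLaplacian hc ξ
  have hcont : ∀ ε : ℝ, 0 < ε → Continuous (logNormSqAdd F ε) := fun ε hε =>
    (contDiff_logNormSqAdd F hε).continuous
  have hb : Integrable fun z => (|Real.log (∑ j, ‖peval (F j) z‖ ^ 2)| + logNormSqAdd F 1 z) *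
      |lineLaplacian χ ξ z| := by
    have h1 := (hint.integrable_smul_right_of_hasCompactSupport hLc hLs).abs
    have h2 := (((hcont 1 one_pos).mul hLc.abs).integrable_of_hasCompactSupport
      (μ := volume) hLs.abs.mul_left)
    refine (h1.add h2).congr (Eventually.of_forall fun z => ?_)
    simp only [Pi.add_apply, Pi.mul_apply, smul_eq_mul, abs_mul, add_mul]
  have hseq : ∀ l : ℕ, (0 : ℝ) < 1 / ((l : ℝ) + 1) ∧ 1 / ((l : ℝ) + 1) ≤ 1 := fun l =>
    ⟨by positivity, by rw [div_le_one (by positivity)]; linarith [(Nat.cast_nonneg l : (0 : ℝ) ≤ l)]⟩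
  have hlim := tendsto_integral_of_dominated_convergence
    (F := fun (l : ℕ) z => logNormSqAdd F (1 / ((l : ℝ) + 1)) z * lineLaplacian χ ξ z)
    (f := fun z => Real.log (∑ j, ‖peval (F j) z‖ ^ 2) * lineLaplacian χ ξ z) _
    (fun l => ((hcont _ (hseq l).1).mul hLc).aestronglyMeasurable) hb
    (fun l => by
      filter_upwards [hpos] with z hz
      rw [norm_mul]
      exact mul_le_mul_of_nonneg_right (abs_log_add_le hz (hseq l).1 (hseq l).2) (norm_nonneg _))
    (by
      filter_upwards [hpos] with z hz
      refine Tendsto.mul_const _ ?_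
      have h1 : Tendsto (fun l : ℕ => ∑ j, ‖peval (F j) z‖ ^ 2 + 1 / ((l : ℝ) + 1)) atTop
          (𝓝 (∑ j, ‖peval (F j) z‖ ^ 2 + 0)) :=
        tendsto_const_nhds.add tendsto_one_div_add_atTop_nhds_zero_nat
      rw [add_zero] at h1
      exact h1.log hz.ne')
  refine ge_of_tendsto' hlim fun l => ?_
  exact integral_mul_lineLaplacian_nonneg (contDiff_logNormSqAdd F (hseq l).1) hχ hc h0 ξ
    fun z => lineLaplacian_logNormSqAdd_nonneg F (hseq l).1 ξ z

theorem IsTestFunction.contDiff_re {χ : Cn m → ℝ} (h : IsTestFunction fun z => (χ z : ℂ)) :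
    ContDiff ℝ 2 χ :=
  Complex.reCLM.contDiff.comp (h.1.of_le (WithTop.coe_le_coe.2 (le_top : (2 : ℕ∞) ≤ ⊤)))

theorem IsTestFunction.hasCompactSupport_re {χ : Cn m → ℝ}
    (h : IsTestFunction fun z => (χ z : ℂ)) : HasCompactSupport χ :=
  h.2.comp_left (g := Complex.re) Complex.zero_re

theorem ddcPairing_eq (u : Cn m → EReal) {χ : Cn m → ℝ} (hχ : ContDiff ℝ 2 χ) (ξ : Fin m → ℂ) :
    ddcPairing u (fun j k z => ξ j * conj (ξ k) * (χ z : ℂ)) =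
      ((1 / (2 * Real.pi) * ∫ z, (u z).toReal * lineLaplacian χ (∑ j, ξ j • stdVec j) z : ℝ) : ℂ) := by
  unfold ddcPairing
  simp only [sum_dz_dzbar hχ]
  have : ∀ z : Cn m, ((u z).toReal : ℂ) *
      ((1 / 4 * lineLaplacian χ (∑ j, ξ j • stdVec j) z : ℝ) : ℂ) =
      ((1 / 4 * ((u z).toReal * lineLaplacian χ (∑ j, ξ j • stdVec j) z) : ℝ) : ℂ) := by
    intro z; push_cast; ring
  simp only [this]
  rw [integral_complex_ofReal, integral_const_mul]
  push_cast
  ring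

theorem isPositiveDdc_potentialMap {n k : ℕ} (hn : 1 ≤ n)
    (p : MultiIndex m n → MvPolynomial (Fin m) ℂ) (c : Fin k → MultiIndex m n → ℂ)
    (h : IsL1Loc (potentialMap p c)) : IsPositiveDdc (potentialMap p c) := by
  refine ⟨h, fun ξ χ hχ h0 => ?_⟩
  have hn0 : (0 : ℝ) < n := by exact_mod_cast hn
  obtain ⟨hfin, hint⟩ := h
  -- With the random coefficients frozen, the potential is `1 / (2 n)` times the logarithm of a sum
  -- of squared moduli of polynomials.
  set F : Fin k → MvPolynomial (Fin m) ℂ := fun j => ∑ ν, MvPolynomial.C (c j ν) * p ν with hF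
  have hFc : ∀ j z, peval (F j) z = combination p (c j) z := fun j z => by
    simp [hF, peval, combination]
  have hval : ∀ z, (potentialMap p c z).toReal =
      1 / (2 * (n : ℝ)) * Real.log (∑ j, ‖peval (F j) z‖ ^ 2) := by
    intro z
    unfold potentialMap
    rw [toReal_mul_elog hn (Real.sqrt_nonneg _), Real.log_sqrt (by positivity)]
    simp only [hFc]
    field_simp
  have hpos : ∀ᵐ z : Cn m, 0 < ∑ j, ‖peval (F j) z‖ ^ 2 := by
    filter_upwards [hfin] with z hz
    refine (Finset.sum_nonneg fun j _ => by positivity).lt_of_ne fun h' => hz.2 ?_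
    unfold potentialMap
    simp only [← hFc]
    rw [← h', Real.sqrt_zero, elog_zero, EReal.coe_mul_bot_of_pos (by positivity)]
  simp only [hval] at hint
  have hint' : LocallyIntegrable fun z : Cn m => Real.log (∑ j, ‖peval (F j) z‖ ^ 2) := by
    have := hint.smul (2 * (n : ℝ))
    refine this.congr (Eventually.of_forall fun z => ?_)
    simp only [Pi.smul_apply, smul_eq_mul]
    field_simp
  rw [ddcPairing_eq _ hχ.contDiff_re]
  refine ⟨?_, Complex.ofReal_im _⟩
  rw [Complex.ofReal_re]
  simp only [hval, mul_assoc]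
  rw [integral_const_mul]
  have := integral_log_sum_mul_lineLaplacian_nonneg F hpos hint' hχ.contDiff_re
    hχ.hasCompactSupport_re h0 (∑ j, ξ j • stdVec j)
  positivity

/-! ### Convergence of the currents -/

theorem continuous_sum_dz_dzbar {χ : Fin m → Fin m → Cn m → ℂ} (hχ : ∀ j k, IsTestFunction (χ j k)) :
    Continuous fun z => ∑ j, ∑ k, dz j (dzbar k (χ j k)) z := by
  refine continuous_finsetSum _ fun j _ => continuous_finsetSum _ fun k _ => ?_
  have h2 : ContDiff ℝ 2 (χ j k) := (hχ j k).1.of_le (WithTop.coe_le_coe.2 (le_top : (2 : ℕ∞) ≤ ⊤))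
  have h1 := (contDiff_dzbar h2 k).continuous_fderiv (by norm_num)
  exact ((h1.clm_apply continuous_const).sub
    (continuous_const.mul (h1.clm_apply continuous_const))).div_const 2

theorem hasCompactSupport_sum_dz_dzbar {χ : Fin m → Fin m → Cn m → ℂ}
    (hχ : ∀ j k, IsTestFunction (χ j k)) :
    HasCompactSupport fun z => ∑ j, ∑ k, dz j (dzbar k (χ j k)) z := by
  have hd : ∀ {f : Cn m → ℂ}, HasCompactSupport f → ∀ (c : ℂ) (v w : Cn m),
      HasCompactSupport fun z => (fderiv ℝ f z v + c * fderiv ℝ f z w) / 2 := by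
    intro f hf c v w
    have h1 : HasCompactSupport fun z => fderiv ℝ f z v := hf.fderiv_apply ℝ v
    have h2 : HasCompactSupport fun z => fderiv ℝ f z w := hf.fderiv_apply ℝ w
    have h3 : HasCompactSupport fun z => c * fderiv ℝ f z w := h2.mul_left
    simp only [div_eq_mul_inv]
    exact (h1.add h3).mul_right
  have hdz : ∀ j {f : Cn m → ℂ}, HasCompactSupport f → HasCompactSupport (dz j f) := by
    intro j f hf
    have := hd hf (-Complex.I) (stdVec j) (Complex.I • stdVec j)
    simp only [neg_mul, ← sub_eq_add_neg] at this
    exact this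
  have hsum : ∀ {ι : Type} [Fintype ι] {f : ι → Cn m → ℂ}, (∀ i, HasCompactSupport (f i)) →
      HasCompactSupport fun z => ∑ i, f i z := by
    intro ι _ f hf
    refine HasCompactSupport.intro (K := ⋃ i, tsupport (f i)) (isCompact_iUnion hf) fun z hz => ?_
    refine Finset.sum_eq_zero fun i _ => image_eq_zero_of_notMem_tsupport fun h => hz ?_
    exact Set.mem_iUnion.2 ⟨i, h⟩
  exact hsum fun j => hsum fun k => hdz j (hd (hχ j k).2 _ _ _)

theorem TendstoL1Loc.tendsto_integral_mul {u : ℕ → Cn m → EReal} {v : Cn m → EReal}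
    (h : TendstoL1Loc u v) {g : Cn m → ℂ} (hg : Continuous g) (hgs : HasCompactSupport g) :
    Tendsto (fun n => ∫ z, ((u n z).toReal : ℂ) * g z) atTop (𝓝 (∫ z, ((v z).toReal : ℂ) * g z)) := by
  obtain ⟨hv, hu, hlim⟩ := h
  have hint : ∀ {w : Cn m → EReal}, IsL1Loc w → Integrable fun z => ((w z).toReal : ℂ) * g z :=
    fun hw => by
      simpa using hw.2.integrable_smul_right_of_hasCompactSupport hg hgs
  obtain ⟨M, hM⟩ := hg.bounded_above_of_compact_support hgs
  refine tendsto_integral_of_L1' _ (hint hv).aestronglyMeasurable (hu.mono fun n hn => hint hn) ?_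
  have h1 : ∀ n, eLpNorm ((fun z => ((u n z).toReal : ℂ) * g z) - fun z => ((v z).toReal : ℂ) * g z)
      1 volume ≤ (∫⁻ z in tsupport g, ‖(u n z).toReal - (v z).toReal‖ₑ) * ENNReal.ofReal M := by
    intro n
    rw [eLpNorm_one_eq_lintegral_enorm, ← lintegral_mul_const' _ _ ENNReal.ofReal_ne_top,
      ← lintegral_indicator (isClosed_tsupport g).measurableSet]
    refine lintegral_mono fun z => ?_
    by_cases hz : z ∈ tsupport g
    · rw [Set.indicator_of_mem hz, Pi.sub_apply, ← sub_mul, enorm_mul, ← Complex.ofReal_sub]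
      have : ‖g z‖ₑ ≤ ENNReal.ofReal M := by
        rw [← ofReal_norm]; exact ENNReal.ofReal_le_ofReal (hM z)
      refine mul_le_mul' (le_of_eq ?_) this
      rw [← ofReal_norm, Complex.norm_real, ofReal_norm]
    · rw [Pi.sub_apply, image_eq_zero_of_notMem_tsupport hz]; simp
  have h2 := ENNReal.Tendsto.mul_const (hlim _ hgs) (Or.inr (ENNReal.ofReal_ne_top (r := M)))
  rw [zero_mul] at h2
  exact tendsto_of_tendsto_of_tendsto_of_le_of_le tendsto_const_nhds h2 (fun _ => zero_le) h1

theorem TendstoL1Loc.tendsto_ddcPairing {u : ℕ → Cn m → EReal} {v : Cn m → EReal}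
    (h : TendstoL1Loc u v) {χ : Fin m → Fin m → Cn m → ℂ} (hχ : ∀ j k, IsTestFunction (χ j k)) :
    Tendsto (fun n => ddcPairing (u n) χ) atTop (𝓝 (ddcPairing v χ)) :=
  (h.tendsto_integral_mul (continuous_sum_dz_dzbar hχ)
    (hasCompactSupport_sum_dz_dzbar hχ)).const_mul _

/-- Convergence in `L¹_loc` implies convergence of positive currents. -/
theorem TendstoL1Loc.ddcTendsto {u : ℕ → Cn m → EReal} {v : Cn m → EReal}
    (h : TendstoL1Loc u v) (hu : ∀ᶠ n in atTop, IsPositiveDdc (u n)) : DdcTendsto u v := by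
  refine ⟨⟨h.1, fun ξ χ hχ h0 => ?_⟩, hu, fun χ hχ => h.tendsto_ddcPairing hχ⟩
  -- The limit inherits positivity, since each pairing with a nonnegative test function is a limit
  -- of nonnegative reals.
  have hlim := h.tendsto_ddcPairing (χ := fun j k z => ξ j * conj (ξ k) * (χ z : ℂ))
    fun j k => ⟨contDiff_const.mul hχ.1, hχ.2.mul_left⟩
  refine ⟨?_, ?_⟩
  · refine ge_of_tendsto ((Complex.continuous_re.tendsto _).comp hlim) ?_
    filter_upwards [hu] with n hn using (hn.2 ξ χ hχ h0).1
  · refine tendsto_nhds_unique ((Complex.continuous_im.tendsto _).comp hlim) ?_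
    refine tendsto_const_nhds.congr' ?_
    filter_upwards [hu] with n hn using (hn.2 ξ χ hχ h0).2.symm

end Pluripotential

/-! ### Random polynomials as mappings with one component, and the conclusion -/

namespace Pluripotential

theorem potential_eq_potentialMap {m n : ℕ} (p : MultiIndex m n → MvPolynomial (Fin m) ℂ)
    (c : MultiIndex m n → ℂ) : potential p c = potentialMap p fun _ : Fin 1 => c := by
  funext z
  unfold potential potentialMap
  rw [Fin.sum_univ_one, Real.sqrt_sq (norm_nonneg _)]

theorem IsIIDAdmissible.fin_one {m : ℕ} {Ω : Type*} [MeasurableSpace Ω] {P : Measure Ω}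
    {a : (n : ℕ) → MultiIndex m n → Ω → ℂ}
    (h : IsIIDAdmissible P fun i : (Σ n : ℕ, MultiIndex m n) => a i.1 i.2) :
    IsIIDAdmissible P fun i : (Σ n : ℕ, Fin 1 × MultiIndex m n) => a i.1 i.2.2 := by
  obtain ⟨h1, h2, μ, hμ, h3⟩ := h
  refine ⟨fun i => h1 ⟨i.1, i.2.2⟩, ?_, μ, hμ, fun i => h3 ⟨i.1, i.2.2⟩⟩
  refine h2.precomp (g := fun i : (Σ n : ℕ, Fin 1 × MultiIndex m n) =>
    (⟨i.1, i.2.2⟩ : Σ n : ℕ, MultiIndex m n)) ?_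
  rintro ⟨n, j, ν⟩ ⟨n', j', ν'⟩ hij
  obtain ⟨rfl, hν⟩ := Sigma.mk.inj_iff.1 hij
  obtain rfl : ν = ν' := eq_of_heq hν
  rw [Subsingleton.elim j j']

namespace IsWeightedSet

variable {m k : ℕ} {Y : Set (Cn m)} {Q : Cn m → ℝ} {τ : Measure (Cn m)}
  {p : (n : ℕ) → MultiIndex m n → MvPolynomial (Fin m) ℂ} {Ω : Type*} [MeasurableSpace Ω]
  {P : Measure Ω} {a : (n : ℕ) → Fin k → MultiIndex m n → Ω → ℂ}

theorem ae_tendstoL1Loc_and_ddcTendsto [IsProbabilityMeasure P] (h : IsWeightedSet Y Q)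
    (hτ : IsWeightedMeasure Y Q τ) (hp : ∀ᶠ n in atTop, IsOrthonormalBasis Y Q τ n (p n))
    (hk : 0 < k)
    (ha : IsIIDAdmissible P fun i : (Σ n : ℕ, Fin k × MultiIndex m n) => a i.1 i.2.1 i.2.2) :
    ∀ᵐ ω ∂P,
      TendstoL1Loc (fun n => potentialMap (p n) (fun j ν => a n j ν ω))
        (uscReg (extremalFunction Y Q)) ∧
      DdcTendsto (fun n => potentialMap (p n) (fun j ν => a n j ν ω))
        (uscReg (extremalFunction Y Q)) := by
  filter_upwards [h.ae_tendstoL1Loc hτ hp hk ha] with ω hω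
  refine ⟨hω, hω.ddcTendsto ?_⟩
  filter_upwards [hω.2.1, eventually_ge_atTop 1] with n hn hn1
  exact isPositiveDdc_potentialMap hn1 _ _ hn

end IsWeightedSet

end Pluripotential

theorem mainTheorem7 {m : ℕ} (Y : Set (Cn m)) (hYclosed : IsClosed Y)
    (hYunbounded : ¬ Bornology.IsBounded Y) (hYnonpluripolar : ¬ IsPluripolar Y)
    (Q : Cn m → ℝ) (hQcont : ContinuousOn Q Y) (hQsuper : SuperLogarithmic Y Q)
    (τ : Measure (Cn m)) [IsLocallyFiniteMeasure τ] (hτY : τ Yᶜ = 0)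
    (hτa : ∃ a : ℝ, 0 < a ∧ ∫⁻ z in {z ∈ Y | 1 ≤ ‖z‖}, ENNReal.ofReal (‖z‖ ^ (-a)) ∂τ < ⊤)
    (hBM : ∃ r₀ : ℝ, ∀ r : ℝ, r₀ ≤ r → WeightedBernsteinMarkov {z ∈ Y | ‖z‖ ≤ r} Q τ) :
    -- orthonormal bases exist for all large `n`
    (∀ᶠ n : ℕ in atTop,
      (∀ q : MvPolynomial (Fin m) ℂ, q.totalDegree ≤ n →
        IntegrableOn (fun z => ‖peval q z‖ ^ 2 * Real.exp (-(2 * n * Q z))) Y τ) ∧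
      ∃ p : MultiIndex m n → MvPolynomial (Fin m) ℂ, IsOrthonormalBasis Y Q τ n p) ∧
    -- the estimate for the Bergman kernel on the diagonal
    (∀ ε : ℝ, 0 < ε → ∃ C₁ C₂ : ℝ, 0 < C₁ ∧ 0 < C₂ ∧
      ∀ n : ℕ, 1 ≤ n → ∀ p : MultiIndex m n → MvPolynomial (Fin m) ℂ,
        IsOrthonormalBasis Y Q τ n p → ∀ z : Cn m,
          1 / (C₁ * (1 + ε) ^ (2 * n) * ((m + n).choose n : ℝ)) ≤
              bergmanDiag p z / phi Y Q n z ^ 2 ∧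
            bergmanDiag p z / phi Y Q n z ^ 2 ≤
              C₂ * (1 + ε) ^ (2 * n) * ((m + n).choose n : ℝ)) ∧
    ∀ p : (n : ℕ) → MultiIndex m n → MvPolynomial (Fin m) ℂ,
      (∀ᶠ n in atTop, IsOrthonormalBasis Y Q τ n (p n)) →
      -- pointwise asymptotics of the Bergman kernel
      (∀ z : Cn m, Tendsto
        (fun n : ℕ => ((1 / (2 * (n : ℝ)) * Real.log (bergmanDiag (p n) z) : ℝ) : EReal))
        atTop (𝓝 (extremalFunction Y Q z))) ∧
      -- random polynomials
      (∀ (Ω : Type*) [MeasurableSpace Ω] (P : Measure Ω) [IsProbabilityMeasure P]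
        (a : (n : ℕ) → MultiIndex m n → Ω → ℂ),
        IsIIDAdmissible P (fun i : (Σ n : ℕ, MultiIndex m n) => a i.1 i.2) →
        (∀ᵐ ω ∂P, ∀ z : Cn m,
          uscReg (fun w => limsup (fun n => potential (p n) (fun ν => a n ν ω) w) atTop) z =
            uscReg (extremalFunction Y Q) z) ∧
        (∀ᵐ ω ∂P,
          TendstoL1Loc (fun n => potential (p n) (fun ν => a n ν ω))
            (uscReg (extremalFunction Y Q)) ∧
          DdcTendsto (fun n => potential (p n) (fun ν => a n ν ω))
            (uscReg (extremalFunction Y Q)))) ∧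
      -- random polynomial mappings
      (∀ (k : ℕ), 1 ≤ k → k ≤ m →
        ∀ (Ω : Type*) [MeasurableSpace Ω] (P : Measure Ω) [IsProbabilityMeasure P]
        (a : (n : ℕ) → Fin k → MultiIndex m n → Ω → ℂ),
        IsIIDAdmissible P
          (fun i : (Σ n : ℕ, Fin k × MultiIndex m n) => a i.1 i.2.1 i.2.2) →
        (∀ᵐ ω ∂P, ∀ z : Cn m,
          uscReg (fun w => limsup (fun n => potentialMap (p n) (fun j ν => a n j ν ω) w) atTop) z =
            uscReg (extremalFunction Y Q) z) ∧
        (∀ᵐ ω ∂P,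
          TendstoL1Loc (fun n => potentialMap (p n) (fun j ν => a n j ν ω))
            (uscReg (extremalFunction Y Q)) ∧
          DdcTendsto (fun n => potentialMap (p n) (fun j ν => a n j ν ω))
            (uscReg (extremalFunction Y Q)))) := by
  have h : IsWeightedSet Y Q := ⟨hYclosed, hYunbounded, hYnonpluripolar, hQcont, hQsuper⟩
  have hτ : IsWeightedMeasure Y Q τ := ⟨inferInstance, hτa, hBM⟩
  refine ⟨h.exists_isOrthonormalBasis hτ, fun ε hε => h.bergmanDiag_div_phi_sq hτ hε,
    fun p hp => ⟨fun z => ?_, fun Ω _ P _ a ha => ?_, fun k hk _ Ω _ P _ a ha =>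
      ⟨h.ae_uscReg_limsup_potentialMap hτ hp hk ha, h.ae_tendstoL1Loc_and_ddcTendsto hτ hp hk ha⟩⟩⟩
  · rw [← h.coe_toReal_extremalFunction]
    exact (continuous_coe_real_ereal.tendsto _).comp (h.tendsto_log_bergmanDiag hτ p hp z)
  · simp only [potential_eq_potentialMap]
    exact ⟨h.ae_uscReg_limsup_potentialMap (a := fun n _ ν => a n ν) hτ hp one_pos ha.fin_one,
      h.ae_tendstoL1Loc_and_ddcTendsto (a := fun n _ ν => a n ν) hτ hp one_pos ha.fin_one⟩
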